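/- Let $D$ be a connected Lie group whose Lie algebra $\mathfrak d=\mathrm{Lie}(D)$ carries a non-degenerate symmetric invariant bilinear form $\langle\cdot,\cdot\rangle_{\mathfrak d}$, and let $G\subset D$ be a connected closed subgroup whose Lie algebra $\mathfrak g$ is Lagrangian, $\mathfrak g=\mathfrak g^{\perp}$. Let $S=D/G$ with the smooth structure for which $\pi_0:D\to S$ is a smooth submersion, let $\rho_s(x)=\frac{d}{dt}\big|_{0}\exp(tx)\cdot s$ be the infinitesimal left action of $\mathfrak d$ on $S$, viewed as a bundle map $\rho:S\times\mathfrak d\to TS$, and let $\rho^*:T^*S\to S\times\mathfrak d$ be given by $\langle\rho^*\xi,x\rangle_{\mathfrak d}=\xi(\rho(x))$. On $C^\infty(S,\mathfrak d)$ define the bracket $$\langle[\psi,\psi']_E,\psi''\rangle_{\mathfrak d}=\langle\mathcal L_{\rho(\psi)}\psi'-\mathcal L_{\rho(\psi')}\psi-[\psi,\psi']_{\mathfrak d},\psi''\rangle_{\mathfrak d}+\langle\mathcal L_{\rho(\psi'')}\psi,\psi'\rangle_{\mathfrak d},$$ which makes $E=S\times\mathfrak d$ an exact Courant algebroid with anchor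 $\rho$. For a vector bundle $V\to M$ with a non-degenerate pairing $\langle\cdot,\cdot\rangle$, anchor $\rho$ and bracket $[\cdot,\cdot]$ forming a Courant algebroid, a Courant algebroid connection is an $\mathbb R$-bilinear map $\nabla:\Gamma(V)\times\Gamma(V)\to\Gamma(V)$ with $\nabla_{f\psi}\psi'=f\nabla_\psi\psi'$, $\nabla_\psi(f\psi')=f\nabla_\psi\psi'+(\mathcal L_{\rho(\psi)}f)\psi'$ and $\mathcal L_{\rho(\psi)}\langle\psi',\psi''\rangle=\langle\nabla_\psi\psi',\psi''\rangle+\langle\psi',\nabla_\psi\psi''\rangle$. For a generalized metric (maximal positive subbundle) $V_+\subset V$, $\mathrm{LC}(V,V_+)$ is the set of such $\nabla$ with $\nabla_\psi\Gamma(V_+)\subset\Gamma(V_+)$ for all $\psi$ and with vanishing torsion $T_\nabla(\psi,\psi',\psi'')=\langle\nabla_\psi\psi'-\nabla_{\psi'}\psi-[\psi,\psi'],\psi''\rangle+\langle\nabla_{\psi''}\psi,\psi'\rangle$. Put $$R^{(0)}_\nabla(\phi',\phi,\psi,\psi')=\langle\phi',\nabla_\psi\nabla_{\psi'}\phi-\nabla_{\psi'}\nabla_\psi\phi-\nabla_{[\psi,\psi']}\phi\rangle,\qquad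 \langle\mathbf K(\psi,\psi'),\phi\rangle=\langle\nabla_\phi\psi,\psi'\rangle,$$ $$2R_\nabla(\phi',\phi,\psi,\psi')=R^{(0)}_\nabla(\phi',\phi,\psi,\psi')+R^{(0)}_\nabla(\psi',\psi,\phi,\phi')+\langle\mathbf K(\psi,\psi'),\mathbf K(\phi,\phi')\rangle,$$ $\mathrm{Ric}_\nabla(\psi,\psi')=\sum_\mu R_\nabla(\psi^\mu,\psi,\psi_\mu,\psi')$ for a local frame $(\psi_\mu)$ and its dual frame $(\psi^\mu)$, $\langle\psi^\mu,\psi_\nu\rangle=\delta^\mu_\nu$. With $V_-=V_+^{\perp}$ and $\mathbf G=\langle\cdot,\cdot\rangle|_{V_+}-\langle\cdot,\cdot\rangle|_{V_-}$, let $\mathcal R^+_\nabla=\mathrm{Tr}_{\mathbf G}(\mathrm{Ric}_\nabla)$. Let $\mathcal E_+\subset\mathfrak d$ be a maximal positive subspace, $\mathcal E_-=\mathcal E_+^\perp$, and let $\nabla^0\in\mathrm{LC}(\mathfrak d,\mathcal E_+)$ be any Levi-Civita connection on the Courant algebroid $(\mathfrak d,0,\langle\cdot,\cdot\rangle_{\mathfrak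 d},-[\cdot,\cdot]_{\mathfrak d})$ over the point. Let $\nabla^E$ be its unique extension to a Courant algebroid connection on $E$, $\nabla^E_\psi\psi'=\mathcal L_{\rho(\psi)}\psi'+\nabla^0_\psi\psi'$. Let $\sigma:TS\to E$ be any isotropic splitting ($\sigma$ a smooth bundle map, $\rho\circ\sigma=1$, isotropic image), and let $\mathbf\Psi_\sigma(X,\xi)=\sigma(X)+\rho^*(\xi)$ be the induced isomorphism from $\mathbb TS=TS\oplus T^*S$, with pairing $\langle(X,\xi),(Y,\eta)\rangle=\eta(X)+\xi(Y)$, anchor the projection to $TS$, and bracket $$[(X,\xi),(Y,\eta)]=([X,Y],\ \mathcal L_X\eta-i_Yd\xi-H_\sigma(X,Y,\cdot)),\qquad H_\sigma(X,Y,Z)=-\langle[\sigma X,\sigma Y]_E,\sigma Z\rangle_{\mathfrak d},$$ onto $E$. Put $V_\pm^\sigma=\mathbf\Psi_\sigma^{-1}(S\times\mathcal E_\pm)$ and $\nabla^\sigma_\psi\psi'=\mathbf\Psi_\sigma^{-1}(\nabla^E_{\mathbf\Psi_\sigma\psi}\mathbf\Psi_\sigma\psi')$. Then $\nabla^\sigma\in\mathrm{LC}(\mathbb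 TS,V_+^\sigma)$; the generalized scalar curvature $\mathcal R^+_{\nabla^\sigma}\in C^\infty(S)$ is the constant function $\mathcal R^+_{\nabla^0}$; and $\mathrm{Ric}_{\nabla^\sigma}(V_+^\sigma,V_-^\sigma)=0$ if and only if $\mathrm{Ric}_{\nabla^0}(\mathcal E_+,\mathcal E_-)=0$. -/

import Mathlib

open Bundle Manifold VectorField
open scoped ContDiff Topology

noncomputable section

namespace PoissonLie

/-! ## Courant algebroid connections and their curvature -/

section Courant

variable {E : Type*} [NormedAddCommGroup E] [NormedSpace ℝ E]
  {H : Type*} [TopologicalSpace H] (I : ModelWithCorners ℝ E H)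
  {M : Type*} [TopologicalSpace M] [ChartedSpace H M]
  (F : Type*) [NormedAddCommGroup F] [NormedSpace ℝ F]
  (V : M → Type*) [∀ x, AddCommGroup (V x)] [∀ x, Module ℝ (V x)]

/-- The operations of a Courant algebroid on a vector bundle `V → M`: fibrewise pairing,
anchor and bracket. (The bracket is only meaningful on smooth sections. No axioms are recorded:
this structure is only used to name the operations of the concrete Courant algebroids
`quadraticLie` and `twistedDorfman` defined below.) -/
structure CourantOps where
  /-- the fibrewise pairing `⟨·,·⟩_E` -/
  pairing : ∀ x, LinearMap.BilinForm ℝ (V x)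
  /-- the anchor `ρ : V → TM` -/
  anchor : ∀ x, V x →ₗ[ℝ] TangentSpace I x
  /-- the bracket `[·,·]_E` of sections -/
  bracket : (∀ x, V x) → (∀ x, V x) → ∀ x, V x

variable [TopologicalSpace (TotalSpace F V)] [∀ x, TopologicalSpace (V x)] [FiberBundle F V]

/-- `ψ ∈ Γ(V)`: a smooth section. -/
def IsSection (ψ : ∀ x, V x) : Prop :=
  ContMDiff I (I.prod 𝓘(ℝ, F)) ∞ (fun x => TotalSpace.mk' F x (ψ x))

variable {V}

/-- `(e_μ)` and `(f^μ)` are smooth sections which restrict, on a neighbourhood of `x`, to local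
frames of `V` with `g(f^μ, e_ν) = δ^μ_ν`. -/
structure IsDualFrameAt (g : ∀ y, LinearMap.BilinForm ℝ (V y)) (x : M)
    (f e : Fin (Module.finrank ℝ F) → ∀ y, V y) : Prop where
  smooth_left : ∀ μ, IsSection I F V (f μ)
  smooth_right : ∀ μ, IsSection I F V (e μ)
  dual : ∀ᶠ y in 𝓝 x, ∀ μ ν, g y (f μ y) (e ν y) = if μ = ν then 1 else 0

open Classical in
/-- The trace `∑_μ T(f^μ, e_μ)` at `x` over a pair of local frames dual with respect to `g`. It
does not depend on the frames if `T` is a tensor. -/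
def frameTrace (g : ∀ y, LinearMap.BilinForm ℝ (V y))
    (T : (∀ y, V y) → (∀ y, V y) → M → ℝ) (x : M) : ℝ :=
  if h : ∃ p : (Fin (Module.finrank ℝ F) → ∀ y, V y) × (Fin (Module.finrank ℝ F) → ∀ y, V y),
      IsDualFrameAt I F g x p.1 p.2
  then ∑ μ, T (h.choose.1 μ) (h.choose.2 μ) x
  else 0

variable {I}
variable (C : CourantOps I V)

/-- The Lie derivative `L_{ρ(ψ)} h` of a function along the anchor of a section. -/
def CourantOps.lieFun (ψ : ∀ x, V x) (h : M → ℝ) (x : M) : ℝ :=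
  mvfderiv I h x (C.anchor x (ψ x))

/-- `∇` is a Courant algebroid connection: an `ℝ`-bilinear map `Γ(V) × Γ(V) → Γ(V)` with the
Leibniz rule in the second argument, `C^∞(M)`-linear in the first, and compatible with the
pairing. (`ℝ`-homogeneity is the case of constant functions of the two rules.) -/
structure IsCourantConnection
    (D : (∀ x, V x) → (∀ x, V x) → ∀ x, V x) : Prop where
  smooth : ∀ ψ φ, IsSection I F V ψ → IsSection I F V φ → IsSection I F V (D ψ φ)
  add_left : ∀ ψ ψ' φ, IsSection I F V ψ → IsSection I F V ψ' → IsSection I F V φ →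
    D (ψ + ψ') φ = D ψ φ + D ψ' φ
  add_right : ∀ ψ φ φ', IsSection I F V ψ → IsSection I F V φ → IsSection I F V φ' →
    D ψ (φ + φ') = D ψ φ + D ψ φ'
  smul_left : ∀ (h : M → ℝ) ψ φ, ContMDiff I 𝓘(ℝ, ℝ) ∞ h → IsSection I F V ψ →
    IsSection I F V φ → D (fun x => h x • ψ x) φ = fun x => h x • D ψ φ x
  leibniz : ∀ (h : M → ℝ) ψ φ, ContMDiff I 𝓘(ℝ, ℝ) ∞ h → IsSection I F V ψ →
    IsSection I F V φ →
    D ψ (fun x => h x • φ x) = fun x => h x • D ψ φ x + C.lieFun ψ h x • φ x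
  metric : ∀ ψ φ φ', IsSection I F V ψ → IsSection I F V φ → IsSection I F V φ' → ∀ x,
    C.lieFun ψ (fun y => C.pairing y (φ y) (φ' y)) x =
      C.pairing x (D ψ φ x) (φ' x) + C.pairing x (φ x) (D ψ φ' x)

/-- The torsion `T_∇(ψ,ψ',ψ'')` of a Courant algebroid connection. -/
def CourantOps.torsion (D : (∀ x, V x) → (∀ x, V x) → ∀ x, V x) (ψ ψ' ψ'' : ∀ x, V x) (x : M) :
    ℝ :=
  C.pairing x (D ψ ψ' x - D ψ' ψ x - C.bracket ψ ψ' x) (ψ'' x) + C.pairing x (D ψ'' ψ x) (ψ' x)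

/-- `∇ ∈ LC(V, V₊)`: a torsion-free Courant algebroid connection preserving `Γ(V₊)`. -/
structure IsLeviCivita (Vp : ∀ x, Submodule ℝ (V x))
    (D : (∀ x, V x) → (∀ x, V x) → ∀ x, V x) : Prop extends IsCourantConnection F C D where
  torsion_eq_zero : ∀ ψ ψ' ψ'', IsSection I F V ψ → IsSection I F V ψ' → IsSection I F V ψ'' →
    ∀ x, C.torsion D ψ ψ' ψ'' x = 0
  preserves : ∀ ψ φ, IsSection I F V ψ → IsSection I F V φ → (∀ x, φ x ∈ Vp x) →
    ∀ x, D ψ φ x ∈ Vp x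

/-- `R^{(0)}_∇(φ',φ,ψ,ψ') = ⟨φ', ∇_ψ ∇_ψ' φ - ∇_ψ' ∇_ψ φ - ∇_{[ψ,ψ']} φ⟩`. -/
def CourantOps.curvatureZero (D : (∀ x, V x) → (∀ x, V x) → ∀ x, V x) (φ' φ ψ ψ' : ∀ x, V x)
    (x : M) : ℝ :=
  C.pairing x (φ' x) (D ψ (D ψ' φ) x - D ψ' (D ψ φ) x - D (C.bracket ψ ψ') φ x)

open Classical in
/-- The section `K(ψ,ψ')`, defined by `⟨K(ψ,ψ'), φ⟩ = ⟨∇_φ ψ, ψ'⟩` for all sections `φ`. -/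
def CourantOps.K (D : (∀ x, V x) → (∀ x, V x) → ∀ x, V x) (ψ ψ' : ∀ x, V x) (x : M) : V x :=
  if h : ∃ k : V x, ∀ φ, IsSection I F V φ →
      C.pairing x k (φ x) = C.pairing x (D φ ψ x) (ψ' x)
  then h.choose else 0

/-- The generalized Riemann tensor `R_∇(φ',φ,ψ,ψ')`. -/
def CourantOps.riemann (D : (∀ x, V x) → (∀ x, V x) → ∀ x, V x) (φ' φ ψ ψ' : ∀ x, V x) (x : M) :
    ℝ :=
  (C.curvatureZero D φ' φ ψ ψ' x + C.curvatureZero D ψ' ψ φ φ' x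
    + C.pairing x (C.K F D ψ ψ' x) (C.K F D φ φ' x)) / 2

/-- The generalized Ricci tensor `Ric_∇(ψ,ψ') = R_∇(ψ^μ, ψ, ψ_μ, ψ')`, for any local frame
`(ψ_μ)` and its dual frame `(ψ^μ)` with respect to the pairing. -/
def CourantOps.ricci (D : (∀ x, V x) → (∀ x, V x) → ∀ x, V x) (ψ ψ' : ∀ x, V x) (x : M) : ℝ :=
  frameTrace I F C.pairing (fun f e => C.riemann F D f ψ e ψ') x

/-- `V₋ = V₊^⊥`. -/
def CourantOps.perp (Vp : ∀ x, Submodule ℝ (V x)) (x : M) : Submodule ℝ (V x) :=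
  (C.pairing x).orthogonal (Vp x)

open Classical in
/-- The projection of `V = V₊ ⊕ V₋` onto `V₊`. -/
def CourantOps.projPlus (Vp : ∀ x, Submodule ℝ (V x)) (x : M) : V x →ₗ[ℝ] V x :=
  if h : IsCompl (Vp x) (C.perp Vp x)
  then (Vp x).projection (C.perp Vp x) h
  else 0

/-- The fibrewise metric `G = ⟨·,·⟩|_{V₊} - ⟨·,·⟩|_{V₋}` on `V = V₊ ⊕ V₋`. -/
def CourantOps.genMetric (Vp : ∀ x, Submodule ℝ (V x)) (x : M) : LinearMap.BilinForm ℝ (V x) :=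
  (C.pairing x).comp (C.projPlus Vp x) (C.projPlus Vp x)
    - (C.pairing x).comp (LinearMap.id - C.projPlus Vp x) (LinearMap.id - C.projPlus Vp x)

/-- The generalized scalar curvature `R⁺_∇ = Tr_G(Ric_∇)`. -/
def CourantOps.scalarPlus (Vp : ∀ x, Submodule ℝ (V x))
    (D : (∀ x, V x) → (∀ x, V x) → ∀ x, V x) (x : M) : ℝ :=
  frameTrace I F (C.genMetric Vp) (C.ricci F D) x

/-- `Ric_∇(V₊, V₋) = 0`. -/
def CourantOps.RicciMixedVanishes (Vp : ∀ x, Submodule ℝ (V x))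
    (D : (∀ x, V x) → (∀ x, V x) → ∀ x, V x) : Prop :=
  ∀ ψ φ, IsSection I F V ψ → IsSection I F V φ → (∀ x, ψ x ∈ Vp x) →
    (∀ x, φ x ∈ C.perp Vp x) → ∀ x, C.ricci F D ψ φ x = 0

end Courant

/-! ## Manin pairs and group pairs -/

section Group

variable {E : Type*} [NormedAddCommGroup E] [NormedSpace ℝ E]
  (D : Type*) [TopologicalSpace D] [ChartedSpace E D] [Group D]

/-- The bracket of the Lie algebra `𝔡 = Lie(D) = T₁D`. The vector space `T₁D` is by definition
the model space `E` of `D`; the bracket is the one of left-invariant vector fields. -/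
def lieD (x y : E) : E :=
  let x' : GroupLieAlgebra 𝓘(ℝ, E) D := x
  let y' : GroupLieAlgebra 𝓘(ℝ, E) D := y
  (⁅x', y'⁆ : GroupLieAlgebra 𝓘(ℝ, E) D)

/-- The Lie algebra of a closed subgroup `G` of `D`, as a subset of `𝔡 = T₁D`: the velocities at
`1` of the smooth curves of `D` which lie in `G`. -/
def lieSubgroup {D : Type*} [TopologicalSpace D] [ChartedSpace E D] [Group D]
    (G : Subgroup D) : Set E :=
  {x | ∃ γ : ℝ → D, ContMDiff 𝓘(ℝ, ℝ) 𝓘(ℝ, E) ∞ γ ∧ γ 0 = 1 ∧ (∀ t, γ t ∈ G) ∧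
    (mfderiv 𝓘(ℝ, ℝ) 𝓘(ℝ, E) γ 0 (1 : ℝ) : E) = x}

/-- `b` is a non-degenerate symmetric invariant bilinear form on the Lie algebra of `D`. -/
structure IsQuadratic (b : LinearMap.BilinForm ℝ E) : Prop where
  symm : ∀ x y, b x y = b y x
  nondegenerate : b.Nondegenerate
  invariant : ∀ x y z, b (lieD D x y) z + b y (lieD D x z) = 0

/-- `Wp` is a generalized metric on `(𝔡, b)`, i.e. a maximal positive subspace. -/
def IsMaximalPositive (b : LinearMap.BilinForm ℝ E) (Wp : Submodule ℝ E) : Prop :=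
  Maximal (fun W : Submodule ℝ E => ∀ v ∈ W, v ≠ 0 → 0 < b v v) Wp

/-- The Courant algebroid `(𝔡, 0, ⟨·,·⟩_𝔡, -[·,·]_𝔡)` over the point. -/
def quadraticLie (b : LinearMap.BilinForm ℝ E) :
    CourantOps 𝓘(ℝ, PUnit) (Bundle.Trivial PUnit E) where
  pairing _ := b
  anchor _ := 0
  bracket ψ ψ' s := -lieD D (ψ s) (ψ' s)

/-- A bilinear map `𝔡 × 𝔡 → 𝔡`, viewed as an operation on sections of `𝔡` over the point. -/
def pointConn (D₀ : E →ₗ[ℝ] E →ₗ[ℝ] E) (ψ ψ' : ∀ s, Bundle.Trivial PUnit E s) :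
    ∀ s, Bundle.Trivial PUnit E s :=
  fun s => D₀ (ψ s) (ψ' s)

end Group

/-! ## The exact Courant algebroid on `S × 𝔡`, `S = D/G` -/

section Coset

variable {E : Type*} [NormedAddCommGroup E] [NormedSpace ℝ E]
  {D : Type*} [TopologicalSpace D] [ChartedSpace E D] [Group D] (G : Subgroup D)
  (F : Type*) [NormedAddCommGroup F] [NormedSpace ℝ F] [ChartedSpace F (D ⧸ G)]

/-- The infinitesimal dressing action `ρ_s(x) = #^▷_s(x)`: the derivative at `1`, in the direction
`x ∈ 𝔡 = T₁D`, of the orbit map `d ↦ d ▷ s`, where `d ▷ kG = (dk)G`. -/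
def rho (s : D ⧸ G) : E →L[ℝ] TangentSpace 𝓘(ℝ, F) s :=
  mfderiv 𝓘(ℝ, E) 𝓘(ℝ, F) (fun d : D => d • s) 1

/-- `x ↦ L_{ρ(x)} ψ` at the point `s`, for `x ∈ 𝔡` and `ψ ∈ C^∞(S, 𝔡)`. -/
def lieSec (ψ : D ⧸ G → E) (s : D ⧸ G) : E →L[ℝ] E :=
  (mvfderiv 𝓘(ℝ, F) ψ s).comp (rho G F s)

/-- The unique Courant algebroid connection `∇^E` on `S × 𝔡` which restricts to `∇⁰` on constant
sections: `∇^E_ψ ψ' = L_{ρ(ψ)} ψ' + ∇⁰_ψ ψ'`. -/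
def connE (D₀ : E →ₗ[ℝ] E →ₗ[ℝ] E) (ψ ψ' : D ⧸ G → E) (s : D ⧸ G) : E :=
  lieSec G F ψ' s (ψ s) + D₀ (ψ s) (ψ' s)

/-- `σ : TS → S × 𝔡` is an isotropic splitting of `0 → T^*S → S × 𝔡 → TS → 0`: a smooth vector
bundle map with `ρ ∘ σ = 1` and isotropic image. -/
structure IsIsotropicSplitting [IsManifold 𝓘(ℝ, F) ∞ (D ⧸ G)] (b : LinearMap.BilinForm ℝ E)
    (σ : ∀ s : D ⧸ G, TangentSpace 𝓘(ℝ, F) s →L[ℝ] E) : Prop where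
  smooth : ContMDiff 𝓘(ℝ, F).tangent 𝓘(ℝ, E) ∞
    (fun p : TangentBundle 𝓘(ℝ, F) (D ⧸ G) => σ p.1 p.2)
  rho_comp : ∀ s v, rho G F s (σ s v) = v
  isotropic : ∀ s v w, b (σ s v) (σ s w) = 0

variable [FiniteDimensional ℝ E] {b : LinearMap.BilinForm ℝ E} (hb : b.Nondegenerate)

/-- The bracket of the Courant algebroid `S × 𝔡`:
`⟨[ψ,ψ']_E, ψ''⟩ = ⟨L_{ρ(ψ)}ψ' - L_{ρ(ψ')}ψ - [ψ,ψ']_𝔡, ψ''⟩ + ⟨L_{ρ(ψ'')}ψ, ψ'⟩`. -/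
def bracketE (ψ ψ' : D ⧸ G → E) (s : D ⧸ G) : E :=
  lieSec G F ψ' s (ψ s) - lieSec G F ψ s (ψ' s) - lieD D (ψ s) (ψ' s)
    + (b.toDual hb).symm ((b.flip (ψ' s)).comp (lieSec G F ψ s : E →ₗ[ℝ] E))

/-- The map `ρ^* = g_𝔡^{-1} ∘ ρ^T : T^*S → S × 𝔡`. -/
def rhoStar (s : D ⧸ G) : (TangentSpace 𝓘(ℝ, F) s →L[ℝ] ℝ) →ₗ[ℝ] E where
  toFun ξ := (b.toDual hb).symm ((ξ.comp (rho G F s) : E →L[ℝ] ℝ) : E →ₗ[ℝ] ℝ)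
  map_add' ξ η := by
    rw [← map_add]
    rfl
  map_smul' c ξ := by
    rw [RingHom.id_apply, ← map_smul]
    rfl

end Coset

/-! ## `𝕋S = TS ⊕ T^*S` with the twisted Dorfman bracket -/

section Generalized

variable (F : Type*) [NormedAddCommGroup F] [NormedSpace ℝ F]
  {S : Type*} [TopologicalSpace S] [ChartedSpace F S]

/-- The cotangent bundle `T^*S`. -/
abbrev Cotangent (s : S) : Type _ :=
  TangentSpace 𝓘(ℝ, F) s →L[ℝ] Bundle.Trivial S ℝ s

variable (S) in
/-- The generalized tangent bundle `𝕋S = TS ⊕ T^*S`. -/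
abbrev GenTangent : S → Type _ :=
  (TangentSpace 𝓘(ℝ, F) : S → Type _) ×ᵇ (Cotangent F : S → Type _)

/-- The contraction `i_u dξ` of the exterior derivative of a `1`-form with a tangent vector `u` at
`s`, where `(dξ)_{ij} = ∂_i ξ_j - ∂_j ξ_i` is computed in the preferred chart `φ` at `s`. -/
def extDerivOne (ξ : ∀ s : S, TangentSpace 𝓘(ℝ, F) s →L[ℝ] ℝ) (s : S)
    (u : TangentSpace 𝓘(ℝ, F) s) : TangentSpace 𝓘(ℝ, F) s →L[ℝ] ℝ :=
  let φ := extChartAt 𝓘(ℝ, F) s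
  let ξ' : F → F →L[ℝ] ℝ := fun y =>
    (ξ (φ.symm y)).comp (mfderiv 𝓘(ℝ, F) 𝓘(ℝ, F) φ.symm y)
  let A : F →L[ℝ] F →L[ℝ] ℝ := fderiv ℝ ξ' (φ s)
  let T : TangentSpace 𝓘(ℝ, F) s →L[ℝ] F := mfderiv 𝓘(ℝ, F) 𝓘(ℝ, F) φ s
  (A (T u) - A.flip (T u)).comp T

/-- The Lie derivative of a `1`-form, `L_X η = i_X dη + d(η(X))`. -/
def lieDerivOne (X : ∀ s : S, TangentSpace 𝓘(ℝ, F) s)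
    (η : ∀ s : S, TangentSpace 𝓘(ℝ, F) s →L[ℝ] ℝ) (s : S) : TangentSpace 𝓘(ℝ, F) s →L[ℝ] ℝ :=
  extDerivOne F η s (X s) + mvfderiv 𝓘(ℝ, F) (fun t => η t (X t)) s

/-- The canonical pairing `⟨(X,ξ),(Y,η)⟩ = η(X) + ξ(Y)` of `𝕋S`. -/
def canonicalPairing (s : S) : LinearMap.BilinForm ℝ (GenTangent F S s) :=
  LinearMap.mk₂ ℝ (fun p q => q.2 p.1 + p.2 q.1)
    (fun p p' q => by
      show q.2 (p.1 + p'.1) + (p.2 + p'.2) q.1 = _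
      rw [map_add, add_apply]; exact add_add_add_comm _ _ _ _)
    (fun c p q => by
      show q.2 (c • p.1) + (c • p.2) q.1 = c • (q.2 p.1 + p.2 q.1)
      rw [map_smul, smul_apply, smul_add])
    (fun p q q' => by
      show (q.2 + q'.2) p.1 + p.2 (q.1 + q'.1) = _
      rw [map_add, add_apply]; exact add_add_add_comm _ _ _ _)
    (fun c p q => by
      show (c • q.2) p.1 + p.2 (c • q.1) = c • (q.2 p.1 + p.2 q.1)
      rw [map_smul, smul_apply, smul_add])

/-- `𝕋S` with the canonical pairing, the projection onto `TS` as anchor and the `H`-twisted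
Dorfman bracket `[(X,ξ),(Y,η)] = ([X,Y], L_X η - i_Y dξ - H(X,Y,·))`. The argument `H` is the
operation `(X,Y) ↦ H(X,Y,·)` on vector fields. -/
def twistedDorfman
    (H : (∀ s : S, TangentSpace 𝓘(ℝ, F) s) → (∀ s : S, TangentSpace 𝓘(ℝ, F) s) →
      ∀ s : S, TangentSpace 𝓘(ℝ, F) s →L[ℝ] ℝ) :
    CourantOps 𝓘(ℝ, F) (GenTangent F S) where
  pairing := canonicalPairing F
  anchor s := LinearMap.fst ℝ (TangentSpace 𝓘(ℝ, F) s) (Cotangent F s)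
  bracket ψ ψ' s :=
    (mlieBracket 𝓘(ℝ, F) (fun t => (ψ t).1) (fun t => (ψ' t).1) s,
      lieDerivOne F (fun t => (ψ t).1) (fun t => (ψ' t).2) s
        - extDerivOne F (fun t => (ψ t).2) s (ψ' s).1
        - H (fun t => (ψ t).1) (fun t => (ψ' t).1) s)

end Generalized

/-! ## The data induced on `𝕋S` by a splitting -/

section Induced

variable {E : Type*} [NormedAddCommGroup E] [NormedSpace ℝ E] [FiniteDimensional ℝ E]
  {D : Type*} [TopologicalSpace D] [ChartedSpace E D] [Group D] (G : Subgroup D)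
  (F : Type*) [NormedAddCommGroup F] [NormedSpace ℝ F] [ChartedSpace F (D ⧸ G)]
  {b : LinearMap.BilinForm ℝ E} (hb : b.Nondegenerate)
  (σ : ∀ s : D ⧸ G, TangentSpace 𝓘(ℝ, F) s →L[ℝ] E)

/-- The `3`-form `H_σ(X,Y,Z) = -⟨[σ(X),σ(Y)]_E, σ(Z)⟩_𝔡`. -/
def severaForm (X Y : ∀ s : D ⧸ G, TangentSpace 𝓘(ℝ, F) s) (s : D ⧸ G) :
    TangentSpace 𝓘(ℝ, F) s →L[ℝ] ℝ :=
  -((LinearMap.toContinuousLinearMap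
      (b (bracketE G F hb (fun t => σ t (X t)) (fun t => σ t (Y t)) s)) : E →L[ℝ] ℝ).comp (σ s))

/-- The Courant algebroid `𝕋S` with the `H_σ`-twisted Dorfman bracket. -/
def courantSigma : CourantOps 𝓘(ℝ, F) (GenTangent F (D ⧸ G)) :=
  twistedDorfman F (severaForm G F hb σ)

/-- The isomorphism `Ψ_σ : 𝕋S → S × 𝔡`, `Ψ_σ(X,ξ) = σ(X) + ρ^*(ξ)`. -/
def Psi (s : D ⧸ G) : GenTangent F (D ⧸ G) s →ₗ[ℝ] E :=
  (σ s : TangentSpace 𝓘(ℝ, F) s →ₗ[ℝ] E).coprod (rhoStar G F hb s)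

/-- `V₊^σ = Ψ_σ^{-1}(S × 𝓔₊)`. -/
def Vplus (Wp : Submodule ℝ E) (s : D ⧸ G) : Submodule ℝ (GenTangent F (D ⧸ G) s) :=
  Wp.comap (Psi G F hb σ s)

/-- The connection `∇^σ` on `𝕋S` which corresponds to `∇^E` under the isomorphism `Ψ_σ`:
`∇^σ_ψ ψ' = Ψ_σ^{-1}(∇^E_{Ψ_σ ψ} Ψ_σ ψ')`. -/
def connSigma (D₀ : E →ₗ[ℝ] E →ₗ[ℝ] E) (ψ ψ' : ∀ s, GenTangent F (D ⧸ G) s) (s : D ⧸ G) :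
    GenTangent F (D ⧸ G) s :=
  Function.invFun (Psi G F hb σ s)
    (connE G F D₀ (fun t => Psi G F hb σ t (ψ t)) (fun t => Psi G F hb σ t (ψ' t)) s)

end Induced

end PoissonLie

end

/-! Everything rests on the kernel of the infinitesimal action being Lagrangian at every point of `D
⧸ G`. At the base coset the kernel is the Lie algebra of `G` (`rho_one_eq_zero_iff`); at the coset
of `k` it is the image of that Lie algebra under `Ad k` (`rho_adjointAction`). `Ad k` is an isometry
of `b`, because `b` is invariant and `D` is connected (`adjointAction_isometry`). The result is
`rho_eq_zero_iff_orthogonal`.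

Hence the sequence `T*S → S × 𝔡 → TS` is exact with isotropic image of `ρ*`. An isotropic splitting
makes `Ψ_σ` a fibrewise isometry over the anchors, with inverse `e ↦ (ρ e, b(e, σ ·))`
(`pairing_Psi`, `Psi_inverse_apply`). It also respects brackets (`Psi_bracket`). The inputs are the
formula `[ρψ, ρψ'] = ρ(L_{ρψ}ψ' - L_{ρψ'}ψ - [ψ,ψ'])` (`mlieBracket_rho`), proved by second-order
calculus in charts, and Cartan's formula for `dη` (`extDerivOne_apply`). So `∇^σ` is `∇^E` seen
through an isomorphism. In its torsion the derivative terms of `∇^E` cancel those of the bracket of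
`E`, leaving the torsion of `∇⁰` (`isLeviCivita_connSigma`).

For the curvature, let `τ(e₁,e₂)` be the vector with `⟨τ, z⟩ = ⟨L_{ρ(z)}e₁, e₂⟩`. The curvature
operator of `∇^E` on smooth functions is that of `∇⁰` minus `∇⁰_τ` (`connE_curvature`), and the
section `K` is that of `∇⁰` plus `τ`. In the generalized Riemann tensor the two corrections to
`R^{(0)}` cancel the cross terms of `⟨K, K⟩`, and `⟨τ, τ⟩ = 0` because `τ` lies in the isotropic
image of `ρ*`. What remains is the Riemann tensor of `∇⁰` evaluated on the values of the sections
(`riemann_connSigma`).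

Traces over dual frames do not depend on the frames, and `Ψ_σ` turns constant elements of `𝔡` into
smooth sections. So Ricci and scalar curvature at any point of `S` are computed by `ricciPoint` and
`bilinTrace` on `𝔡`. The same argument over the one-point base gives the same expressions
(`IsTrivialization` covers both cases), and the two sides agree. -/

noncomputable section

namespace PoissonLie

/-! ### Local form of a submersion and second derivatives -/

/-- Around a point where its derivative is surjective, a smooth map is a projection in suitable
coordinates. -/
theorem exists_local_parametrization {E F : Type*} [NormedAddCommGroup E] [NormedSpace ℝ E]
    [FiniteDimensional ℝ E] [NormedAddCommGroup F] [NormedSpace ℝ F] [FiniteDimensional ℝ F]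
    {f : E → F} {e₀ : E} (hf : ∀ᶠ e in 𝓝 e₀, ContDiffAt ℝ ∞ f e)
    (hs : Function.Surjective (fderiv ℝ f e₀)) :
    ∃ Φ : F × (fderiv ℝ f e₀).ker → E, Φ (f e₀, 0) = e₀ ∧
      (∀ᶠ p in 𝓝 (f e₀, 0), ContDiffAt ℝ ∞ Φ p ∧ f (Φ p) = p.1) ∧
      ∀ k, fderiv ℝ Φ (f e₀, 0) (0, k) = k := by
  have : CompleteSpace E := FiniteDimensional.complete ℝ E
  have : CompleteSpace F := FiniteDimensional.complete ℝ F
  set f' := fderiv ℝ f e₀ with hf'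
  obtain ⟨P, hP⟩ := Submodule.ClosedComplemented.of_finiteDimensional (𝕜 := ℝ) f'.ker
  have hPr : (P : E →ₗ[ℝ] f'.ker).range = ⊤ :=
    LinearMap.range_eq_top.2 fun k => ⟨k, hP k⟩
  let g' : E ≃L[ℝ] F × f'.ker := ContinuousLinearMap.equivProdOfSurjectiveOfIsCompl f' P
    (LinearMap.range_eq_top.2 hs) hPr (LinearMap.isCompl_of_proj hP)
  have hg'1 : ∀ e, g' e = (f' e, P e) := fun e => rfl
  -- Complete `f` by a projection onto its kernel, so that the inverse function theorem applies;
  -- subtracting `P e₀` puts the base point at fibre coordinate `0`.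
  let g : E → F × f'.ker := fun e => (f e, P e - P e₀)
  have hg : ∀ᶠ e in 𝓝 e₀, ContDiffAt ℝ ∞ g e := hf.mono fun e he =>
    he.prodMk ((P.contDiff.contDiffAt).sub contDiffAt_const)
  have hg0 : g e₀ = (f e₀, 0) := by simp [g]
  have hgd : HasFDerivAt g (g' : E →L[ℝ] F × f'.ker) e₀ := by
    have h1 : HasFDerivAt f f' e₀ :=
      (hf.self_of_nhds.differentiableAt (by simp)).hasFDerivAt
    exact h1.prodMk ((P.hasFDerivAt).sub_const _)
  have hgs : HasStrictFDerivAt g (g' : E →L[ℝ] F × f'.ker) e₀ :=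
    hg.self_of_nhds.hasStrictFDerivAt' hgd (by simp)
  let θ := hgs.toOpenPartialHomeomorph g
  have hθ : ∀ e, θ e = g e := fun e => rfl
  have hes : e₀ ∈ θ.source := hgs.mem_toOpenPartialHomeomorph_source
  have het : (f e₀, 0) ∈ θ.target := by
    have := θ.map_source hes
    rwa [hθ, hg0] at this
  have hinv : θ.symm (f e₀, 0) = e₀ := by
    rw [← hg0, ← hθ]; exact θ.left_inv hes
  have hcont : Filter.Tendsto θ.symm (𝓝 (f e₀, 0)) (𝓝 e₀) := by
    have := θ.continuousAt_symm het
    rw [ContinuousAt, hinv] at this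
    exact this
  -- Smoothness of the inverse is needed on a neighbourhood and not only at the base point.
  -- Invertible operators form an open set, so the derivative of `g` stays invertible nearby.
  have hiso : ∀ᶠ e in 𝓝 e₀, ∃ A : E ≃L[ℝ] F × f'.ker, fderiv ℝ g e = A := by
    have hc : ContinuousAt (fderiv ℝ g) e₀ :=
      (hg.self_of_nhds.fderiv_right (m := 0) (by simp)).continuousAt
    have := hc.preimage_mem_nhds (t := Set.range ContinuousLinearEquiv.toContinuousLinearMap)
      (by rw [hgd.fderiv]; exact ContinuousLinearEquiv.nhds g')
    filter_upwards [this] with e he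
    obtain ⟨A, hA⟩ := he
    exact ⟨A, hA.symm⟩
  have hgood : ∀ᶠ p in 𝓝 (f e₀, 0), ContDiffAt ℝ ∞ θ.symm p ∧ f (θ.symm p) = p.1 := by
    filter_upwards [hcont.eventually (hg.and hiso), θ.open_target.mem_nhds het]
      with p ⟨h1, A, hA⟩ hp
    refine ⟨θ.contDiffAt_symm hp (f₀' := A) ?_ h1, ?_⟩
    · rw [← hA]
      exact (h1.differentiableAt (by simp)).hasFDerivAt
    · have : g (θ.symm p) = p := θ.right_inv hp
      exact congrArg Prod.fst this
  refine ⟨θ.symm, hinv, hgood, fun k => ?_⟩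
  have hd : HasFDerivAt θ.symm (g'.symm : F × f'.ker →L[ℝ] E) (f e₀, 0) := by
    apply θ.hasFDerivAt_symm het
    rw [hinv]; exact hgd
  rw [hd.fderiv]
  change g'.symm (0, k) = k
  rw [ContinuousLinearEquiv.symm_apply_eq, hg'1, hP]
  congr 1
  exact k.2.symm

/-- Derivative of a second derivative in a fixed direction. -/
theorem hasFDerivAt_fderiv_apply_comp {E F G : Type*} [NormedAddCommGroup E] [NormedSpace ℝ E]
    [NormedAddCommGroup F] [NormedSpace ℝ F] [NormedAddCommGroup G] [NormedSpace ℝ G]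
    {A : F → G} {c : E → F} {c' : E →L[ℝ] F} {u : E} (hA : ContDiffAt ℝ 2 A (c u))
    (hc : HasFDerivAt c c' u) (v : F) :
    HasFDerivAt (fun u => fderiv ℝ A (c u) v)
      ((ContinuousLinearMap.apply ℝ G v) ∘L (fderiv ℝ (fderiv ℝ A) (c u)) ∘L c') u := by
  have h : HasFDerivAt (fderiv ℝ A) (fderiv ℝ (fderiv ℝ A) (c u)) (c u) :=
    ((hA.fderiv_right (m := 1) (by norm_num)).differentiableAt (by simp)).hasFDerivAt
  exact (ContinuousLinearMap.apply ℝ G v).hasFDerivAt.comp u (h.comp u hc)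

theorem fderiv_fderiv_comm {F G : Type*} [NormedAddCommGroup F] [NormedSpace ℝ F]
    [NormedAddCommGroup G] [NormedSpace ℝ G] {A : F → G} {p : F} (hA : ContDiffAt ℝ 2 A p)
    (v w : F) : fderiv ℝ (fderiv ℝ A) p v w = fderiv ℝ (fderiv ℝ A) p w v :=
  (hA.isSymmSndFDerivAt (by simp)).eq v w

/-! ### Second-order identities for local groups and local actions -/

section LocalCalculus

variable {E F : Type*} [NormedAddCommGroup E] [NormedSpace ℝ E]
  [NormedAddCommGroup F] [NormedSpace ℝ F]

theorem eventually_differentiableAt {A : E → F} {p : E} (hA : ContDiffAt ℝ 2 A p) :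
    ∀ᶠ q in 𝓝 p, DifferentiableAt ℝ A q :=
  (hA.eventually (by simp)).mono fun _ h => h.differentiableAt (by simp)

/-- The infinitesimal generators of a local left action `A` of a local group `M`
form an anti-representation, in terms of second derivatives. -/
theorem local_action_bracket {A : E × F → F} {M : E × E → E} {u₀ : E} {y₀ : F}
    (hA : ContDiffAt ℝ 2 A (u₀, y₀)) (hM : ContDiffAt ℝ 2 M (u₀, u₀))
    (hA0 : A (u₀, y₀) = y₀) (hM0 : ∀ᶠ u in 𝓝 u₀, M (u₀, u) = u)
    (hM1 : ∀ᶠ u in 𝓝 u₀, M (u, u₀) = u)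
    (hAM : ∀ᶠ u' in 𝓝 u₀, ∀ᶠ u in 𝓝 u₀, A (u, A (u', y₀)) = A (M (u, u'), y₀)) (x y : E) :
    fderiv ℝ (fderiv ℝ A) (u₀, y₀) (0, fderiv ℝ A (u₀, y₀) (x, 0)) (y, 0)
      - fderiv ℝ (fderiv ℝ A) (u₀, y₀) (0, fderiv ℝ A (u₀, y₀) (y, 0)) (x, 0)
    = -fderiv ℝ A (u₀, y₀) (fderiv ℝ (fderiv ℝ M) (u₀, u₀) (x, 0) (0, y)
        - fderiv ℝ (fderiv ℝ M) (u₀, u₀) (y, 0) (0, x), 0) := by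
  have hM00 : M (u₀, u₀) = u₀ := hM0.self_of_nhds
  -- Differentiate `A (u, A (u', y₀)) = A (M (u, u'), y₀)` in `u` at `u₀` along `y`, and the result
  -- in `u'` at `u₀` along `x`. As the `u`-derivative is taken for fixed `u'`, the neighbourhood of
  -- `u` may shrink with `u'`.
  have key : ∀ x y : E,
      fderiv ℝ (fderiv ℝ A) (u₀, y₀) (0, fderiv ℝ A (u₀, y₀) (x, 0)) (y, 0)
      = fderiv ℝ (fderiv ℝ A) (u₀, y₀) (x, 0) (fderiv ℝ M (u₀, u₀) (y, 0), 0)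
        + fderiv ℝ A (u₀, y₀) (fderiv ℝ (fderiv ℝ M) (u₀, u₀) (0, x) (y, 0), 0) := by
    intro x y
    have c1 : ContinuousAt (fun u' : E => (u₀, A (u', y₀))) u₀ := by
      have : ContinuousAt (fun u' : E => A (u', y₀)) u₀ :=
        ContinuousAt.comp (f := fun u' : E => (u', y₀)) (g := A) hA.continuousAt (by fun_prop)
      exact continuousAt_const.prodMk this
    have hd1 : ∀ᶠ u' in 𝓝 u₀, DifferentiableAt ℝ A (u₀, A (u', y₀)) := by
      have := eventually_differentiableAt hA
      exact c1.eventually (by simpa only [hA0] using this)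
    have hd2 : ∀ᶠ u' in 𝓝 u₀, DifferentiableAt ℝ A (u', y₀) := by
      have c : ContinuousAt (fun u' : E => (u', y₀)) u₀ := by fun_prop
      exact c.eventually (eventually_differentiableAt hA)
    have hd3 : ∀ᶠ u' in 𝓝 u₀, DifferentiableAt ℝ M (u₀, u') := by
      have c : ContinuousAt (fun u' : E => (u₀, u')) u₀ := by fun_prop
      exact c.eventually (eventually_differentiableAt hM)
    have e1 : ∀ᶠ u' in 𝓝 u₀, fderiv ℝ A (u₀, A (u', y₀)) (y, 0)
        = fderiv ℝ A (u', y₀) (fderiv ℝ M (u₀, u') (y, 0), 0) := by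
      filter_upwards [hd1, hd2, hd3, hAM, hM0] with u' h1 h2 h3 h4 h5
      have l : HasFDerivAt (fun u => A (u, A (u', y₀)))
          (fderiv ℝ A (u₀, A (u', y₀)) ∘L (ContinuousLinearMap.inl ℝ E F)) u₀ :=
        h1.hasFDerivAt.comp u₀ (hasFDerivAt_prodMk_left u₀ _)
      have m : HasFDerivAt (fun u => M (u, u'))
          (fderiv ℝ M (u₀, u') ∘L (ContinuousLinearMap.inl ℝ E E)) u₀ :=
        h3.hasFDerivAt.comp u₀ (hasFDerivAt_prodMk_left u₀ _)
      have h2' : HasFDerivAt (fun w => A (w, y₀))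
          (fderiv ℝ A (u', y₀) ∘L (ContinuousLinearMap.inl ℝ E F)) (M (u₀, u')) := by
        rw [h5]
        exact h2.hasFDerivAt.comp u' (hasFDerivAt_prodMk_left u' _)
      have r : HasFDerivAt (fun u => A (M (u, u'), y₀))
          ((fderiv ℝ A (u', y₀) ∘L (ContinuousLinearMap.inl ℝ E F)) ∘L
            (fderiv ℝ M (u₀, u') ∘L (ContinuousLinearMap.inl ℝ E E))) u₀ :=
        HasFDerivAt.comp (g := fun w => A (w, y₀)) (f := fun u => M (u, u')) u₀ h2' m
      have := congrArg (fun T : E →L[ℝ] F => T y) (l.unique (r.congr_of_eventuallyEq h4))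
      simpa using this
    have a0 : HasFDerivAt (fun u' => A (u', y₀))
        (fderiv ℝ A (u₀, y₀) ∘L (ContinuousLinearMap.inl ℝ E F)) u₀ :=
      HasFDerivAt.comp (g := A) (f := fun u => (u, y₀)) u₀
        hd2.self_of_nhds.hasFDerivAt (hasFDerivAt_prodMk_left u₀ y₀)
    have a1 : HasFDerivAt (fun u' => fderiv ℝ A (u₀, A (u', y₀)) (y, 0)) _ u₀ :=
      hasFDerivAt_fderiv_apply_comp (c := fun u' : E => (u₀, A (u', y₀))) (by simpa only [hA0])
        (HasFDerivAt.prodMk (hasFDerivAt_const u₀ u₀) a0) (y, (0 : F))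
    have a2 : HasFDerivAt (fun u' => fderiv ℝ M (u₀, u') (y, 0)) _ u₀ :=
      hasFDerivAt_fderiv_apply_comp (c := fun u' : E => (u₀, u')) hM
        (hasFDerivAt_prodMk_right u₀ u₀) (y, (0 : E))
    have a3 : HasFDerivAt (fun u' => fderiv ℝ A (u', y₀)) _ u₀ :=
      HasFDerivAt.comp (g := fderiv ℝ A) (f := fun u' : E => (u', y₀)) u₀
        (((hA.fderiv_right (m := 1) (by norm_num)).differentiableAt (by simp)).hasFDerivAt)
        (hasFDerivAt_prodMk_left u₀ y₀)
    have a4 := a3.clm_apply (a2.prodMk (hasFDerivAt_const (0 : F) u₀))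
    have := congrArg (fun T => T x) (a1.unique (a4.congr_of_eventuallyEq e1))
    simp only [hA0] at this
    simpa [add_comm] using this
  have hM1 : ∀ y, fderiv ℝ M (u₀, u₀) (y, 0) = y := fun y => by
    have m : HasFDerivAt (fun u => M (u, u₀))
        (fderiv ℝ M (u₀, u₀) ∘L (ContinuousLinearMap.inl ℝ E E)) u₀ :=
      HasFDerivAt.comp (g := M) (f := fun u => (u, u₀)) u₀
        (hM.differentiableAt (by simp)).hasFDerivAt (hasFDerivAt_prodMk_left u₀ u₀)
    have := congrArg (fun T => T y) (m.unique ((hasFDerivAt_id u₀).congr_of_eventuallyEq hM1))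
    simpa using this
  -- Antisymmetrizing in `x`, `y` removes the second derivative of `A` along `(x, 0)`, `(y, 0)`,
  -- which is symmetric; only second derivatives of `M` survive.
  rw [key, key, hM1, hM1, fderiv_fderiv_comm hA (x, 0), fderiv_fderiv_comm hM (x, 0),
    fderiv_fderiv_comm hM (y, 0), add_sub_add_left_eq_sub, ← map_sub, ← map_neg]
  congr 1
  ext <;> simp

/-- The derivative of the local adjoint action `C` is the bracket of the local group `M`. -/
theorem local_adjoint_deriv {C M : E × E → E} {u₀ : E}
    (hC : ContDiffAt ℝ 2 C (u₀, u₀)) (hM : ContDiffAt ℝ 2 M (u₀, u₀))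
    (hM1 : ∀ᶠ u in 𝓝 u₀, M (u, u₀) = u)
    (hC0 : ∀ᶠ u in 𝓝 u₀, C (u₀, u) = u) (hC1 : ∀ᶠ u in 𝓝 u₀, C (u, u₀) = u₀)
    (hCM : ∀ᶠ u in 𝓝 u₀, ∀ᶠ v in 𝓝 u₀, M (C (u, v), u) = M (u, v)) (x z : E) :
    fderiv ℝ (fderiv ℝ C) (u₀, u₀) (z, 0) (0, x)
      = fderiv ℝ (fderiv ℝ M) (u₀, u₀) (z, 0) (0, x)
        - fderiv ℝ (fderiv ℝ M) (u₀, u₀) (x, 0) (0, z) := by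
  have inr_c : ContinuousAt (fun u : E => (u₀, u)) u₀ := by fun_prop
  have inl_c : ContinuousAt (fun u : E => (u, u₀)) u₀ := by fun_prop
  -- This is the `v`-derivative of `M (C (u, v), u) = M (u, v)`, a form of conjugation that avoids
  -- differentiating inverses. Its own derivative in `u` gives the claim.
  have e1 : ∀ᶠ u in 𝓝 u₀, fderiv ℝ M (u₀, u) (fderiv ℝ C (u, u₀) (0, x), 0)
      = fderiv ℝ M (u, u₀) (0, x) := by
    filter_upwards [inr_c.eventually (eventually_differentiableAt hM),
      inl_c.eventually (eventually_differentiableAt hM),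
      inl_c.eventually (eventually_differentiableAt hC), hC1, hCM] with u h1 h2 h3 h4 h5
    have l : HasFDerivAt (fun v => M (u, v))
        (fderiv ℝ M (u, u₀) ∘L (ContinuousLinearMap.inr ℝ E E)) u₀ :=
      h2.hasFDerivAt.comp u₀ (hasFDerivAt_prodMk_right u u₀)
    have c : HasFDerivAt (fun v => C (u, v))
        (fderiv ℝ C (u, u₀) ∘L (ContinuousLinearMap.inr ℝ E E)) u₀ :=
      h3.hasFDerivAt.comp u₀ (hasFDerivAt_prodMk_right u u₀)
    have m : HasFDerivAt (fun w => M (w, u))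
        (fderiv ℝ M (u₀, u) ∘L (ContinuousLinearMap.inl ℝ E E)) (C (u, u₀)) := by
      rw [h4]
      exact h1.hasFDerivAt.comp u₀ (hasFDerivAt_prodMk_left u₀ u)
    have r : HasFDerivAt (fun v => M (u, v)) _ u₀ :=
      HasFDerivAt.congr_of_eventuallyEq
        (HasFDerivAt.comp (g := fun w => M (w, u)) (f := fun v => C (u, v)) u₀ m c)
        (h5.mono fun v hv => hv.symm)
    have := congrArg (fun T => T x) (r.unique l)
    simpa using this
  have dM : HasFDerivAt (fderiv ℝ M) (fderiv ℝ (fderiv ℝ M) (u₀, u₀)) (u₀, u₀) :=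
    ((hM.fderiv_right (m := 1) (by norm_num)).differentiableAt (by simp)).hasFDerivAt
  have a1 : HasFDerivAt (fun u => fderiv ℝ M (u₀, u)) _ u₀ :=
    HasFDerivAt.comp (g := fderiv ℝ M) (f := fun u : E => (u₀, u)) u₀ dM
      (hasFDerivAt_prodMk_right u₀ u₀)
  have a2 : HasFDerivAt (fun u => fderiv ℝ C (u, u₀) (0, x)) _ u₀ :=
    hasFDerivAt_fderiv_apply_comp (c := fun u : E => (u, u₀)) hC
      (hasFDerivAt_prodMk_left u₀ u₀) ((0 : E), x)
  have a3 : HasFDerivAt (fun u => fderiv ℝ M (u, u₀) (0, x)) _ u₀ :=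
    hasFDerivAt_fderiv_apply_comp (c := fun u : E => (u, u₀)) hM
      (hasFDerivAt_prodMk_left u₀ u₀) ((0 : E), x)
  have a4 := a1.clm_apply (a2.prodMk (hasFDerivAt_const (0 : E) u₀))
  have hM1' : ∀ y, fderiv ℝ M (u₀, u₀) (y, 0) = y := fun y => by
    have m : HasFDerivAt (fun u => M (u, u₀))
        (fderiv ℝ M (u₀, u₀) ∘L (ContinuousLinearMap.inl ℝ E E)) u₀ :=
      HasFDerivAt.comp (g := M) (f := fun u => (u, u₀)) u₀
        (hM.differentiableAt (by simp)).hasFDerivAt (hasFDerivAt_prodMk_left u₀ u₀)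
    have := congrArg (fun T => T y) (m.unique ((hasFDerivAt_id u₀).congr_of_eventuallyEq hM1))
    simpa using this
  have hC0' : ∀ y, fderiv ℝ C (u₀, u₀) (0, y) = y := fun y => by
    have m : HasFDerivAt (fun u => C (u₀, u))
        (fderiv ℝ C (u₀, u₀) ∘L (ContinuousLinearMap.inr ℝ E E)) u₀ :=
      (hC.differentiableAt (by simp)).hasFDerivAt.comp u₀ (hasFDerivAt_prodMk_right u₀ u₀)
    have := congrArg (fun T => T y) (m.unique ((hasFDerivAt_id u₀).congr_of_eventuallyEq hC0))
    simpa using this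
  have := congrArg (fun T => T z) (a3.unique (a4.congr_of_eventuallyEq (e1.mono fun u h => h.symm)))
  simp [hM1', hC0'] at this
  rw [this, fderiv_fderiv_comm hM (x, 0)]
  abel

end LocalCalculus

/-! ### Submersions of manifolds, fibres and connectedness -/

section Submersion

variable {E : Type*} [NormedAddCommGroup E] [NormedSpace ℝ E]
  {F : Type*} [NormedAddCommGroup F] [NormedSpace ℝ F]
  {M : Type*} [TopologicalSpace M] [ChartedSpace E M]
  {N : Type*} [TopologicalSpace N] [ChartedSpace F N]

theorem extChartAt_target_mem_nhds_self (x : M) :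
    (extChartAt 𝓘(ℝ, E) x).target ∈ 𝓝 (extChartAt 𝓘(ℝ, E) x x) :=
  (isOpen_extChartAt_target x).mem_nhds (mem_extChartAt_target x)

theorem mfderiv_eq_fderiv_charts {f : M → N} {x : M} (hf : MDifferentiableAt 𝓘(ℝ, E) 𝓘(ℝ, F) f x) :
    mfderiv 𝓘(ℝ, E) 𝓘(ℝ, F) f x = fderiv ℝ (fun u => extChartAt 𝓘(ℝ, F) (f x)
      (f ((extChartAt 𝓘(ℝ, E) x).symm u))) (extChartAt 𝓘(ℝ, E) x x) := by
  have h := hf.mfderiv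
  rw [ModelWithCorners.range_eq_univ, fderivWithin_univ] at h
  exact h

/-- The symmetric chart has derivative the identity at the base point. -/
theorem mfderiv_extChartAt_symm_self [IsManifold 𝓘(ℝ, E) 1 M] (x : M) :
    mfderiv 𝓘(ℝ, E) 𝓘(ℝ, E) (extChartAt 𝓘(ℝ, E) x).symm (extChartAt 𝓘(ℝ, E) x x)
      = ContinuousLinearMap.id ℝ E := by
  have h := mfderivWithin_range_extChartAt_symm (I := 𝓘(ℝ, E)) (x := x)
  rw [ModelWithCorners.range_eq_univ, mfderivWithin_univ] at h
  exact h

theorem contMDiffAt_extChartAt_symm_self [IsManifold 𝓘(ℝ, E) ∞ M] {x : M} {u : E}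
    (hu : u ∈ (extChartAt 𝓘(ℝ, E) x).target) :
    ContMDiffAt 𝓘(ℝ, E) 𝓘(ℝ, E) ∞ (extChartAt 𝓘(ℝ, E) x).symm u :=
  (contMDiffOn_extChartAt_symm x).contMDiffAt ((isOpen_extChartAt_target x).mem_nhds hu)

/-- A submersion is a projection in suitable local parametrizations. -/
theorem exists_parametrization_of_submersion [IsManifold 𝓘(ℝ, E) ∞ M] [IsManifold 𝓘(ℝ, F) ∞ N]
    [FiniteDimensional ℝ E] [FiniteDimensional ℝ F]
    {f : M → N} (hf : ContMDiff 𝓘(ℝ, E) 𝓘(ℝ, F) ∞ f) (x : M)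
    (hs : Function.Surjective (mfderiv 𝓘(ℝ, E) 𝓘(ℝ, F) f x)) :
    ∃ (K : Submodule ℝ E) (Φ : F × K → M),
      (∀ v : E, v ∈ K ↔ mfderiv 𝓘(ℝ, E) 𝓘(ℝ, F) f x v = 0) ∧
      Φ (extChartAt 𝓘(ℝ, F) (f x) (f x), 0) = x ∧
      (∀ᶠ p in 𝓝 (extChartAt 𝓘(ℝ, F) (f x) (f x), 0),
        ContMDiffAt 𝓘(ℝ, F × K) 𝓘(ℝ, E) ∞ Φ p ∧ f (Φ p) = (extChartAt 𝓘(ℝ, F) (f x)).symm p.1) ∧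
      ∀ k, mfderiv 𝓘(ℝ, F × K) 𝓘(ℝ, E) Φ (extChartAt 𝓘(ℝ, F) (f x) (f x), 0) (0, k) = (k : E) := by
  set χ := extChartAt 𝓘(ℝ, E) x with hχ
  set φ := extChartAt 𝓘(ℝ, F) (f x) with hφ
  have hfx := hf.contMDiffAt.mdifferentiableAt (x := x) (by simp)
  let g : E → F := fun u => φ (f (χ.symm u))
  have hd : mfderiv 𝓘(ℝ, E) 𝓘(ℝ, F) f x = fderiv ℝ g (χ x) := mfderiv_eq_fderiv_charts hfx
  have hχx : χ.symm (χ x) = x := extChartAt_to_inv x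
  have hcχ : ContinuousAt (fun u => f (χ.symm u)) (χ x) := by
    apply ContinuousAt.comp (g := f) _ (continuousAt_extChartAt_symm x)
    exact hf.continuous.continuousAt
  have hsrc : ∀ᶠ u in 𝓝 (χ x), f (χ.symm u) ∈ φ.source := by
    apply hcχ
    change φ.source ∈ 𝓝 (f (χ.symm (χ x)))
    rw [hχx]
    exact extChartAt_source_mem_nhds (I := 𝓘(ℝ, F)) (f x)
  have hg : ∀ᶠ u in 𝓝 (χ x), ContDiffAt ℝ ∞ g u := by
    filter_upwards [hsrc, extChartAt_target_mem_nhds_self x] with u h1 h2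
    rw [← contMDiffAt_iff_contDiffAt]
    have h3 := (contMDiffAt_extChartAt' (I := 𝓘(ℝ, F)) (n := ∞) (x := f x)
      (x' := f (χ.symm u)) (by simpa [hφ] using h1))
    exact ContMDiffAt.comp u (g := φ) (f := fun u => f (χ.symm u)) h3
      (hf.contMDiffAt.comp u (contMDiffAt_extChartAt_symm_self h2))
  obtain ⟨Φ, h0, h1, h2⟩ := exists_local_parametrization hg (by rw [← hd]; exact hs)
  have hg0 : g (χ x) = φ (f x) := by simp only [g, hχx]
  rw [hg0] at h0 h1 h2
  have hc : ContinuousAt Φ (φ (f x), 0) := h1.self_of_nhds.1.continuousAt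
  have hsm : ∀ᶠ p in 𝓝 (φ (f x), 0), ContMDiffAt 𝓘(ℝ, F × (fderiv ℝ g (χ x)).ker) 𝓘(ℝ, E) ∞
      (fun p => χ.symm (Φ p)) p := by
    have ht : ∀ᶠ p in 𝓝 (φ (f x), 0), Φ p ∈ χ.target := by
      apply hc; rw [h0]; exact extChartAt_target_mem_nhds_self x
    filter_upwards [h1, ht] with p h3 h4
    exact (contMDiffAt_extChartAt_symm_self h4).comp p h3.1.contMDiffAt
  refine ⟨(fderiv ℝ g (χ x)).ker, fun p => χ.symm (Φ p), fun v => ?_, ?_, ?_, fun k => ?_⟩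
  · rw [hd]; exact LinearMap.mem_ker
  · change χ.symm (Φ _) = x
    rw [h0, hχx]
  · have hs' : ∀ᶠ p in 𝓝 (φ (f x), 0), f (χ.symm (Φ p)) ∈ φ.source := by
      rw [← h0] at hsrc
      exact hc.eventually hsrc
    filter_upwards [hsm, h1, hs'] with p h3 h4 h5
    refine ⟨h3, ?_⟩
    rw [← h4.2]
    exact (φ.left_inv h5).symm
  · have e := mfderiv_comp (I := 𝓘(ℝ, F × (fderiv ℝ g (χ x)).ker)) (I' := 𝓘(ℝ, E)) (I'' := 𝓘(ℝ, E))
      (φ (f x), 0) (g := χ.symm) (f := Φ)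
      (by rw [h0]
          exact (contMDiffAt_extChartAt_symm_self (mem_extChartAt_target x)).mdifferentiableAt (by simp))
      (h1.self_of_nhds.1.differentiableAt (by simp)).mdifferentiableAt
    change mfderiv _ _ (χ.symm ∘ Φ) _ _ = _
    rw [e, mfderiv_eq_fderiv]
    refine (congrArg _ (h2 k)).trans ?_
    rw [h0]
    exact congrArg (fun T : E →L[ℝ] E => T (k : E)) (mfderiv_extChartAt_symm_self x)

/-- Freeze the fibre coordinate of a local parametrization at `0`. -/
theorem exists_local_section [IsManifold 𝓘(ℝ, E) ∞ M] [IsManifold 𝓘(ℝ, F) ∞ N]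
    [FiniteDimensional ℝ E] [FiniteDimensional ℝ F]
    {f : M → N} (hf : ContMDiff 𝓘(ℝ, E) 𝓘(ℝ, F) ∞ f) (x : M)
    (hs : Function.Surjective (mfderiv 𝓘(ℝ, E) 𝓘(ℝ, F) f x)) :
    ∃ τ : N → M, ContMDiffAt 𝓘(ℝ, F) 𝓘(ℝ, E) ∞ τ (f x) ∧ ∀ᶠ y in 𝓝 (f x), f (τ y) = y := by
  obtain ⟨K, Φ, -, -, h1, -⟩ := exists_parametrization_of_submersion hf x hs
  set φ := extChartAt 𝓘(ℝ, F) (f x) with hφ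
  have hφs : ContMDiffAt 𝓘(ℝ, F) 𝓘(ℝ, F) ∞ φ (f x) := contMDiffAt_extChartAt
  have hj : ContMDiffAt 𝓘(ℝ, F) 𝓘(ℝ, F × K) ∞ (fun y => (φ y, (0 : K))) (f x) := 
    hφs.prodMk_space contMDiffAt_const
  refine ⟨fun y => Φ (φ y, 0), ?_, ?_⟩
  · exact ContMDiffAt.comp (g := Φ) (f x) h1.self_of_nhds.1 hj
  · filter_upwards [hj.continuousAt.eventually h1,
      extChartAt_source_mem_nhds (I := 𝓘(ℝ, F)) (f x)] with y h3 h4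
    rw [h3.2]
    exact φ.left_inv h4

/-- Every vector in the kernel of the derivative of a submersion is the velocity of a global
smooth curve in the fibre. -/
theorem exists_curve_in_fibre [IsManifold 𝓘(ℝ, E) ∞ M] [IsManifold 𝓘(ℝ, F) ∞ N]
    [FiniteDimensional ℝ E] [FiniteDimensional ℝ F]
    {f : M → N} (hf : ContMDiff 𝓘(ℝ, E) 𝓘(ℝ, F) ∞ f) (x : M)
    (hs : Function.Surjective (mfderiv 𝓘(ℝ, E) 𝓘(ℝ, F) f x)) {v : E}
    (hv : mfderiv 𝓘(ℝ, E) 𝓘(ℝ, F) f x v = 0) :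
    ∃ γ : ℝ → M, ContMDiff 𝓘(ℝ, ℝ) 𝓘(ℝ, E) ∞ γ ∧ γ 0 = x ∧ (∀ t, f (γ t) = f x) ∧
      mfderiv 𝓘(ℝ, ℝ) 𝓘(ℝ, E) γ 0 (1 : ℝ) = v := by
  obtain ⟨K, Φ, hK, h0, h1, h2⟩ := exists_parametrization_of_submersion hf x hs
  set y₀ := extChartAt 𝓘(ℝ, F) (f x) (f x) with hy₀
  let k : K := ⟨v, (hK v).2 hv⟩
  obtain ⟨ε, hε, hball⟩ := Metric.eventually_nhds_iff.1 h1
  -- A curve defined on all of `ℝ` is required, but the parametrization is controlled only on a ball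
  -- of radius `ε`. The function `δ * sin (t / δ)` has velocity `1` at `0` and modulus at most `δ`,
  -- and `δ * ‖k‖ < ε`; the summand `1` covers `k = 0`.
  let δ : ℝ := ε / (‖k‖ + 1)
  have hδ : 0 < δ := by positivity
  let c : ℝ → F × K := fun t => (y₀, (δ * Real.sin (t / δ)) • k)
  have hc : ContDiff ℝ ∞ c := by
    apply contDiff_const.prodMk
    exact ((contDiff_const.mul (Real.contDiff_sin.comp (contDiff_id.div_const δ)))).smul
      contDiff_const
  have hcb : ∀ t, dist (c t) (y₀, 0) < ε := by
    intro t
    have h3 : ‖(δ * Real.sin (t / δ)) • k‖ < ε := by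
      rw [norm_smul, norm_mul, Real.norm_of_nonneg hδ.le, Real.norm_eq_abs]
      calc δ * |Real.sin (t / δ)| * ‖k‖ ≤ δ * 1 * ‖k‖ := by
            gcongr; exact Real.abs_sin_le_one _
        _ < δ * (‖k‖ + 1) := by nlinarith
        _ = ε := by simp only [δ]; field_simp
    rw [Prod.dist_eq]
    refine max_lt (by simpa [c] using hε) ?_
    change dist ((δ * Real.sin (t / δ)) • k) 0 < ε
    rwa [dist_zero_right]
  have hc0 : c 0 = (y₀, 0) := by simp [c]
  have hcd : HasDerivAt c (0, k) 0 := by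
    have h4 : HasDerivAt (fun t : ℝ => δ * Real.sin (t / δ)) 1 0 := by
      have := ((Real.hasDerivAt_sin (0 / δ)).comp (0 : ℝ) ((hasDerivAt_id 0).div_const δ)).const_mul δ
      convert! this using 1
      simp; field_simp
    have := (hasDerivAt_const (0 : ℝ) y₀).prodMk (h4.smul_const k)
    simpa using this
  refine ⟨fun t => Φ (c t), fun t => ?_, ?_, fun t => ?_, ?_⟩
  · exact (hball (hcb t)).1.comp t hc.contDiffAt.contMDiffAt
  · change Φ (c 0) = x
    rw [hc0, h0]
  · change f (Φ (c t)) = _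
    rw [(hball (hcb t)).2]
    exact extChartAt_to_inv (I := 𝓘(ℝ, F)) (f x)
  · have e := mfderiv_comp (I := 𝓘(ℝ, ℝ)) (I' := 𝓘(ℝ, F × K)) (I'' := 𝓘(ℝ, E))
      (0 : ℝ) (g := Φ) (f := c)
      ((hball (hcb 0)).1.mdifferentiableAt (by simp))
      hcd.differentiableAt.mdifferentiableAt
    change mfderiv _ _ (Φ ∘ c) _ _ = _
    rw [e, mfderiv_eq_fderiv]
    have : fderiv ℝ c 0 (1 : ℝ) = (0, k) := by rw [fderiv_apply_one_eq_deriv, hcd.deriv]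
    refine (congrArg _ this).trans ?_
    rw [hc0]
    exact h2 k

/-- A real function on a connected manifold with zero derivative is constant. -/
theorem eq_of_mfderiv_eq_zero [IsManifold 𝓘(ℝ, E) ∞ M] [ConnectedSpace M] {h : M → ℝ}
    (hh : ∀ x, MDifferentiableAt 𝓘(ℝ, E) 𝓘(ℝ, ℝ) h x)
    (h0 : ∀ x, mfderiv 𝓘(ℝ, E) 𝓘(ℝ, ℝ) h x = 0) (x y : M) : h x = h y := by
  have hl : IsLocallyConstant h := by
    rw [IsLocallyConstant.iff_eventually_eq]
    intro x
    set χ := extChartAt 𝓘(ℝ, E) x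
    obtain ⟨r, hr, hb⟩ := Metric.isOpen_iff.1 (isOpen_extChartAt_target (I := 𝓘(ℝ, E)) x) _
      (mem_extChartAt_target x)
    have hm : ∀ u ∈ Metric.ball (χ x) r, HasFDerivAt (fun u => h (χ.symm u)) (0 : E →L[ℝ] ℝ) u := by
      intro u hu
      have h1 := (contMDiffAt_extChartAt_symm_self (hb hu)).mdifferentiableAt (by simp)
      have h2 := (hh (χ.symm u)).hasMFDerivAt.comp u h1.hasMFDerivAt
      rw [h0, ContinuousLinearMap.zero_comp] at h2
      exact h2.hasFDerivAt
    -- A ball in the chart is convex, so the mean value inequality applies there; connectedness is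
    -- used only for passing from locally constant to constant.
    have hconst : ∀ u ∈ Metric.ball (χ x) r, h (χ.symm u) = h (χ.symm (χ x)) := by
      intro u hu
      refine (convex_ball (χ x) r).is_const_of_fderivWithin_eq_zero (𝕜 := ℝ)
        (f := fun u => h (χ.symm u)) (fun w hw => (hm w hw).differentiableAt.differentiableWithinAt)
        (fun w hw => ?_) hu (Metric.mem_ball_self hr)
      rw [fderivWithin_of_isOpen Metric.isOpen_ball hw, (hm w hw).fderiv]
    have hc : ContinuousAt χ x := continuousAt_extChartAt x
    filter_upwards [hc.preimage_mem_nhds (Metric.ball_mem_nhds _ hr),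
      extChartAt_source_mem_nhds (I := 𝓘(ℝ, E)) x] with z hz hzs
    have := hconst _ hz
    rwa [χ.left_inv hzs, extChartAt_to_inv x] at this
  exact hl.apply_eq_of_preconnectedSpace x y

end Submersion

/-! ### Derivatives and Lie brackets of vector fields in charts -/

section Charts

variable {E : Type*} [NormedAddCommGroup E] [NormedSpace ℝ E]
  {F : Type*} [NormedAddCommGroup F] [NormedSpace ℝ F]
  {M : Type*} [TopologicalSpace M] [ChartedSpace E M]
  {N : Type*} [TopologicalSpace N] [ChartedSpace F N]

theorem mfderiv_extChartAt_symm_comp [IsManifold 𝓘(ℝ, F) ∞ N] {n y : N}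
    (hy : y ∈ (extChartAt 𝓘(ℝ, F) n).source) (v : TangentSpace 𝓘(ℝ, F) y) :
    mfderiv 𝓘(ℝ, F) 𝓘(ℝ, F) (extChartAt 𝓘(ℝ, F) n).symm (extChartAt 𝓘(ℝ, F) n y)
      (mfderiv 𝓘(ℝ, F) 𝓘(ℝ, F) (extChartAt 𝓘(ℝ, F) n) y v) = v := by
  have : IsManifold 𝓘(ℝ, F) 1 N := IsManifold.of_le (n := ∞) (by simp)
  have h := mfderivWithin_extChartAt_symm_comp_mfderiv_extChartAt' (I := 𝓘(ℝ, F)) hy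
  rw [ModelWithCorners.range_eq_univ, mfderivWithin_univ] at h
  exact congrArg (fun T => T v) h

theorem isInvertible_mfderiv_extChartAt_symm [IsManifold 𝓘(ℝ, F) ∞ N] {n : N} {y : F}
    (hy : y ∈ (extChartAt 𝓘(ℝ, F) n).target) :
    (mfderiv 𝓘(ℝ, F) 𝓘(ℝ, F) (extChartAt 𝓘(ℝ, F) n).symm y).IsInvertible := by
  have : IsManifold 𝓘(ℝ, F) 1 N := IsManifold.of_le (n := ∞) (by simp)
  have h := isInvertible_mfderivWithin_extChartAt_symm (I := 𝓘(ℝ, F)) hy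
  rwa [ModelWithCorners.range_eq_univ, mfderivWithin_univ] at h

/-- The target chart is centred at an arbitrary `n` and not at `f x`. This serves families such as
translations and orbit maps, whose values move with a parameter while the chart has to stay fixed.
It is the chain rule with the chart and its inverse cancelling. -/
theorem mfderiv_symm_fderiv_charts [IsManifold 𝓘(ℝ, E) ∞ M] [IsManifold 𝓘(ℝ, F) ∞ N]
    {f : M → N} {x : M} {n : N} {y : F}
    (hf : MDifferentiableAt 𝓘(ℝ, E) 𝓘(ℝ, F) f x) (hn : f x ∈ (extChartAt 𝓘(ℝ, F) n).source)
    (hy : extChartAt 𝓘(ℝ, F) n (f x) = y) (v : E) :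
    (mfderiv 𝓘(ℝ, F) 𝓘(ℝ, F) (extChartAt 𝓘(ℝ, F) n).symm y
      (fderiv ℝ (fun u => extChartAt 𝓘(ℝ, F) n (f ((extChartAt 𝓘(ℝ, E) x).symm u)))
        (extChartAt 𝓘(ℝ, E) x x) v) : F) = mfderiv 𝓘(ℝ, E) 𝓘(ℝ, F) f x v := by
  subst hy
  have : IsManifold 𝓘(ℝ, E) 1 M := IsManifold.of_le (n := ∞) (by simp)
  have h1 : MDifferentiableAt 𝓘(ℝ, F) 𝓘(ℝ, F) (extChartAt 𝓘(ℝ, F) n) (f x) :=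
    (contMDiffAt_extChartAt' (I := 𝓘(ℝ, F)) (n := ∞)
      (by simpa using hn)).mdifferentiableAt (by simp)
  have h2 : MDifferentiableAt 𝓘(ℝ, E) 𝓘(ℝ, F) (fun z => extChartAt 𝓘(ℝ, F) n (f z)) x :=
    h1.comp x hf
  have h3 := mfderiv_eq_fderiv_charts h2
  have h4 : mfderiv 𝓘(ℝ, E) 𝓘(ℝ, F) (fun z => extChartAt 𝓘(ℝ, F) n (f z)) x = _ :=
    mfderiv_comp x h1 hf
  have h5 : fderiv ℝ (fun u => extChartAt 𝓘(ℝ, F) n (f ((extChartAt 𝓘(ℝ, E) x).symm u)))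
        (extChartAt 𝓘(ℝ, E) x x) v = mfderiv 𝓘(ℝ, F) 𝓘(ℝ, F) (extChartAt 𝓘(ℝ, F) n) (f x)
          (mfderiv 𝓘(ℝ, E) 𝓘(ℝ, F) f x v) :=
    congrArg (fun T : E →L[ℝ] F => T v) (h3.symm.trans h4)
  refine (congrArg _ h5).trans ?_
  exact mfderiv_extChartAt_symm_comp hn _

/-- The Lie bracket of vector fields in the preferred chart. -/
theorem mlieBracket_eq_of_chart [CompleteSpace E] [IsManifold 𝓘(ℝ, E) ∞ M] {X Y : ∀ x : M, TangentSpace 𝓘(ℝ, E) x}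
    {x : M} {X' Y' : E → E}
    (hX : ∀ᶠ u in 𝓝 (extChartAt 𝓘(ℝ, E) x x),
      mfderiv 𝓘(ℝ, E) 𝓘(ℝ, E) (extChartAt 𝓘(ℝ, E) x).symm u (X' u)
        = X ((extChartAt 𝓘(ℝ, E) x).symm u))
    (hY : ∀ᶠ u in 𝓝 (extChartAt 𝓘(ℝ, E) x x),
      mfderiv 𝓘(ℝ, E) 𝓘(ℝ, E) (extChartAt 𝓘(ℝ, E) x).symm u (Y' u)
        = Y ((extChartAt 𝓘(ℝ, E) x).symm u)) :
    mlieBracket 𝓘(ℝ, E) X Y x =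
      fderiv ℝ Y' (extChartAt 𝓘(ℝ, E) x x) (X' (extChartAt 𝓘(ℝ, E) x x))
        - fderiv ℝ X' (extChartAt 𝓘(ℝ, E) x x) (Y' (extChartAt 𝓘(ℝ, E) x x)) := by
  have : IsManifold 𝓘(ℝ, E) 1 M := IsManifold.of_le (n := ∞) (by simp)
  have key : ∀ {X : ∀ x : M, TangentSpace 𝓘(ℝ, E) x} {X' : E → E},
      (∀ᶠ u in 𝓝 (extChartAt 𝓘(ℝ, E) x x),
      mfderiv 𝓘(ℝ, E) 𝓘(ℝ, E) (extChartAt 𝓘(ℝ, E) x).symm u (X' u)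
        = X ((extChartAt 𝓘(ℝ, E) x).symm u)) →
      mpullbackWithin 𝓘(ℝ, E) 𝓘(ℝ, E) (extChartAt 𝓘(ℝ, E) x).symm X (Set.range 𝓘(ℝ, E))
        =ᶠ[𝓝 (extChartAt 𝓘(ℝ, E) x x)] X' := by
    intro X X' h
    rw [ModelWithCorners.range_eq_univ, mpullbackWithin_univ]
    filter_upwards [h, extChartAt_target_mem_nhds_self x] with u h1 h2
    rw [mpullback_apply, ← h1]
    exact (isInvertible_mfderiv_extChartAt_symm h2).inverse_apply_self _
  have hbr : ∀ V W : E → E, V =ᶠ[𝓝 (extChartAt 𝓘(ℝ, E) x x)] X' →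
      W =ᶠ[𝓝 (extChartAt 𝓘(ℝ, E) x x)] Y' →
      lieBracketWithin ℝ V W ((extChartAt 𝓘(ℝ, E) x).symm ⁻¹' Set.univ ∩ Set.range 𝓘(ℝ, E))
        (extChartAt 𝓘(ℝ, E) x x) =
      fderiv ℝ Y' (extChartAt 𝓘(ℝ, E) x x) (X' (extChartAt 𝓘(ℝ, E) x x))
        - fderiv ℝ X' (extChartAt 𝓘(ℝ, E) x x) (Y' (extChartAt 𝓘(ℝ, E) x x)) := by
    intro V W hV hW
    rw [ModelWithCorners.range_eq_univ, Set.preimage_univ, Set.univ_inter, lieBracketWithin_univ,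
      hV.lieBracket_vectorField_eq hW, lieBracket]
  have hinv : (mfderiv 𝓘(ℝ, E) 𝓘(ℝ, E) (extChartAt 𝓘(ℝ, E) x) x).inverse
      = ContinuousLinearMap.id ℝ E := by
    rw [mfderiv_extChartAt_self]
    exact ContinuousLinearMap.inverse_id
  rw [← mlieBracketWithin_univ, mlieBracketWithin_apply]
  exact (congrArg (fun T : E →L[ℝ] E => T _) hinv).trans (hbr _ _ (key hX) (key hY))

end Charts

/-! ### The Lie bracket of a Lie group from its multiplication in a chart -/

section LieGroupCharts

variable {E : Type*} [NormedAddCommGroup E] [NormedSpace ℝ E]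
  (D : Type*) [TopologicalSpace D] [ChartedSpace E D] [Group D] [LieGroup 𝓘(ℝ, E) ∞ D]

/-- The multiplication of a Lie group in the preferred chart at the identity. -/
def mulChart (p : E × E) : E :=
  extChartAt 𝓘(ℝ, E) (1 : D)
    ((extChartAt 𝓘(ℝ, E) (1 : D)).symm p.1 * (extChartAt 𝓘(ℝ, E) (1 : D)).symm p.2)

/-- Conjugation in the preferred chart at the identity. -/
def conjChart (p : E × E) : E :=
  extChartAt 𝓘(ℝ, E) (1 : D)
    ((extChartAt 𝓘(ℝ, E) (1 : D)).symm p.1 * (extChartAt 𝓘(ℝ, E) (1 : D)).symm p.2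
      * ((extChartAt 𝓘(ℝ, E) (1 : D)).symm p.1)⁻¹)

theorem contDiffAt_mulChart :
    ContDiffAt ℝ ∞ (mulChart D)
      (extChartAt 𝓘(ℝ, E) (1 : D) 1, extChartAt 𝓘(ℝ, E) (1 : D) 1) := by
  set χ := extChartAt 𝓘(ℝ, E) (1 : D) with hχ
  have h1 : χ.symm (χ 1) = 1 := extChartAt_to_inv (1 : D)
  rw [← contMDiffAt_iff_contDiffAt]
  have hs := contMDiffAt_extChartAt_symm_self (mem_extChartAt_target (I := 𝓘(ℝ, E)) (1 : D))
  have ha : ContMDiffAt 𝓘(ℝ, E × E) 𝓘(ℝ, E) ∞ (fun p : E × E => χ.symm p.1) (χ 1, χ 1) :=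
    hs.comp (χ 1, χ 1) (contDiff_fst.contDiffAt.contMDiffAt)
  have hb : ContMDiffAt 𝓘(ℝ, E × E) 𝓘(ℝ, E) ∞ (fun p : E × E => χ.symm p.2) (χ 1, χ 1) :=
    hs.comp (χ 1, χ 1) (contDiff_snd.contDiffAt.contMDiffAt)
  have hm := ha.mul hb
  have hc : ContMDiffAt 𝓘(ℝ, E) 𝓘(ℝ, E) ∞ χ (χ.symm (χ 1) * χ.symm (χ 1)) := by
    rw [h1, mul_one]; exact contMDiffAt_extChartAt
  exact ContMDiffAt.comp (g := χ) (χ 1, χ 1) hc hm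

theorem contDiffAt_conjChart :
    ContDiffAt ℝ ∞ (conjChart D)
      (extChartAt 𝓘(ℝ, E) (1 : D) 1, extChartAt 𝓘(ℝ, E) (1 : D) 1) := by
  set χ := extChartAt 𝓘(ℝ, E) (1 : D) with hχ
  have h1 : χ.symm (χ 1) = 1 := extChartAt_to_inv (1 : D)
  rw [← contMDiffAt_iff_contDiffAt]
  have hs := contMDiffAt_extChartAt_symm_self (mem_extChartAt_target (I := 𝓘(ℝ, E)) (1 : D))
  have ha : ContMDiffAt 𝓘(ℝ, E × E) 𝓘(ℝ, E) ∞ (fun p : E × E => χ.symm p.1) (χ 1, χ 1) :=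
    hs.comp (χ 1, χ 1) (contDiff_fst.contDiffAt.contMDiffAt)
  have hb : ContMDiffAt 𝓘(ℝ, E × E) 𝓘(ℝ, E) ∞ (fun p : E × E => χ.symm p.2) (χ 1, χ 1) :=
    hs.comp (χ 1, χ 1) (contDiff_snd.contDiffAt.contMDiffAt)
  have hm := (ha.mul hb).mul ha.inv
  have hc : ContMDiffAt 𝓘(ℝ, E) 𝓘(ℝ, E) ∞ χ (χ.symm (χ 1) * χ.symm (χ 1) * (χ.symm (χ 1))⁻¹) := by
    rw [h1, mul_one, inv_one, mul_one]; exact contMDiffAt_extChartAt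
  exact ContMDiffAt.comp (g := χ) (χ 1, χ 1) hc hm

theorem two_le_infty : (2 : ℕ∞ω) ≤ ∞ := ENat.LEInfty.out

omit [LieGroup 𝓘(ℝ, E) ∞ D] in
variable {D} in
theorem eventually_extChartAt_symm_mem_source :
    ∀ᶠ u in 𝓝 (extChartAt 𝓘(ℝ, E) (1 : D) 1),
      (extChartAt 𝓘(ℝ, E) (1 : D)).symm u ∈ (extChartAt 𝓘(ℝ, E) (1 : D)).source ∧
      extChartAt 𝓘(ℝ, E) (1 : D) ((extChartAt 𝓘(ℝ, E) (1 : D)).symm u) = u := by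
  filter_upwards [extChartAt_target_mem_nhds_self (E := E) (1 : D)] with u hu
  exact ⟨(extChartAt 𝓘(ℝ, E) (1 : D)).map_target hu, (extChartAt 𝓘(ℝ, E) (1 : D)).right_inv hu⟩

omit [LieGroup 𝓘(ℝ, E) ∞ D] in
theorem eventually_mulChart_left_unit :
    ∀ᶠ u in 𝓝 (extChartAt 𝓘(ℝ, E) (1 : D) 1), mulChart D (extChartAt 𝓘(ℝ, E) (1 : D) 1, u) = u := by
  filter_upwards [eventually_extChartAt_symm_mem_source (D := D)] with u hu
  rw [mulChart, extChartAt_to_inv, one_mul, hu.2]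

omit [LieGroup 𝓘(ℝ, E) ∞ D] in
theorem eventually_mulChart_right_unit :
    ∀ᶠ u in 𝓝 (extChartAt 𝓘(ℝ, E) (1 : D) 1), mulChart D (u, extChartAt 𝓘(ℝ, E) (1 : D) 1) = u := by
  filter_upwards [eventually_extChartAt_symm_mem_source (D := D)] with u hu
  rw [mulChart, extChartAt_to_inv, mul_one, hu.2]

/-- The Lie bracket of a Lie group is the antisymmetrization of the second derivative of the
multiplication. -/
theorem lieD_eq_mulChart [FiniteDimensional ℝ E] (x y : E) :
    lieD D x y = fderiv ℝ (fderiv ℝ (mulChart D))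
        (extChartAt 𝓘(ℝ, E) (1 : D) 1, extChartAt 𝓘(ℝ, E) (1 : D) 1) (x, 0) (0, y)
      - fderiv ℝ (fderiv ℝ (mulChart D))
        (extChartAt 𝓘(ℝ, E) (1 : D) 1, extChartAt 𝓘(ℝ, E) (1 : D) 1) (y, 0) (0, x) := by
  have : CompleteSpace E := FiniteDimensional.complete ℝ E
  set χ := extChartAt 𝓘(ℝ, E) (1 : D) with hχ
  set u₀ := χ 1 with hu₀
  have h1 : χ.symm u₀ = 1 := extChartAt_to_inv (1 : D)
  have hM := (contDiffAt_mulChart (E := E) D).of_le (m := 2) two_le_infty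
  -- In the chart, the left-invariant field of `x` is the derivative of the multiplication in its
  -- second argument at the unit. The bracket of two such fields is then a difference of mixed
  -- second derivatives.
  have hfield : ∀ x : E, ∀ᶠ u in 𝓝 u₀, mfderiv 𝓘(ℝ, E) 𝓘(ℝ, E) χ.symm u
      (fderiv ℝ (mulChart D) (u, u₀) (0, x))
      = mulInvariantVectorField (I := 𝓘(ℝ, E)) (G := D) x (χ.symm u) := by
    intro x
    have hc : ContinuousAt (fun u : E => (u, u₀)) u₀ := by fun_prop
    filter_upwards [eventually_extChartAt_symm_mem_source (D := D),
      hc.eventually (eventually_differentiableAt hM)] with u hu hd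
    have h2 := mfderiv_symm_fderiv_charts (f := fun d : D => χ.symm u * d) (x := 1) (n := 1)
      (contMDiff_mul_left.contMDiffAt.mdifferentiableAt (n := ∞) (by simp))
      (by rw [mul_one]; exact hu.1) (y := u) (by rw [mul_one]; exact hu.2) x
    refine Eq.trans ?_ h2
    have h3 : HasFDerivAt (fun v => mulChart D (u, v))
        (fderiv ℝ (mulChart D) (u, u₀) ∘L (ContinuousLinearMap.inr ℝ E E)) u₀ :=
      hd.hasFDerivAt.comp u₀ (hasFDerivAt_prodMk_right u u₀)
    exact congrArg (mfderiv 𝓘(ℝ, E) 𝓘(ℝ, E) χ.symm u)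
      (congrArg (fun T : E →L[ℝ] E => T x) h3.fderiv).symm
  have hv : ∀ x, fderiv ℝ (mulChart D) (u₀, u₀) (0, x) = x := by
    intro x
    have m : HasFDerivAt (fun u => mulChart D (u₀, u))
        (fderiv ℝ (mulChart D) (u₀, u₀) ∘L (ContinuousLinearMap.inr ℝ E E)) u₀ :=
      HasFDerivAt.comp (g := mulChart D) (f := fun u => (u₀, u)) u₀
        (hM.differentiableAt (by simp)).hasFDerivAt (hasFDerivAt_prodMk_right u₀ u₀)
    have := congrArg (fun T : E →L[ℝ] E => T x)
      (m.unique ((hasFDerivAt_id u₀).congr_of_eventuallyEq (eventually_mulChart_left_unit D)))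
    simpa using this
  have hder : ∀ x z, fderiv ℝ (fun u => fderiv ℝ (mulChart D) (u, u₀) (0, x)) u₀ z
      = fderiv ℝ (fderiv ℝ (mulChart D)) (u₀, u₀) (z, 0) (0, x) := by
    intro x z
    have := hasFDerivAt_fderiv_apply_comp (c := fun u : E => (u, u₀)) hM
      (hasFDerivAt_prodMk_left u₀ u₀) ((0 : E), x)
    rw [this.fderiv]; rfl
  have h3 := mlieBracket_eq_of_chart (hfield x) (hfield y)
  rw [← hχ, ← hu₀, hder, hder, hv, hv] at h3
  exact h3

end LieGroupCharts

/-! ### The adjoint action and its invariance of the form -/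

section Adjoint

variable {E : Type*} [NormedAddCommGroup E] [NormedSpace ℝ E] [FiniteDimensional ℝ E]
  {D : Type*} [TopologicalSpace D] [ChartedSpace E D] [Group D] [LieGroup 𝓘(ℝ, E) ∞ D]

/-- The adjoint action of a Lie group on its Lie algebra. -/
def adjointAction (k : D) : E →L[ℝ] E :=
  (mfderiv 𝓘(ℝ, E) 𝓘(ℝ, E) (fun g : D => k * g * k⁻¹) 1 : E →L[ℝ] E)

omit [FiniteDimensional ℝ E] in
theorem contMDiff_conj (k : D) : ContMDiff 𝓘(ℝ, E) 𝓘(ℝ, E) ∞ (fun g : D => k * g * k⁻¹) :=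
  (contMDiff_const.mul contMDiff_id).mul contMDiff_const

omit [FiniteDimensional ℝ E] in
theorem adjointAction_mul (k l : D) :
    adjointAction (E := E) (k * l) = (adjointAction k).comp (adjointAction l) := by
  have h : (fun g : D => k * l * g * (k * l)⁻¹)
      = (fun g : D => k * g * k⁻¹) ∘ (fun g : D => l * g * l⁻¹) := by
    ext g; simp only [Function.comp]; group
  have e := mfderiv_comp_of_eq (I := 𝓘(ℝ, E)) (I' := 𝓘(ℝ, E)) (I'' := 𝓘(ℝ, E)) (x := (1 : D))
    (y := (1 : D)) (g := fun g : D => k * g * k⁻¹) (f := fun g : D => l * g * l⁻¹)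
    ((contMDiff_conj k).contMDiffAt.mdifferentiableAt (by simp))
    ((contMDiff_conj l).contMDiffAt.mdifferentiableAt (by simp)) (by simp)
  rw [← h] at e
  -- The chain rule places the outer derivative at `l * 1 * l⁻¹`. Viewing all tangent spaces as the
  -- model space `E` allows this base point to be replaced by `1`.
  let A : D → E →L[ℝ] E := fun d => mfderiv 𝓘(ℝ, E) 𝓘(ℝ, E) (fun g : D => k * g * k⁻¹) d
  have hA : A (l * 1 * l⁻¹) = A 1 := by rw [mul_one, mul_inv_cancel]
  exact e.trans (congrArg (fun T : E →L[ℝ] E => T.comp (adjointAction l)) hA)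

omit [FiniteDimensional ℝ E] [LieGroup 𝓘(ℝ, E) ∞ D] in
theorem adjointAction_one : adjointAction (1 : D) = ContinuousLinearMap.id ℝ E := by
  have h : (fun g : D => 1 * g * 1⁻¹) = id := by ext g; simp
  have := mfderiv_id (I := 𝓘(ℝ, E)) (x := (1 : D))
  rw [← h] at this
  exact this

omit [FiniteDimensional ℝ E] in
theorem adjointAction_surjective (k : D) : Function.Surjective (adjointAction (E := E) k) := by
  intro x
  refine ⟨adjointAction k⁻¹ x, ?_⟩
  have := congrArg (fun T : E →L[ℝ] E => T x) (adjointAction_mul (E := E) k k⁻¹)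
  rw [mul_inv_cancel, adjointAction_one] at this
  exact this.symm

/-- The adjoint representation in the chart at the identity and its derivative. -/
theorem exists_adjoint_chart (x : E) : ∃ a : E → E,
    (∀ᶠ u in 𝓝 (extChartAt 𝓘(ℝ, E) (1 : D) 1),
      adjointAction ((extChartAt 𝓘(ℝ, E) (1 : D)).symm u) x = a u) ∧
    ∃ a' : E →L[ℝ] E, HasFDerivAt a a' (extChartAt 𝓘(ℝ, E) (1 : D) 1) ∧
      ∀ z, a' z = lieD D z x := by
  have : IsTopologicalGroup D := topologicalGroup_of_lieGroup 𝓘(ℝ, E) ∞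
  set χ := extChartAt 𝓘(ℝ, E) (1 : D) with hχ
  set u₀ := χ 1 with hu₀
  have h1 : χ.symm u₀ = 1 := extChartAt_to_inv (1 : D)
  have hsrc : χ.source ∈ 𝓝 (1 : D) := extChartAt_source_mem_nhds (I := 𝓘(ℝ, E)) (1 : D)
  have hM := (contDiffAt_mulChart (E := E) D).of_le (m := 2) two_le_infty
  have hC := (contDiffAt_conjChart (E := E) D).of_le (m := 2) two_le_infty
  have hc : ContinuousAt (fun u : E => (u, u₀)) u₀ := by fun_prop
  have hcs : ContinuousAt χ.symm u₀ := continuousAt_extChartAt_symm (1 : D)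
  -- The adjoint action is the derivative of conjugation in its second argument, so its derivative
  -- in the group variable is a mixed second derivative, which `local_adjoint_deriv` evaluates.
  refine ⟨fun u => fderiv ℝ (conjChart D) (u, u₀) (0, x), ?_, _,
    hasFDerivAt_fderiv_apply_comp (c := fun u : E => (u, u₀)) hC
      (hasFDerivAt_prodMk_left u₀ u₀) ((0 : E), x), fun z => ?_⟩
  · filter_upwards [hc.eventually (eventually_differentiableAt hC)] with u hd
    have h2 := mfderiv_symm_fderiv_charts (f := fun d : D => χ.symm u * d * (χ.symm u)⁻¹)
      (x := 1) (n := 1) (y := u₀)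
      ((contMDiff_conj _).contMDiffAt.mdifferentiableAt (by simp))
      (by simp) (by simp [hu₀, hχ]) x
    have h3 : HasFDerivAt (fun v => conjChart D (u, v))
        (fderiv ℝ (conjChart D) (u, u₀) ∘L (ContinuousLinearMap.inr ℝ E E)) u₀ :=
      hd.hasFDerivAt.comp u₀ (hasFDerivAt_prodMk_right u u₀)
    have : IsManifold 𝓘(ℝ, E) 1 D := IsManifold.of_le (n := ∞) (by simp)
    have h4 := congrArg (fun T : E →L[ℝ] E => T (fderiv ℝ (conjChart D) (u, u₀) (0, x)))
      (mfderiv_extChartAt_symm_self (E := E) (1 : D))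
    refine h2.symm.trans (Eq.trans ?_ h4)
    exact congrArg (mfderiv 𝓘(ℝ, E) 𝓘(ℝ, E) χ.symm u₀)
      (congrArg (fun T : E →L[ℝ] E => T x) h3.fderiv)
  · rw [lieD_eq_mulChart]
    refine local_adjoint_deriv hC hM (eventually_mulChart_right_unit D) ?_ ?_ ?_ x z
    · filter_upwards [eventually_extChartAt_symm_mem_source (D := D)] with u hu
      rw [conjChart, h1, one_mul, inv_one, mul_one, hu.2]
    · refine Filter.Eventually.of_forall fun u => ?_
      rw [conjChart, h1, mul_one, mul_inv_cancel]
    · have hcont : ContinuousAt (fun p : E × E => χ.symm p.1 * χ.symm p.2 * (χ.symm p.1)⁻¹)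
          (u₀, u₀) := by
        have c1 : ContinuousAt (fun p : E × E => χ.symm p.1) (u₀, u₀) :=
          ContinuousAt.comp (g := χ.symm) hcs continuousAt_fst
        have c2 : ContinuousAt (fun p : E × E => χ.symm p.2) (u₀, u₀) :=
          ContinuousAt.comp (g := χ.symm) hcs continuousAt_snd
        exact (c1.mul c2).mul c1.inv
      have hev : ∀ᶠ p : E × E in 𝓝 (u₀, u₀),
          χ.symm p.1 * χ.symm p.2 * (χ.symm p.1)⁻¹ ∈ χ.source := by
        apply hcont.eventually
        simpa [h1] using hsrc
      rw [nhds_prod_eq] at hev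
      filter_upwards [hev.curry] with u hu
      filter_upwards [hu] with v hv
      change χ (χ.symm (χ _) * χ.symm u) = χ _
      rw [χ.left_inv hv, inv_mul_cancel_right]

/-- The adjoint action of a connected Lie group preserves an invariant bilinear form. -/
theorem adjointAction_isometry [ConnectedSpace D] {b : LinearMap.BilinForm ℝ E}
    (hb : IsQuadratic D b) (k : D) (x y : E) :
    b (adjointAction k x) (adjointAction k y) = b x y := by
  set χ := extChartAt 𝓘(ℝ, E) (1 : D) with hχ
  set u₀ := χ 1 with hu₀
  let B : E →L[ℝ] E →L[ℝ] ℝ := LinearMap.toContinuousBilinearMap b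
  have hB : ∀ v w, B v w = b v w := fun v w => rfl
  -- At the identity the derivative along `z` is `b([z,x], y) + b(x, [z,y])`, which vanishes by
  -- invariance.
  have hone : ∀ x y : E, HasMFDerivAt 𝓘(ℝ, E) 𝓘(ℝ, ℝ)
      (fun d : D => b (adjointAction d x) (adjointAction d y)) 1 (0 : E →L[ℝ] ℝ) := by
    intro x y
    obtain ⟨a, ha, a', ha', hax⟩ := exists_adjoint_chart (D := D) x
    obtain ⟨c, hc, c', hc', hcy⟩ := exists_adjoint_chart (D := D) y
    have hax0 : a u₀ = x := by
      rw [← ha.self_of_nhds, extChartAt_to_inv, adjointAction_one]; rfl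
    have hcy0 : c u₀ = y := by
      rw [← hc.self_of_nhds, extChartAt_to_inv, adjointAction_one]; rfl
    have hd : HasFDerivAt (fun u => B (a u) (c u)) (0 : E →L[ℝ] ℝ) u₀ := by
      have := (B.hasFDerivAt.comp u₀ ha').clm_apply hc'
      refine this.congr_fderiv ?_
      ext z
      have := hb.invariant z x y
      simp only [Function.comp, hax0, hcy0, add_apply, ContinuousLinearMap.comp_apply,
        ContinuousLinearMap.flip_apply, hB, hax, hcy]
      rw [add_comm]
      exact this
    have hχd : MDifferentiableAt 𝓘(ℝ, E) 𝓘(ℝ, E) χ (1 : D) :=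
      (contMDiffAt_extChartAt (n := ∞)).mdifferentiableAt (by simp)
    have h2 := (hd.hasMFDerivAt.comp (1 : D) hχd.hasMFDerivAt).congr_mfderiv
      (f₁' := (0 : E →L[ℝ] ℝ)) (ContinuousLinearMap.zero_comp _)
    refine h2.congr_of_eventuallyEq ?_
    have hcχ : ContinuousAt χ (1 : D) := continuousAt_extChartAt 1
    filter_upwards [hcχ.eventually (ha.and hc),
      extChartAt_source_mem_nhds (I := 𝓘(ℝ, E)) (1 : D)] with d h3 h4
    rw [χ.left_inv h4] at h3
    rw [h3.1, h3.2]
    rfl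
  -- The factorization of `Ad d` as `Ad (d * k⁻¹)` after `Ad k` carries the vanishing at the
  -- identity to every `k`, with `x` and `y` replaced by their images under `Ad k`.
  have hall : ∀ k : D, HasMFDerivAt 𝓘(ℝ, E) 𝓘(ℝ, ℝ)
      (fun d : D => b (adjointAction d x) (adjointAction d y)) k (0 : E →L[ℝ] ℝ) := by
    intro k
    have hr : MDifferentiableAt 𝓘(ℝ, E) 𝓘(ℝ, E) (fun d : D => d * k⁻¹) k :=
      contMDiff_mul_right.contMDiffAt.mdifferentiableAt (n := ∞) (by simp)
    have h1 := hone (adjointAction k x) (adjointAction k y)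
    rw [← mul_inv_cancel k] at h1
    have h2 := (HasMFDerivAt.comp k h1 hr.hasMFDerivAt).congr_mfderiv
      (f₁' := (0 : E →L[ℝ] ℝ)) (ContinuousLinearMap.zero_comp _)
    refine h2.congr_of_eventuallyEq (Filter.Eventually.of_forall fun d => ?_)
    have : ∀ x : E, adjointAction d x = adjointAction (d * k⁻¹) (adjointAction k x) := by
      intro x
      have := congrArg (fun T : E →L[ℝ] E => T x) (adjointAction_mul (E := E) (d * k⁻¹) k)
      rwa [inv_mul_cancel_right] at this
    simp only [this]
    rfl
  have := eq_of_mfderiv_eq_zero (fun k => (hall k).mdifferentiableAt) (fun k => (hall k).mfderiv) k 1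
  rw [this, adjointAction_one]
  rfl

end Adjoint

/-! ### Smoothness of the action on the coset space -/

section Dressing

variable {E : Type*} [NormedAddCommGroup E] [NormedSpace ℝ E] [FiniteDimensional ℝ E]
  {D : Type*} [TopologicalSpace D] [ChartedSpace E D] [Group D] [LieGroup 𝓘(ℝ, E) ∞ D]
  {G : Subgroup D}
  {F : Type*} [NormedAddCommGroup F] [NormedSpace ℝ F]
  [ChartedSpace F (D ⧸ G)] [IsManifold 𝓘(ℝ, F) ∞ (D ⧸ G)]

/-- With a local section `τ` of the projection, the action is locally `(d, s) ↦ π (d * τ s)`. -/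
theorem contMDiff_coset_smul [FiniteDimensional ℝ F]
    (hsmooth : ContMDiff 𝓘(ℝ, E) 𝓘(ℝ, F) ∞ (fun d : D => (d : D ⧸ G)))
    (hsubm : ∀ d : D, Function.Surjective
      (mfderiv 𝓘(ℝ, E) 𝓘(ℝ, F) (fun d : D => (d : D ⧸ G)) d)) :
    ContMDiff (𝓘(ℝ, E).prod 𝓘(ℝ, F)) 𝓘(ℝ, F) ∞ (fun p : D × (D ⧸ G) => p.1 • p.2) := by
  rintro ⟨d, s⟩
  obtain ⟨g, rfl⟩ := QuotientGroup.mk_surjective s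
  obtain ⟨τ, hτ, hsec⟩ := exists_local_section hsmooth g (hsubm g)
  have h1 : ContMDiffAt (𝓘(ℝ, E).prod 𝓘(ℝ, F)) 𝓘(ℝ, E) ∞
      (fun p : D × (D ⧸ G) => p.1 * τ p.2) (d, (g : D ⧸ G)) :=
    contMDiffAt_fst.mul (ContMDiffAt.comp (g := τ) (d, (g : D ⧸ G)) hτ contMDiffAt_snd)
  have h2 := ContMDiffAt.comp (d, (g : D ⧸ G)) (hsmooth.contMDiffAt) h1
  refine h2.congr_of_eventuallyEq ?_
  have hc : Filter.Tendsto (fun p : D × (D ⧸ G) => p.2) (𝓝 (d, (g : D ⧸ G))) (𝓝 (g : D ⧸ G)) :=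
    continuousAt_snd
  filter_upwards [hc.eventually hsec] with p hp
  change p.1 • p.2 = ((p.1 * τ p.2 : D) : D ⧸ G)
  conv_lhs => rw [← hp]
  rfl

variable (hact : ContMDiff (𝓘(ℝ, E).prod 𝓘(ℝ, F)) 𝓘(ℝ, F) ∞
  (fun p : D × (D ⧸ G) => p.1 • p.2))

include hact

theorem contMDiff_smul_left (s : D ⧸ G) :
    ContMDiff 𝓘(ℝ, E) 𝓘(ℝ, F) ∞ (fun d : D => d • s) :=
  hact.comp (contMDiff_id.prodMk contMDiff_const)

theorem contMDiff_smul_right (d : D) :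
    ContMDiff 𝓘(ℝ, F) 𝓘(ℝ, F) ∞ (fun s : D ⧸ G => d • s) :=
  hact.comp (contMDiff_const.prodMk contMDiff_id)

/-- The tangent map of the whole action `D × S → S` is smooth; evaluate it on the pair made of `x`
at `1` and the zero vector at `s`, which depends smoothly on `s`. -/
theorem contMDiff_rho_const (x : E) :
    ContMDiff 𝓘(ℝ, F) 𝓘(ℝ, F).tangent ∞
      (fun s : D ⧸ G => TotalSpace.mk' F s (rho G F s x)) := by
  have : IsManifold 𝓘(ℝ, E) 1 D := IsManifold.of_le (n := ∞) (by simp)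
  have : IsManifold 𝓘(ℝ, F) 1 (D ⧸ G) := IsManifold.of_le (n := ∞) (by simp)
  let fv : D ⧸ G → TangentBundle 𝓘(ℝ, E) D := fun _ => TotalSpace.mk' E 1 x
  have sfv : ContMDiff 𝓘(ℝ, F) 𝓘(ℝ, E).tangent ∞ fv := contMDiff_const
  let fg : D ⧸ G → TangentBundle 𝓘(ℝ, F) (D ⧸ G) := fun s => TotalSpace.mk' F s 0
  have sfg : ContMDiff 𝓘(ℝ, F) 𝓘(ℝ, F).tangent ∞ fg := contMDiff_zeroSection ℝ _
  have S₂ : ContMDiff (𝓘(ℝ, E).tangent.prod 𝓘(ℝ, F).tangent) (𝓘(ℝ, E).prod 𝓘(ℝ, F)).tangent ∞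
      (equivTangentBundleProd 𝓘(ℝ, E) D 𝓘(ℝ, F) (D ⧸ G)).symm :=
    contMDiff_equivTangentBundleProd_symm
  have S₃ : ContMDiff (𝓘(ℝ, E).prod 𝓘(ℝ, F)).tangent 𝓘(ℝ, F).tangent ∞
      (tangentMap (𝓘(ℝ, E).prod 𝓘(ℝ, F)) 𝓘(ℝ, F) (fun p : D × (D ⧸ G) => p.1 • p.2)) :=
    hact.contMDiff_tangentMap (m := ∞) (by simp)
  have S := (S₃.comp S₂).comp (sfv.prodMk sfg)
  convert! S using 1
  ext s
  · simp [fv, fg]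
  · simp only [Function.comp_apply, tangentMap, fv, fg]
    rw [mfderiv_prod_eq_add_apply (hact.mdifferentiableAt (by simp))]
    refine heq_of_eq ?_
    change rho G F s x = (mfderiv 𝓘(ℝ, E) 𝓘(ℝ, F) (fun d : D => d • s) 1 x : F)
      + (mfderiv 𝓘(ℝ, F) 𝓘(ℝ, F) (fun t : D ⧸ G => (1 : D) • t) s (0 : F) : F)
    refine Eq.trans (add_zero (rho G F s x : F)).symm (congrArg _ ?_)
    exact (map_zero (mfderiv 𝓘(ℝ, F) 𝓘(ℝ, F) (fun t : D ⧸ G => (1 : D) • t) s)).symm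

/-- The infinitesimal action sends smooth functions `S → 𝔡` to smooth vector fields. -/
theorem contMDiff_rho {ψ : D ⧸ G → E} (hψ : ContMDiff 𝓘(ℝ, F) 𝓘(ℝ, E) ∞ ψ) :
    ContMDiff 𝓘(ℝ, F) 𝓘(ℝ, F).tangent ∞
      (fun s : D ⧸ G => TotalSpace.mk' F s (rho G F s (ψ s))) := by
  have : IsManifold 𝓘(ℝ, F) 1 (D ⧸ G) := IsManifold.of_le (n := ∞) (by simp)
  let B := Module.finBasis ℝ E
  have h : ∀ s, rho G F s (ψ s) = ∑ i, (B.coord i (ψ s)) • rho G F s (B i) := by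
    intro s
    calc rho G F s (ψ s) = rho G F s (∑ i, B.repr (ψ s) i • B i) := by rw [B.sum_repr]
      _ = _ := (map_sum (rho G F s) _ _).trans
        (Finset.sum_congr rfl fun i _ => map_smul (rho G F s) _ _)
  simp_rw [h]
  refine ContMDiff.sum_section fun i _ => ContMDiff.smul_section ?_ (contMDiff_rho_const hact (B i))
  exact (LinearMap.toContinuousLinearMap (B.coord i)).contMDiff.comp hψ

end Dressing

theorem mvfderiv_eq_fderiv_chart {F V : Type*} [NormedAddCommGroup F] [NormedSpace ℝ F]
    [NormedAddCommGroup V] [NormedSpace ℝ V]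
    {S : Type*} [TopologicalSpace S] [ChartedSpace F S] {h : S → V} {s : S}
    (hh : MDifferentiableAt 𝓘(ℝ, F) 𝓘(ℝ, V) h s) (v : F) :
    mvfderiv 𝓘(ℝ, F) h s v =
      fderiv ℝ (fun y => h ((extChartAt 𝓘(ℝ, F) s).symm y)) (extChartAt 𝓘(ℝ, F) s s) v := by
  have := congrArg (fun T : F →L[ℝ] V => T v) (mfderiv_eq_fderiv_charts hh)
  exact this

theorem differentiableAt_comp_chart_symm {F V : Type*} [NormedAddCommGroup F] [NormedSpace ℝ F]
    [NormedAddCommGroup V] [NormedSpace ℝ V]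
    {S : Type*} [TopologicalSpace S] [ChartedSpace F S] [IsManifold 𝓘(ℝ, F) ∞ S] {h : S → V} {s : S}
    (hh : MDifferentiableAt 𝓘(ℝ, F) 𝓘(ℝ, V) h s) :
    DifferentiableAt ℝ (fun y => h ((extChartAt 𝓘(ℝ, F) s).symm y)) (extChartAt 𝓘(ℝ, F) s s) := by
  rw [← mdifferentiableAt_iff_differentiableAt]
  have h1 := (contMDiffAt_extChartAt_symm_self
    (mem_extChartAt_target (I := 𝓘(ℝ, F)) s)).mdifferentiableAt (by simp)
  refine MDifferentiableAt.comp (g := h) _ ?_ h1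
  rwa [extChartAt_to_inv]

/-! ### Lie brackets of the fields of the infinitesimal action -/

section Dressing

variable {E : Type*} [NormedAddCommGroup E] [NormedSpace ℝ E] [FiniteDimensional ℝ E]
  {D : Type*} [TopologicalSpace D] [ChartedSpace E D] [Group D] [LieGroup 𝓘(ℝ, E) ∞ D]
  {G : Subgroup D}
  {F : Type*} [NormedAddCommGroup F] [NormedSpace ℝ F]
  [ChartedSpace F (D ⧸ G)] [IsManifold 𝓘(ℝ, F) ∞ (D ⧸ G)]

/-- The action of `D` on `D ⧸ G` in the preferred charts at `1` and `s`. -/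
def actChart (s : D ⧸ G) (p : E × F) : F :=
  extChartAt 𝓘(ℝ, F) s
    ((extChartAt 𝓘(ℝ, E) (1 : D)).symm p.1 • (extChartAt 𝓘(ℝ, F) s).symm p.2)

variable (hact : ContMDiff (𝓘(ℝ, E).prod 𝓘(ℝ, F)) 𝓘(ℝ, F) ∞
  (fun p : D × (D ⧸ G) => p.1 • p.2))

include hact

omit [FiniteDimensional ℝ E] in
theorem contDiffAt_actChart (s : D ⧸ G) :
    ContDiffAt ℝ ∞ (actChart (E := E) s)
      (extChartAt 𝓘(ℝ, E) (1 : D) 1, extChartAt 𝓘(ℝ, F) s s) := by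
  set χ := extChartAt 𝓘(ℝ, E) (1 : D) with hχ
  set φ := extChartAt 𝓘(ℝ, F) s with hφ
  have h1 : χ.symm (χ 1) = 1 := extChartAt_to_inv (1 : D)
  have h2 : φ.symm (φ s) = s := extChartAt_to_inv s
  rw [← contMDiffAt_iff_contDiffAt]
  have ha : ContMDiffAt 𝓘(ℝ, E × F) 𝓘(ℝ, E) ∞ (fun p : E × F => χ.symm p.1) (χ 1, φ s) :=
    (contMDiffAt_extChartAt_symm_self (mem_extChartAt_target (I := 𝓘(ℝ, E)) (1 : D))).comp
      (χ 1, φ s) (contDiff_fst.contDiffAt.contMDiffAt)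
  have hb : ContMDiffAt 𝓘(ℝ, E × F) 𝓘(ℝ, F) ∞ (fun p : E × F => φ.symm p.2) (χ 1, φ s) :=
    (contMDiffAt_extChartAt_symm_self (mem_extChartAt_target (I := 𝓘(ℝ, F)) s)).comp
      (χ 1, φ s) (contDiff_snd.contDiffAt.contMDiffAt)
  have hm : ContMDiffAt 𝓘(ℝ, E × F) 𝓘(ℝ, F) ∞ (fun p : E × F => χ.symm p.1 • φ.symm p.2)
      (χ 1, φ s) := hact.contMDiffAt.comp (χ 1, φ s) (ha.prodMk hb)
  have hc : ContMDiffAt 𝓘(ℝ, F) 𝓘(ℝ, F) ∞ φ (χ.symm (χ 1) • φ.symm (φ s)) := by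
    rw [h1, one_smul, h2]; exact contMDiffAt_extChartAt
  exact ContMDiffAt.comp (g := φ) (χ 1, φ s) hc hm

/-- A coordinate expression of the infinitesimal action in one fixed chart, valid on a neighbourhood
of `s`: the Lie bracket differentiates it once more, so its value at `s` alone would not do. -/
theorem eventually_rho_eq_actChart (s : D ⧸ G) :
    ∀ᶠ y in 𝓝 (extChartAt 𝓘(ℝ, F) s s), ∀ v : E,
      (mfderiv 𝓘(ℝ, F) 𝓘(ℝ, F) (extChartAt 𝓘(ℝ, F) s).symm y
        (fderiv ℝ (actChart s) (extChartAt 𝓘(ℝ, E) (1 : D) 1, y) (v, 0)) : F)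
        = rho G F ((extChartAt 𝓘(ℝ, F) s).symm y) v := by
  set χ := extChartAt 𝓘(ℝ, E) (1 : D) with hχ
  set φ := extChartAt 𝓘(ℝ, F) s with hφ
  have hc : ContinuousAt (fun y : F => (χ 1, y)) (φ s) := by fun_prop
  filter_upwards [hc.eventually (eventually_differentiableAt
    ((contDiffAt_actChart hact s).of_le two_le_infty)), extChartAt_target_mem_nhds_self s]
    with y hd hy v
  have h2 := mfderiv_symm_fderiv_charts (f := fun d : D => d • φ.symm y)
    (x := 1) (n := s) (y := y)
    ((contMDiff_smul_left hact _).contMDiffAt.mdifferentiableAt (by simp))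
    (by rw [one_smul]; exact φ.map_target hy) (by rw [one_smul]; exact φ.right_inv hy) v
  refine Eq.trans ?_ h2
  have h3 : HasFDerivAt (fun u => actChart (E := E) s (u, y))
      (fderiv ℝ (actChart s) (χ 1, y) ∘L (ContinuousLinearMap.inl ℝ E F)) (χ 1) :=
    HasFDerivAt.comp (g := actChart s) (f := fun u => (u, y)) (χ 1) hd.hasFDerivAt
      (hasFDerivAt_prodMk_left (χ 1) y)
  exact congrArg (mfderiv 𝓘(ℝ, F) 𝓘(ℝ, F) φ.symm y)
    (congrArg (fun T : E →L[ℝ] F => T v) h3.fderiv).symm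

theorem rho_eq_actChart (s : D ⧸ G) (v : E) :
    (rho G F s v : F) = fderiv ℝ (actChart s)
      (extChartAt 𝓘(ℝ, E) (1 : D) 1, extChartAt 𝓘(ℝ, F) s s) (v, 0) := by
  have : IsManifold 𝓘(ℝ, F) 1 (D ⧸ G) := IsManifold.of_le (n := ∞) (by simp)
  have h := (eventually_rho_eq_actChart hact s).self_of_nhds v
  have h2 : ∀ t, t = s → (rho G F t v : F) = (rho G F s v : F) := by rintro t rfl; rfl
  rw [← h2 _ (extChartAt_to_inv (I := 𝓘(ℝ, F)) s), ← h]
  exact congrArg (fun T : F →L[ℝ] F => T (fderiv ℝ (actChart s)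
    (extChartAt 𝓘(ℝ, E) (1 : D) 1, extChartAt 𝓘(ℝ, F) s s) (v, 0)))
    (mfderiv_extChartAt_symm_self (E := F) s)

/-- The Lie bracket of the vector fields `ρ(ψ)`, `ρ(ψ')` for functions `ψ ψ' : S → 𝔡`. -/
theorem mlieBracket_rho [FiniteDimensional ℝ F] {ψ ψ' : D ⧸ G → E} {s : D ⧸ G}
    (hψ : MDifferentiableAt 𝓘(ℝ, F) 𝓘(ℝ, E) ψ s) (hψ' : MDifferentiableAt 𝓘(ℝ, F) 𝓘(ℝ, E) ψ' s) :
    mlieBracket 𝓘(ℝ, F) (fun t => rho G F t (ψ t)) (fun t => rho G F t (ψ' t)) s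
      = rho G F s (lieSec G F ψ' s (ψ s) - lieSec G F ψ s (ψ' s) - lieD D (ψ s) (ψ' s)) := by
  have : IsTopologicalGroup D := topologicalGroup_of_lieGroup 𝓘(ℝ, E) ∞
  have : CompleteSpace F := FiniteDimensional.complete ℝ F
  set χ := extChartAt 𝓘(ℝ, E) (1 : D) with hχ
  set φ := extChartAt 𝓘(ℝ, F) s with hφ
  set u₀ := χ 1 with hu₀
  set y₀ := φ s with hy₀
  have h1 : χ.symm u₀ = 1 := extChartAt_to_inv (1 : D)
  have h2 : φ.symm y₀ = s := extChartAt_to_inv s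
  have hA := (contDiffAt_actChart hact s).of_le two_le_infty
  have hM := (contDiffAt_mulChart (E := E) D).of_le (m := 2) two_le_infty
  -- The product rule separates the variation of the action from the variation of `ψ`. The
  -- antisymmetrized first part is the Lie algebra term, with the sign of an anti-homomorphism
  -- because the action is a left action; the second part gives the Lie derivatives.
  have hder : ∀ {ψ : D ⧸ G → E}, MDifferentiableAt 𝓘(ℝ, F) 𝓘(ℝ, E) ψ s → ∀ v : F,
      fderiv ℝ (fun y => fderiv ℝ (actChart s) (u₀, y) (ψ (φ.symm y), 0)) y₀ v
      = fderiv ℝ (fderiv ℝ (actChart s)) (u₀, y₀) (0, v) (ψ s, 0)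
        + fderiv ℝ (actChart s) (u₀, y₀) (mvfderiv 𝓘(ℝ, F) ψ s v, 0) := by
    intro ψ hψ v
    have a1 : HasFDerivAt (fun y => fderiv ℝ (actChart (E := E) s) (u₀, y)) _ y₀ :=
      HasFDerivAt.comp (g := fderiv ℝ (actChart (E := E) s)) (f := fun y : F => (u₀, y)) y₀
        (((hA.fderiv_right (m := 1) (by norm_num)).differentiableAt (by simp)).hasFDerivAt)
        (hasFDerivAt_prodMk_right u₀ y₀)
    have a2 := (differentiableAt_comp_chart_symm hψ).hasFDerivAt
    have a3 := a1.clm_apply (a2.prodMk (hasFDerivAt_const (0 : F) y₀))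
    refine (congrArg (fun T : F →L[ℝ] F => T v) a3.fderiv).trans ?_
    rw [mvfderiv_eq_fderiv_chart hψ]
    change fderiv ℝ (actChart s) (u₀, y₀) (fderiv ℝ (fun y => ψ (φ.symm y)) y₀ v, 0)
      + fderiv ℝ (fderiv ℝ (actChart s)) (u₀, y₀) (0, v) (ψ (φ.symm y₀), 0) = _
    rw [h2, add_comm]
  have hb := mlieBracket_eq_of_chart (x := s)
    (X := fun t => rho G F t (ψ t)) (Y := fun t => rho G F t (ψ' t))
    (X' := fun y => fderiv ℝ (actChart s) (u₀, y) (ψ (φ.symm y), 0))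
    (Y' := fun y => fderiv ℝ (actChart s) (u₀, y) (ψ' (φ.symm y), 0))
    ((eventually_rho_eq_actChart hact s).mono fun y h => h _)
    ((eventually_rho_eq_actChart hact s).mono fun y h => h _)
  rw [← hφ, ← hy₀, hder hψ, hder hψ'] at hb
  simp only [h2] at hb
  have hact' := local_action_bracket (A := actChart s) (M := mulChart D) (u₀ := u₀) (y₀ := y₀)
    hA hM (by rw [actChart, h1, one_smul, h2])
    (eventually_mulChart_left_unit D) (eventually_mulChart_right_unit D) ?_ (ψ s) (ψ' s)
  · rw [← lieD_eq_mulChart] at hact'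
    refine hb.trans ?_
    have e : ∀ v, (rho G F s v : F) = fderiv ℝ (actChart s) (u₀, y₀) (v, 0) :=
      rho_eq_actChart hact s
    refine Eq.trans ?_ (e _).symm
    have l1 : lieSec G F ψ' s (ψ s) = mvfderiv 𝓘(ℝ, F) ψ' s
      (fderiv ℝ (actChart s) (u₀, y₀) (ψ s, 0)) := congrArg (mvfderiv 𝓘(ℝ, F) ψ' s) (e _)
    have l2 : lieSec G F ψ s (ψ' s) = mvfderiv 𝓘(ℝ, F) ψ s
      (fderiv ℝ (actChart s) (u₀, y₀) (ψ' s, 0)) := congrArg (mvfderiv 𝓘(ℝ, F) ψ s) (e _)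
    rw [l1, l2]
    have lin : ∀ a b c : E, fderiv ℝ (actChart s) (u₀, y₀) (a - b - c, 0)
        = fderiv ℝ (actChart s) (u₀, y₀) (a, 0) - fderiv ℝ (actChart s) (u₀, y₀) (b, 0)
          - fderiv ℝ (actChart s) (u₀, y₀) (c, (0 : F)) := by
      intro a b c
      rw [← map_sub, ← map_sub]
      simp
    rw [lin, sub_eq_add_neg _ (fderiv ℝ (actChart s) (u₀, y₀) (lieD D (ψ s) (ψ' s), 0)), ← hact']
    abel
  -- The action law transfers to charts only where the intermediate products stay in the chart
  -- domains, hence the nested neighbourhoods.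
  · have hsrc : φ.source ∈ 𝓝 s := extChartAt_source_mem_nhds (I := 𝓘(ℝ, F)) s
    have hsrcD : χ.source ∈ 𝓝 (1 : D) := extChartAt_source_mem_nhds (I := 𝓘(ℝ, E)) (1 : D)
    have hcs : ContinuousAt χ.symm u₀ := continuousAt_extChartAt_symm (1 : D)
    have c1 : ContinuousAt (fun u : E => χ.symm u • φ.symm y₀) u₀ :=
      ContinuousAt.comp (g := fun d : D => d • φ.symm y₀)
        (contMDiff_smul_left hact _).continuous.continuousAt hcs
    have e1 : ∀ᶠ u' in 𝓝 u₀, χ.symm u' • φ.symm y₀ ∈ φ.source := by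
      apply c1.eventually
      simpa [h1, h2] using hsrc
    have e2 : ∀ᶠ p : E × E in 𝓝 (u₀, u₀), χ.symm p.2 * χ.symm p.1 ∈ χ.source := by
      have c3 : ContinuousAt (fun p : E × E => χ.symm p.2 * χ.symm p.1) (u₀, u₀) := by
        have c4 : ContinuousAt (fun p : E × E => χ.symm p.1) (u₀, u₀) :=
          ContinuousAt.comp (g := χ.symm) hcs continuousAt_fst
        have c5 : ContinuousAt (fun p : E × E => χ.symm p.2) (u₀, u₀) :=
          ContinuousAt.comp (g := χ.symm) hcs continuousAt_snd
        exact c5.mul c4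
      apply c3.eventually
      simpa [h1] using hsrcD
    rw [nhds_prod_eq] at e2
    filter_upwards [e1, e2.curry] with u' h3 h4
    filter_upwards [h4] with u h5
    rw [actChart, actChart, actChart, mulChart, ← hφ, ← hχ, φ.left_inv h3, χ.left_inv h5, smul_smul]

end Dressing

/-! ### Kernels of the infinitesimal action -/

section Lagrangian

variable {E : Type*} [NormedAddCommGroup E] [NormedSpace ℝ E] [FiniteDimensional ℝ E]
  {D : Type*} [TopologicalSpace D] [ChartedSpace E D] [Group D] [LieGroup 𝓘(ℝ, E) ∞ D]
  {G : Subgroup D}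
  {F : Type*} [NormedAddCommGroup F] [NormedSpace ℝ F] [FiniteDimensional ℝ F]
  [ChartedSpace F (D ⧸ G)] [IsManifold 𝓘(ℝ, F) ∞ (D ⧸ G)]

omit [FiniteDimensional ℝ E] [LieGroup 𝓘(ℝ, E) ∞ D] [FiniteDimensional ℝ F]
  [IsManifold 𝓘(ℝ, F) ∞ (D ⧸ G)] in
theorem rho_one (x : E) : (rho G F ((1 : D) : D ⧸ G) x : F)
    = mfderiv 𝓘(ℝ, E) 𝓘(ℝ, F) (fun d : D => (d : D ⧸ G)) 1 x := by
  have h : (fun d : D => d • ((1 : D) : D ⧸ G)) = fun d : D => (d : D ⧸ G) := by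
    ext d
    change ((d * 1 : D) : D ⧸ G) = d
    rw [mul_one]
  rw [rho, h]
  rfl

/-- The kernel of the infinitesimal action at the base point is the Lie algebra of `G`. -/
theorem rho_one_eq_zero_iff
    (hsmooth : ContMDiff 𝓘(ℝ, E) 𝓘(ℝ, F) ∞ (fun d : D => (d : D ⧸ G)))
    (hsubm : ∀ d : D, Function.Surjective
      (mfderiv 𝓘(ℝ, E) 𝓘(ℝ, F) (fun d : D => (d : D ⧸ G)) d)) (x : E) :
    rho G F ((1 : D) : D ⧸ G) x = 0 ↔ x ∈ lieSubgroup (E := E) G := by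
  constructor
  · intro h
    obtain ⟨γ, hγ, h0, h1, h2⟩ := exists_curve_in_fibre hsmooth (1 : D) (hsubm 1)
      ((rho_one x).symm.trans h)
    refine ⟨γ, hγ, h0, fun t => ?_, h2⟩
    have := QuotientGroup.eq.1 (h1 t).symm
    simpa using this
  · rintro ⟨γ, hγ, h0, h1, h2⟩
    refine (rho_one x).trans ?_
    have hc : (fun t => ((γ t : D) : D ⧸ G)) = fun _ => ((1 : D) : D ⧸ G) := by
      ext t
      exact (QuotientGroup.eq.2 (by simpa using h1 t)).symm
    have e := mfderiv_comp_of_eq (I := 𝓘(ℝ, ℝ)) (I' := 𝓘(ℝ, E)) (I'' := 𝓘(ℝ, F)) (x := (0 : ℝ))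
      (g := fun d : D => (d : D ⧸ G)) (f := γ) (y := 1)
      (hsmooth.contMDiffAt.mdifferentiableAt (by simp))
      (hγ.contMDiffAt.mdifferentiableAt (by simp)) h0
    have e' : (mfderiv 𝓘(ℝ, ℝ) 𝓘(ℝ, F) (fun t => ((γ t : D) : D ⧸ G)) 0 : ℝ →L[ℝ] F) = 0 := by
      rw [hc]; exact mfderiv_const
    have e2 := congrArg (fun T : ℝ →L[ℝ] F => T (1 : ℝ)) (e.symm.trans e')
    have key : ∀ d : D, d = 1 → (mfderiv 𝓘(ℝ, E) 𝓘(ℝ, F) (fun d : D => (d : D ⧸ G)) d x : F) = 0 →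
        (mfderiv 𝓘(ℝ, E) 𝓘(ℝ, F) (fun d : D => (d : D ⧸ G)) 1 x : F) = 0 := by
      rintro d rfl h; exact h
    refine key (γ 0) h0 ?_
    rw [← h2]
    exact e2

omit [FiniteDimensional ℝ F] in
/-- Equivariance of the infinitesimal action. -/
theorem rho_adjointAction
    (hact : ContMDiff (𝓘(ℝ, E).prod 𝓘(ℝ, F)) 𝓘(ℝ, F) ∞ (fun p : D × (D ⧸ G) => p.1 • p.2))
    (k : D) (x : E) :
    (rho G F (k : D ⧸ G) (adjointAction k x) : F)
      = mfderiv 𝓘(ℝ, F) 𝓘(ℝ, F) (fun s : D ⧸ G => k • s) ((1 : D) : D ⧸ G)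
          (rho G F ((1 : D) : D ⧸ G) x) := by
  -- Differentiate the identity `(k g k⁻¹) · kG = k · (g · G)` in `g` at `1`.
  have h : (fun d : D => d • (k : D ⧸ G)) ∘ (fun g : D => k * g * k⁻¹)
      = (fun s : D ⧸ G => k • s) ∘ fun d : D => d • ((1 : D) : D ⧸ G) := by
    ext g
    change ((k * g * k⁻¹ * k : D) : D ⧸ G) = ((k * (g * 1) : D) : D ⧸ G)
    group
  have e1 := mfderiv_comp_of_eq (I := 𝓘(ℝ, E)) (I' := 𝓘(ℝ, E)) (I'' := 𝓘(ℝ, F)) (x := (1 : D))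
      (g := fun d : D => d • (k : D ⧸ G)) (f := fun g : D => k * g * k⁻¹) (y := 1)
      ((contMDiff_smul_left hact _).contMDiffAt.mdifferentiableAt (by simp))
      ((contMDiff_conj k).contMDiffAt.mdifferentiableAt (by simp)) (by simp)
  have e2 := mfderiv_comp_of_eq (I := 𝓘(ℝ, E)) (I' := 𝓘(ℝ, F)) (I'' := 𝓘(ℝ, F)) (x := (1 : D))
      (g := fun s : D ⧸ G => k • s) (f := fun d : D => d • ((1 : D) : D ⧸ G))
      (y := ((1 : D) : D ⧸ G))
      ((contMDiff_smul_right hact _).contMDiffAt.mdifferentiableAt (by simp))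
      ((contMDiff_smul_left hact _).contMDiffAt.mdifferentiableAt (by simp)) (one_smul _ _)
  rw [h] at e1
  let T₁ : D → E →L[ℝ] F := fun d => mfderiv 𝓘(ℝ, E) 𝓘(ℝ, F) (fun d : D => d • (k : D ⧸ G)) d
  have hT₁ : T₁ (k * 1 * k⁻¹) = T₁ 1 := by rw [mul_one, mul_inv_cancel]
  let T₂ : D ⧸ G → F →L[ℝ] F := fun s => mfderiv 𝓘(ℝ, F) 𝓘(ℝ, F) (fun s : D ⧸ G => k • s) s
  have hT₂ : T₂ ((1 : D) • ((1 : D) : D ⧸ G)) = T₂ ((1 : D) : D ⧸ G) := by rw [one_smul]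
  have a1 : (T₁ (k * 1 * k⁻¹)).comp (adjointAction (E := E) k)
      = (T₂ ((1 : D) • ((1 : D) : D ⧸ G))).comp (rho G F ((1 : D) : D ⧸ G) : E →L[ℝ] F) :=
    e1.symm.trans e2
  rw [hT₁, hT₂] at a1
  exact congrArg (fun T : E →L[ℝ] F => T x) a1

omit [FiniteDimensional ℝ F] in
theorem mfderiv_smul_injective
    (hact : ContMDiff (𝓘(ℝ, E).prod 𝓘(ℝ, F)) 𝓘(ℝ, F) ∞ (fun p : D × (D ⧸ G) => p.1 • p.2))
    (k : D) (s : D ⧸ G) :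
    Function.Injective (mfderiv 𝓘(ℝ, F) 𝓘(ℝ, F) (fun s : D ⧸ G => k • s) s) := by
  have h : (fun s : D ⧸ G => k⁻¹ • s) ∘ (fun s : D ⧸ G => k • s) = id := by
    ext s; simp
  have e := mfderiv_comp (I := 𝓘(ℝ, F)) (I' := 𝓘(ℝ, F)) (I'' := 𝓘(ℝ, F)) s
      (g := fun s : D ⧸ G => k⁻¹ • s) (f := fun s : D ⧸ G => k • s)
      ((contMDiff_smul_right hact _).contMDiffAt.mdifferentiableAt (by simp))
      ((contMDiff_smul_right hact _).contMDiffAt.mdifferentiableAt (by simp))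
  have hid := mfderiv_id (I := 𝓘(ℝ, F)) (x := s)
  rw [← h] at hid
  intro v w hvw
  have hv := congrArg (fun T : F →L[ℝ] F => T v) (e.symm.trans hid)
  have hw := congrArg (fun T : F →L[ℝ] F => T w) (e.symm.trans hid)
  refine hv.symm.trans (Eq.trans ?_ hw)
  exact congrArg (mfderiv 𝓘(ℝ, F) 𝓘(ℝ, F) (fun s : D ⧸ G => k⁻¹ • s) (k • s)) hvw

/-- The kernels of the infinitesimal action are Lagrangian. -/
theorem rho_eq_zero_iff_orthogonal [ConnectedSpace D]
    (hsmooth : ContMDiff 𝓘(ℝ, E) 𝓘(ℝ, F) ∞ (fun d : D => (d : D ⧸ G)))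
    (hsubm : ∀ d : D, Function.Surjective
      (mfderiv 𝓘(ℝ, E) 𝓘(ℝ, F) (fun d : D => (d : D ⧸ G)) d))
    {b : LinearMap.BilinForm ℝ E} (hb : IsQuadratic D b)
    (hG : ∀ x : E, x ∈ lieSubgroup (E := E) G ↔ ∀ y ∈ lieSubgroup (E := E) G, b x y = 0)
    (s : D ⧸ G) (x : E) :
    rho G F s x = 0 ↔ ∀ y, rho G F s y = 0 → b x y = 0 := by
  have hact := contMDiff_coset_smul hsmooth hsubm
  obtain ⟨k, rfl⟩ := QuotientGroup.mk_surjective s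
  -- The kernel at the coset of `k` is the `Ad k`-image of the kernel at the base coset. As `Ad k`
  -- is a surjective isometry, the Lagrangian property travels along.
  have hker : ∀ x, rho G F (k : D ⧸ G) (adjointAction k x) = 0 ↔ x ∈ lieSubgroup (E := E) G := by
    intro x
    rw [← rho_one_eq_zero_iff hsmooth hsubm]
    have h := rho_adjointAction hact k x
    constructor
    · intro h0
      refine mfderiv_smul_injective hact k _ ?_
      exact (h.symm.trans h0).trans (map_zero (mfderiv 𝓘(ℝ, F) 𝓘(ℝ, F)
        (fun s : D ⧸ G => k • s) ((1 : D) : D ⧸ G))).symm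
    · intro h0
      refine h.trans ?_
      rw [h0]
      exact map_zero (mfderiv 𝓘(ℝ, F) 𝓘(ℝ, F) (fun s : D ⧸ G => k • s) ((1 : D) : D ⧸ G))
  obtain ⟨x, rfl⟩ := adjointAction_surjective k x
  change rho G F (k : D ⧸ G) (adjointAction k x) = 0 ↔
    ∀ y, rho G F (k : D ⧸ G) y = 0 → b (adjointAction k x) y = 0
  rw [hker, hG]
  constructor
  · intro h y hy
    obtain ⟨y, rfl⟩ := adjointAction_surjective k y
    rw [adjointAction_isometry hb]
    exact h y ((hker y).1 hy)
  · intro h y hy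
    rw [← adjointAction_isometry hb k]
    exact h _ ((hker y).2 hy)

end Lagrangian

/-! ### The fibrewise algebra of `Ψ_σ` -/

section PsiAlgebra

variable {E : Type*} [NormedAddCommGroup E] [NormedSpace ℝ E] [FiniteDimensional ℝ E]
  {D : Type*} [TopologicalSpace D] [ChartedSpace E D] [Group D]
  {G : Subgroup D}
  {F : Type*} [NormedAddCommGroup F] [NormedSpace ℝ F] [ChartedSpace F (D ⧸ G)]
  {b : LinearMap.BilinForm ℝ E} (hb : b.Nondegenerate)

theorem pairing_rhoStar {s : D ⧸ G} (ξ : TangentSpace 𝓘(ℝ, F) s →L[ℝ] ℝ) (x : E) :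
    b (rhoStar G F hb s ξ) x = ξ (rho G F s x) := by
  change b ((b.toDual hb).symm _) x = _
  rw [LinearMap.BilinForm.apply_toDual_symm_apply]
  rfl

/-- The covector `b(e, σ ·)`. -/
def sigmaCov (b : LinearMap.BilinForm ℝ E) {s : D ⧸ G} (σs : TangentSpace 𝓘(ℝ, F) s →L[ℝ] E)
    (e : E) : TangentSpace 𝓘(ℝ, F) s →L[ℝ] ℝ :=
  (LinearMap.toContinuousLinearMap (b e) : E →L[ℝ] ℝ).comp σs

variable (hsymm : ∀ x y, b x y = b y x)
  (hlag : ∀ (s : D ⧸ G) (x : E), rho G F s x = 0 ↔ ∀ y, rho G F s y = 0 → b x y = 0)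

include hlag in
-- The vector `ρ* ξ` is orthogonal to the kernel of `ρ`, and the kernel contains its own orthogonal:
-- this is the coisotropic half of being Lagrangian.
theorem rho_rhoStar {s : D ⧸ G} (ξ : TangentSpace 𝓘(ℝ, F) s →L[ℝ] ℝ) :
    rho G F s (rhoStar G F hb s ξ) = 0 := by
  rw [hlag]
  intro y hy
  rw [pairing_rhoStar, hy, map_zero]

variable {σ : ∀ s : D ⧸ G, TangentSpace 𝓘(ℝ, F) s →L[ℝ] E}
  (hrho : ∀ s v, rho G F s (σ s v) = v) (hiso : ∀ s v w, b (σ s v) (σ s w) = 0)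

theorem Psi_apply {s : D ⧸ G} (p : GenTangent F (D ⧸ G) s) :
    Psi G F hb σ s p = σ s p.1 + rhoStar G F hb s p.2 := rfl

include hlag hrho in
theorem rho_Psi {s : D ⧸ G} (p : GenTangent F (D ⧸ G) s) :
    rho G F s (Psi G F hb σ s p) = p.1 := by
  rw [Psi_apply, map_add, hrho]
  exact (congrArg (fun w => p.1 + w) (rho_rhoStar hb hlag p.2)).trans (add_zero p.1)

include hsymm hlag hrho hiso in
-- The images of `σ` and of `ρ*` are both isotropic, so only the cross terms remain, and `ρ ∘ σ = 1`
-- makes them the canonical pairing.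
theorem pairing_Psi {s : D ⧸ G} (p q : GenTangent F (D ⧸ G) s) :
    b (Psi G F hb σ s p) (Psi G F hb σ s q) = canonicalPairing F s p q := by
  have h : canonicalPairing F s p q = q.2 p.1 + p.2 q.1 := rfl
  have h2 : b (rhoStar G F hb s p.2) (rhoStar G F hb s q.2) = 0 := by
    rw [pairing_rhoStar, rho_rhoStar hb hlag]; exact map_zero p.2
  rw [h, Psi_apply, Psi_apply, map_add, LinearMap.map_add₂, LinearMap.map_add₂, hiso, h2,
    hsymm (σ s p.1), pairing_rhoStar, pairing_rhoStar, hrho, hrho, zero_add, add_zero, add_comm]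

omit [FiniteDimensional ℝ E] in
theorem eq_of_pairing_eq {b : LinearMap.BilinForm ℝ E} (hb : b.Nondegenerate) {x y : E}
    (h : ∀ z, b x z = b y z) : x = y :=
  sub_eq_zero.1 (hb.1 _ fun z => by rw [map_sub, LinearMap.sub_apply, h, sub_self])

include hlag hrho hiso in
-- For every `e` the difference `e - σ(ρ e)` lies in the kernel of `ρ`. The kernel is isotropic, so
-- two such differences, for `e` and for a test vector `z`, pair to zero; expanding that pairing is
-- the claim tested against `z`.
theorem Psi_inverse_apply (s : D ⧸ G) (e : E) :
    Psi G F hb σ s (rho G F s e, sigmaCov b (σ s) e) = e := by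
  refine eq_of_pairing_eq hb fun z => ?_
  have h1 : ∀ e : E, rho G F s (e - σ s (rho G F s e)) = 0 := fun e => by
    rw [map_sub, hrho]; exact sub_self (rho G F s e)
  have h2 := (hlag s _).1 (h1 e) _ (h1 z)
  rw [map_sub, LinearMap.map_sub₂, LinearMap.map_sub₂, hiso, sub_zero] at h2
  have h3 : b (Psi G F hb σ s (rho G F s e, sigmaCov b (σ s) e)) z
      = b (σ s (rho G F s e)) z + b e (σ s (rho G F s z)) := by
    rw [Psi_apply, LinearMap.map_add₂, pairing_rhoStar]
    rfl
  rw [h3]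
  linarith

include hrho hiso in
theorem sigmaCov_Psi {s : D ⧸ G} (p : GenTangent F (D ⧸ G) s) :
    sigmaCov b (σ s) (Psi G F hb σ s p) = p.2 := by
  ext v
  change b (Psi G F hb σ s p) (σ s v) = p.2 v
  rw [Psi_apply, LinearMap.map_add₂, hiso, pairing_rhoStar, hrho, zero_add]

include hlag hrho hiso in
theorem Psi_bijective (s : D ⧸ G) : Function.Bijective (Psi G F hb σ s) := by
  refine ⟨fun p q h => Prod.ext ?_ ?_, fun e => ⟨_, Psi_inverse_apply hb hlag hrho hiso s e⟩⟩
  · rw [← rho_Psi hb hlag hrho p, h, rho_Psi hb hlag hrho q]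
  · rw [← sigmaCov_Psi hb hrho hiso p, h, sigmaCov_Psi hb hrho hiso q]

end PsiAlgebra

/-! ### Smooth sections of product and cotangent bundles -/

section Sections

theorem isSection_prod_iff {F : Type*} [NormedAddCommGroup F] [NormedSpace ℝ F]
    {S : Type*} [TopologicalSpace S] [ChartedSpace F S]
    {F₁ F₂ : Type*} [NormedAddCommGroup F₁] [NormedSpace ℝ F₁] [NormedAddCommGroup F₂]
    [NormedSpace ℝ F₂] {V₁ V₂ : S → Type*} [∀ x, AddCommGroup (V₁ x)] [∀ x, AddCommGroup (V₂ x)]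
    [TopologicalSpace (TotalSpace F₁ V₁)] [∀ x, TopologicalSpace (V₁ x)] [FiberBundle F₁ V₁]
    [TopologicalSpace (TotalSpace F₂ V₂)] [∀ x, TopologicalSpace (V₂ x)] [FiberBundle F₂ V₂]
    {ψ : ∀ s, V₁ s × V₂ s} :
    IsSection 𝓘(ℝ, F) (F₁ × F₂) (V₁ ×ᵇ V₂) ψ ↔
      IsSection 𝓘(ℝ, F) F₁ V₁ (fun s => (ψ s).1) ∧ IsSection 𝓘(ℝ, F) F₂ V₂ (fun s => (ψ s).2) := by
  constructor
  · intro h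
    refine ⟨fun s => ?_, fun s => ?_⟩
    · rw [contMDiffAt_section]
      have h' := (contMDiffAt_section (E := V₁ ×ᵇ V₂) (F := F₁ × F₂) s).1 (h s)
      exact ContMDiffAt.comp (g := (Prod.fst : F₁ × F₂ → F₁)) s
        contDiff_fst.contMDiff.contMDiffAt h'
    · rw [contMDiffAt_section]
      have h' := (contMDiffAt_section (E := V₁ ×ᵇ V₂) (F := F₁ × F₂) s).1 (h s)
      exact ContMDiffAt.comp (g := (Prod.snd : F₁ × F₂ → F₂)) s
        contDiff_snd.contMDiff.contMDiffAt h'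
  · rintro ⟨h1, h2⟩ s
    rw [contMDiffAt_section]
    exact ((contMDiffAt_section s).1 (h1 s)).prodMk_space ((contMDiffAt_section s).1 (h2 s))

theorem IsSection.cotangent_apply {F : Type*} [NormedAddCommGroup F] [NormedSpace ℝ F]
    {S : Type*} [TopologicalSpace S] [ChartedSpace F S] [IsManifold 𝓘(ℝ, F) ∞ S]
    {ξ : ∀ s, Cotangent F s} {X : ∀ s : S, TangentSpace 𝓘(ℝ, F) s}
    (hξ : IsSection 𝓘(ℝ, F) (F →L[ℝ] ℝ) (Cotangent F : S → Type _) ξ)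
    (hX : IsSection 𝓘(ℝ, F) F (TangentSpace 𝓘(ℝ, F) : S → Type _) X) :
    ContMDiff 𝓘(ℝ, F) 𝓘(ℝ, ℝ) ∞ (fun s => (ξ s (X s) : ℝ)) := by
  have : IsManifold 𝓘(ℝ, F) 1 S := IsManifold.of_le (n := ∞) (by simp)
  intro s
  have h := ContMDiff.clm_bundle_apply (F₁ := F) (F₂ := ℝ)
    (E₁ := (TangentSpace 𝓘(ℝ, F) : S → Type _)) (E₂ := Bundle.Trivial S ℝ) hξ hX
  exact (contMDiffAt_section s).1 (h s)

/-- The covector field `b(e, σ ·)` is smooth. -/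
theorem isSection_sigmaCov {E : Type*} [NormedAddCommGroup E] [NormedSpace ℝ E]
    [FiniteDimensional ℝ E]
    {F : Type*} [NormedAddCommGroup F] [NormedSpace ℝ F] [FiniteDimensional ℝ F]
    {S : Type*} [TopologicalSpace S] [ChartedSpace F S] [IsManifold 𝓘(ℝ, F) ∞ S]
    (b : LinearMap.BilinForm ℝ E)
    {σ : ∀ s : S, TangentSpace 𝓘(ℝ, F) s →L[ℝ] E}
    (hσ : ContMDiff 𝓘(ℝ, F).tangent 𝓘(ℝ, E) ∞
      (fun p : TangentBundle 𝓘(ℝ, F) S => σ p.1 p.2))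
    {e : S → E} (he : ContMDiff 𝓘(ℝ, F) 𝓘(ℝ, E) ∞ e) :
    IsSection 𝓘(ℝ, F) (F →L[ℝ] ℝ) (Cotangent F : S → Type _) (fun s =>
      ((LinearMap.toContinuousLinearMap (b (e s)) : E →L[ℝ] ℝ).comp (σ s) :
        TangentSpace 𝓘(ℝ, F) s →L[ℝ] ℝ)) := by
  have : IsManifold 𝓘(ℝ, F) 1 S := IsManifold.of_le (n := ∞) (by simp)
  intro s₀
  rw [contMDiffAt_hom_bundle]
  refine ⟨contMDiffAt_id, ?_⟩
  let t := trivializationAt F (TangentSpace 𝓘(ℝ, F) : S → Type _) s₀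
  let B := Module.finBasis ℝ F
  have hv : ∀ v : F, ContMDiffAt 𝓘(ℝ, F) 𝓘(ℝ, ℝ) ∞ (fun s => b (e s) (σ s (t.symmL ℝ s v))) s₀ := by
    intro v
    have h1 := (t.contMDiffAt_symmL (IB := 𝓘(ℝ, F)) (n := ∞)
      (FiberBundle.mem_baseSet_trivializationAt' s₀)).clm_bundle_apply
      (v := fun _ => v) ((contMDiffAt_section (E := Bundle.Trivial S F) (s := fun _ => v) s₀).2
        contMDiffAt_const)
    have h2 : ContMDiffAt 𝓘(ℝ, F) 𝓘(ℝ, E) ∞ (fun s => σ s (t.symmL ℝ s v)) s₀ :=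
      ContMDiffAt.comp (g := fun p : TangentBundle 𝓘(ℝ, F) S => σ p.1 p.2) s₀ (hσ _) h1
    exact (((LinearMap.toContinuousBilinearMap b).contMDiff.contMDiffAt.comp s₀
      he.contMDiffAt).clm_apply h2)
  -- Expanding the covector in the dual of a fixed basis of `F` reduces smoothness in the Hom bundle
  -- to that of finitely many scalar functions.
  have hsum : ContMDiffAt 𝓘(ℝ, F) 𝓘(ℝ, F →L[ℝ] ℝ) ∞
      (fun s => ∑ i, b (e s) (σ s (t.symmL ℝ s (B i))) •
        (LinearMap.toContinuousLinearMap (B.coord i) : F →L[ℝ] ℝ)) s₀ := by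
    refine ContMDiffAt.sum fun i _ => (hv (B i)).smul contMDiffAt_const
  refine hsum.congr_of_eventuallyEq (Filter.Eventually.of_forall fun s => ?_)
  ext v
  have hl : ∀ w : F, b (e s) (σ s (t.symmL ℝ s w))
      = ((LinearMap.toContinuousLinearMap (b (e s)) : E →L[ℝ] ℝ).comp (σ s)).comp
        (t.symmL ℝ s : F →L[ℝ] TangentSpace 𝓘(ℝ, F) s) w := fun w => rfl
  have hc : (trivializationAt ℝ (Trivial S ℝ) s₀).continuousLinearMapAt ℝ s
      = ContinuousLinearMap.id ℝ ℝ :=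
    Bundle.Trivial.continuousLinearMapAt_trivialization ℝ S ℝ s
  have hin : ContinuousLinearMap.inCoordinates F (TangentSpace 𝓘(ℝ, F) : S → Type _) ℝ
      (Trivial S ℝ) s₀ s s₀ s ((LinearMap.toContinuousLinearMap (b (e s)) : E →L[ℝ] ℝ).comp (σ s))
      = (ContinuousLinearMap.id ℝ ℝ).comp
        (((LinearMap.toContinuousLinearMap (b (e s)) : E →L[ℝ] ℝ).comp (σ s)).comp
        (t.symmL ℝ s : F →L[ℝ] TangentSpace 𝓘(ℝ, F) s)) :=
    congrArg (fun T : ℝ →L[ℝ] ℝ => T.comp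
      (((LinearMap.toContinuousLinearMap (b (e s)) : E →L[ℝ] ℝ).comp (σ s)).comp
        (t.symmL ℝ s : F →L[ℝ] TangentSpace 𝓘(ℝ, F) s))) hc
  refine (congrArg (fun T : F →L[ℝ] ℝ => T v) hin).trans ?_
  change b (e s) (σ s (t.symmL ℝ s v)) = (∑ i, b (e s) (σ s (t.symmL ℝ s (B i))) •
        (LinearMap.toContinuousLinearMap (B.coord i) : F →L[ℝ] ℝ)) v
  rw [sum_apply, hl]
  conv_lhs => rw [← B.sum_repr v]
  rw [map_sum]
  refine Finset.sum_congr rfl fun i _ => ?_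
  rw [map_smul, hl]
  exact mul_comm _ _

/-- The pairings with the vectors of a basis are the coordinates in the dual basis. -/
theorem contMDiff_of_forall_pairing {E : Type*} [NormedAddCommGroup E] [NormedSpace ℝ E]
    [FiniteDimensional ℝ E]
    {F : Type*} [NormedAddCommGroup F] [NormedSpace ℝ F]
    {S : Type*} [TopologicalSpace S] [ChartedSpace F S]
    {b : LinearMap.BilinForm ℝ E} (hb : b.Nondegenerate) {e : S → E}
    (h : ∀ x, ContMDiff 𝓘(ℝ, F) 𝓘(ℝ, ℝ) ∞ (fun s => b (e s) x)) :
    ContMDiff 𝓘(ℝ, F) 𝓘(ℝ, E) ∞ e := by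
  let B := Module.finBasis ℝ E
  have : e = fun s => ∑ i, b (e s) (B i) • b.dualBasis hb B i := by
    ext s
    conv_lhs => rw [← (b.dualBasis hb B).sum_repr (e s)]
    simp only [LinearMap.BilinForm.dualBasis_repr_apply]
  rw [this]
  intro s
  exact ContMDiffAt.sum fun i _ => (h (B i) s).smul contMDiffAt_const

end Sections

/-! ### `Ψ_σ` and its inverse preserve smoothness -/

section PsiSections

variable {E : Type*} [NormedAddCommGroup E] [NormedSpace ℝ E] [FiniteDimensional ℝ E]
  {D : Type*} [TopologicalSpace D] [ChartedSpace E D] [Group D] [LieGroup 𝓘(ℝ, E) ∞ D]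
  {G : Subgroup D}
  {F : Type*} [NormedAddCommGroup F] [NormedSpace ℝ F] [FiniteDimensional ℝ F]
  [ChartedSpace F (D ⧸ G)]
  [IsManifold 𝓘(ℝ, F) ∞ (D ⧸ G)]
  {b : LinearMap.BilinForm ℝ E} (hb : b.Nondegenerate)
  (hact : ContMDiff (𝓘(ℝ, E).prod 𝓘(ℝ, F)) 𝓘(ℝ, F) ∞ (fun p : D × (D ⧸ G) => p.1 • p.2))
  {σ : ∀ s : D ⧸ G, TangentSpace 𝓘(ℝ, F) s →L[ℝ] E}
  (hσ : IsIsotropicSplitting G F b σ)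

include hact in
-- Pairing with a constant `x` yields `ξ(ρ(x))`, a smooth one-form evaluated on a smooth vector
-- field.
theorem contMDiff_rhoStar {ξ : ∀ s : D ⧸ G, Cotangent F s}
    (hξ : IsSection 𝓘(ℝ, F) (F →L[ℝ] ℝ) (Cotangent F : D ⧸ G → Type _) ξ) :
    ContMDiff 𝓘(ℝ, F) 𝓘(ℝ, E) ∞ (fun s => rhoStar G F hb s (ξ s)) := by
  refine contMDiff_of_forall_pairing hb fun x => ?_
  have := hξ.cotangent_apply (contMDiff_rho_const hact x)
  refine this.congr fun s => pairing_rhoStar hb (ξ s) x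

include hact hσ in
theorem contMDiff_Psi {ψ : ∀ s, GenTangent F (D ⧸ G) s}
    (hψ : IsSection 𝓘(ℝ, F) (F × (F →L[ℝ] ℝ)) (GenTangent F (D ⧸ G)) ψ) :
    ContMDiff 𝓘(ℝ, F) 𝓘(ℝ, E) ∞ (fun s => Psi G F hb σ s (ψ s)) := by
  obtain ⟨h1, h2⟩ := isSection_prod_iff.1 hψ
  exact (hσ.smooth.comp h1).add (contMDiff_rhoStar hb hact h2)

include hact hσ in
theorem isSection_Psi_inverse {e : D ⧸ G → E} (he : ContMDiff 𝓘(ℝ, F) 𝓘(ℝ, E) ∞ e) :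
    IsSection 𝓘(ℝ, F) (F × (F →L[ℝ] ℝ)) (GenTangent F (D ⧸ G))
      (fun s => (rho G F s (e s), sigmaCov b (σ s) (e s))) :=
  isSection_prod_iff.2 ⟨contMDiff_rho hact he, isSection_sigmaCov b hσ.smooth he⟩

end PsiSections

/-! ### Vector fields, one-forms and Cartan's formula in a chart -/

section ChartCalculus

variable {F : Type*} [NormedAddCommGroup F] [NormedSpace ℝ F]
  {S : Type*} [TopologicalSpace S] [ChartedSpace F S] [IsManifold 𝓘(ℝ, F) ∞ S]

/-- A vector field in the preferred chart at `s`. -/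
def chartRep (X : ∀ t : S, TangentSpace 𝓘(ℝ, F) t) (s : S) (y : F) : F :=
  mfderiv 𝓘(ℝ, F) 𝓘(ℝ, F) (extChartAt 𝓘(ℝ, F) s) ((extChartAt 𝓘(ℝ, F) s).symm y)
    (X ((extChartAt 𝓘(ℝ, F) s).symm y))

theorem mfderiv_symm_chartRep (X : ∀ t : S, TangentSpace 𝓘(ℝ, F) t) {s : S} {y : F}
    (hy : y ∈ (extChartAt 𝓘(ℝ, F) s).target) :
    mfderiv 𝓘(ℝ, F) 𝓘(ℝ, F) (extChartAt 𝓘(ℝ, F) s).symm y (chartRep (F := F) X s y)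
      = X ((extChartAt 𝓘(ℝ, F) s).symm y) := by
  have h := mfderiv_extChartAt_symm_comp ((extChartAt 𝓘(ℝ, F) s).map_target hy)
    (X ((extChartAt 𝓘(ℝ, F) s).symm y))
  let T₁ : F → F →L[ℝ] F := fun z => mfderiv 𝓘(ℝ, F) 𝓘(ℝ, F) (extChartAt 𝓘(ℝ, F) s).symm z
  have h2 : T₁ (extChartAt 𝓘(ℝ, F) s ((extChartAt 𝓘(ℝ, F) s).symm y)) = T₁ y :=
    congrArg T₁ ((extChartAt 𝓘(ℝ, F) s).right_inv hy)
  exact (congrArg (fun T : F →L[ℝ] F => T (chartRep X s y)) h2.symm).trans h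

theorem chartRep_self (X : ∀ t : S, TangentSpace 𝓘(ℝ, F) t) (s : S) :
    chartRep X s (extChartAt 𝓘(ℝ, F) s s) = X s := by
  have : IsManifold 𝓘(ℝ, F) 1 S := IsManifold.of_le (n := ∞) (by simp)
  have h := mfderiv_symm_chartRep X (mem_extChartAt_target (I := 𝓘(ℝ, F)) s)
  have h2 := congrArg (fun T : F →L[ℝ] F => T (chartRep X s (extChartAt 𝓘(ℝ, F) s s)))
    (mfderiv_extChartAt_symm_self (E := F) s)
  let X₁ : S → F := X
  have h3 : X₁ ((extChartAt 𝓘(ℝ, F) s).symm (extChartAt 𝓘(ℝ, F) s s)) = X₁ s :=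
    congrArg X₁ (extChartAt_to_inv s)
  exact h2.symm.trans (h.trans h3)

/-- The derivative of the chart is the trivialization of the tangent bundle at `s`, so the chart
representative agrees near the centre with the fibre coordinate through which smoothness of sections
is defined. -/
theorem differentiableAt_chartRep {X : ∀ t : S, TangentSpace 𝓘(ℝ, F) t}
    (hX : IsSection 𝓘(ℝ, F) F (TangentSpace 𝓘(ℝ, F) : S → Type _) X) (s : S) :
    DifferentiableAt ℝ (chartRep X s) (extChartAt 𝓘(ℝ, F) s s) := by
  have : IsManifold 𝓘(ℝ, F) 1 S := IsManifold.of_le (n := ∞) (by simp)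
  have h := ((contMDiffAt_section s).1 (hX s)).mdifferentiableAt (by simp)
  have h2 := differentiableAt_comp_chart_symm h
  refine h2.congr_of_eventuallyEq ?_
  filter_upwards [extChartAt_target_mem_nhds_self s] with y hy
  have hm : (extChartAt 𝓘(ℝ, F) s).symm y ∈ (chartAt F s).source := by
    simpa using (extChartAt 𝓘(ℝ, F) s).map_target hy
  have h3 := TangentBundle.continuousLinearMapAt_trivializationAt (𝕜 := ℝ) (I := 𝓘(ℝ, F)) hm
  have h4 := congrArg (fun T : F →L[ℝ] F => T (X ((extChartAt 𝓘(ℝ, F) s).symm y))) h3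
  refine h4.symm.trans ?_
  exact congrFun (Trivialization.coe_linearMapAt_of_mem (R := ℝ)
    (trivializationAt F (TangentSpace 𝓘(ℝ, F) : S → Type _) s) (b := (extChartAt 𝓘(ℝ, F) s).symm y) hm)
      (X ((extChartAt 𝓘(ℝ, F) s).symm y))

theorem differentiableAt_cotangent_chart {η : ∀ t : S, TangentSpace 𝓘(ℝ, F) t →L[ℝ] ℝ}
    (hη : IsSection 𝓘(ℝ, F) (F →L[ℝ] ℝ) (Cotangent F : S → Type _) η) (s : S) :
    DifferentiableAt ℝ (fun y : F => ((η ((extChartAt 𝓘(ℝ, F) s).symm y)).comp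
      (mfderiv 𝓘(ℝ, F) 𝓘(ℝ, F) (extChartAt 𝓘(ℝ, F) s).symm y) : F →L[ℝ] ℝ))
      (extChartAt 𝓘(ℝ, F) s s) := by
  have : IsManifold 𝓘(ℝ, F) 1 S := IsManifold.of_le (n := ∞) (by simp)
  have h := (((contMDiffAt_hom_bundle _).1 (hη s)).2).mdifferentiableAt (by simp)
  have h2 := differentiableAt_comp_chart_symm h
  refine h2.congr_of_eventuallyEq ?_
  filter_upwards [extChartAt_target_mem_nhds_self s] with y hy
  have hm : (extChartAt 𝓘(ℝ, F) s).symm y ∈ (chartAt F s).source := by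
    simpa using (extChartAt 𝓘(ℝ, F) s).map_target hy
  have hc : (trivializationAt ℝ (Trivial S ℝ) s).continuousLinearMapAt ℝ
      ((extChartAt 𝓘(ℝ, F) s).symm y) = ContinuousLinearMap.id ℝ ℝ :=
    Bundle.Trivial.continuousLinearMapAt_trivialization ℝ S ℝ _
  have h3 := TangentBundle.symmL_trivializationAt (𝕜 := ℝ) (I := 𝓘(ℝ, F)) hm
  rw [ModelWithCorners.range_eq_univ, mfderivWithin_univ] at h3
  let T₁ : F → F →L[ℝ] F := fun z => mfderiv 𝓘(ℝ, F) 𝓘(ℝ, F) (extChartAt 𝓘(ℝ, F) s).symm z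
  have h4 : T₁ (extChartAt 𝓘(ℝ, F) s ((extChartAt 𝓘(ℝ, F) s).symm y)) = T₁ y :=
    congrArg T₁ ((extChartAt 𝓘(ℝ, F) s).right_inv hy)
  have h5 := (h3.trans h4).symm
  let η₁ : F →L[ℝ] ℝ := η ((extChartAt 𝓘(ℝ, F) s).symm y)
  have h6 := congrArg₂ (fun (A : ℝ →L[ℝ] ℝ) (T : F →L[ℝ] F) => A.comp (η₁.comp T)) hc.symm h5
  exact h6

theorem mvfderiv_along {V : Type*} [NormedAddCommGroup V] [NormedSpace ℝ V] {h : S → V}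
    {s : S} (X : ∀ t : S, TangentSpace 𝓘(ℝ, F) t)
    (hh : MDifferentiable 𝓘(ℝ, F) 𝓘(ℝ, V) h) {y : F}
    (hy : y ∈ (extChartAt 𝓘(ℝ, F) s).target) :
    mvfderiv 𝓘(ℝ, F) h ((extChartAt 𝓘(ℝ, F) s).symm y) (X ((extChartAt 𝓘(ℝ, F) s).symm y))
      = fderiv ℝ (fun y => h ((extChartAt 𝓘(ℝ, F) s).symm y)) y (chartRep X s y) := by
  have h1 : HasMFDerivAt 𝓘(ℝ, F) 𝓘(ℝ, F) (extChartAt 𝓘(ℝ, F) s).symm y _ :=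
    ((contMDiffAt_extChartAt_symm_self hy).mdifferentiableAt (by simp)).hasMFDerivAt
  have h2 := (hh ((extChartAt 𝓘(ℝ, F) s).symm y)).hasMFDerivAt.comp y h1
  let A : F →L[ℝ] V := mfderiv 𝓘(ℝ, F) 𝓘(ℝ, V) h ((extChartAt 𝓘(ℝ, F) s).symm y)
  let B : F →L[ℝ] F := mfderiv 𝓘(ℝ, F) 𝓘(ℝ, F) (extChartAt 𝓘(ℝ, F) s).symm y
  have h3 : HasFDerivAt (fun y => h ((extChartAt 𝓘(ℝ, F) s).symm y)) (A.comp B) y :=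
    h2.hasFDerivAt
  have h4 := congrArg (fun T : F →L[ℝ] V => T (chartRep (F := F) X s y)) h3.fderiv
  refine Eq.trans ?_ h4.symm
  exact congrArg (mfderiv 𝓘(ℝ, F) 𝓘(ℝ, V) h ((extChartAt 𝓘(ℝ, F) s).symm y))
    (mfderiv_symm_chartRep X hy).symm

theorem mlieBracket_eq_chartRep [CompleteSpace F] (X Y : ∀ t : S, TangentSpace 𝓘(ℝ, F) t) (s : S) :
    mlieBracket 𝓘(ℝ, F) X Y s
      = lieBracket ℝ (chartRep (F := F) X s) (chartRep (F := F) Y s) (extChartAt 𝓘(ℝ, F) s s) :=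
  mlieBracket_eq_of_chart
    (by filter_upwards [extChartAt_target_mem_nhds_self s] with y hy
        exact mfderiv_symm_chartRep X hy)
    (by filter_upwards [extChartAt_target_mem_nhds_self s] with y hy
        exact mfderiv_symm_chartRep Y hy)

/-- In the chart this is symmetry of the second derivative of `h`. Vector values are allowed because
it is applied to `𝔡`-valued functions in the curvature of `∇^E`. -/
theorem mvfderiv_mlieBracket [CompleteSpace F] {V : Type*} [NormedAddCommGroup V] [NormedSpace ℝ V]
    {h : S → V} (hh : ContMDiff 𝓘(ℝ, F) 𝓘(ℝ, V) ∞ h)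
    {X Y : ∀ t : S, TangentSpace 𝓘(ℝ, F) t}
    (hX : IsSection 𝓘(ℝ, F) F (TangentSpace 𝓘(ℝ, F) : S → Type _) X)
    (hY : IsSection 𝓘(ℝ, F) F (TangentSpace 𝓘(ℝ, F) : S → Type _) Y) (s : S)
    (hXh : MDifferentiableAt 𝓘(ℝ, F) 𝓘(ℝ, V) (fun t => mvfderiv 𝓘(ℝ, F) h t (X t)) s)
    (hYh : MDifferentiableAt 𝓘(ℝ, F) 𝓘(ℝ, V) (fun t => mvfderiv 𝓘(ℝ, F) h t (Y t)) s) :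
    mvfderiv 𝓘(ℝ, F) h s (mlieBracket 𝓘(ℝ, F) X Y s)
      = mvfderiv 𝓘(ℝ, F) (fun t => mvfderiv 𝓘(ℝ, F) h t (Y t)) s (X s)
        - mvfderiv 𝓘(ℝ, F) (fun t => mvfderiv 𝓘(ℝ, F) h t (X t)) s (Y s) := by
  have hd := hh.mdifferentiable (by simp)
  have key : ∀ X : ∀ t : S, TangentSpace 𝓘(ℝ, F) t,
      (fun y => mvfderiv 𝓘(ℝ, F) h ((extChartAt 𝓘(ℝ, F) s).symm y)
        (X ((extChartAt 𝓘(ℝ, F) s).symm y))) =ᶠ[𝓝 (extChartAt 𝓘(ℝ, F) s s)]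
      fun y => fderiv ℝ (fun y => h ((extChartAt 𝓘(ℝ, F) s).symm y)) y (chartRep X s y) := by
    intro X
    filter_upwards [extChartAt_target_mem_nhds_self s] with y hy
    exact mvfderiv_along X hd hy
  have hc : ContDiffAt ℝ ∞ (fun y => h ((extChartAt 𝓘(ℝ, F) s).symm y))
      (extChartAt 𝓘(ℝ, F) s s) := by
    rw [← contMDiffAt_iff_contDiffAt]
    exact ContMDiffAt.comp (g := h) _ (hh _)
      (contMDiffAt_extChartAt_symm_self (mem_extChartAt_target s))
  have h1 := fderiv_apply_lieBracket (hc.of_le two_le_infty) (by simp)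
    (differentiableAt_chartRep hY s) (differentiableAt_chartRep hX s)
  refine (mvfderiv_eq_fderiv_chart (hd s) _).trans ?_
  refine (congrArg (fderiv ℝ (fun y => h ((extChartAt 𝓘(ℝ, F) s).symm y))
      (extChartAt 𝓘(ℝ, F) s s)) (mlieBracket_eq_chartRep X Y s)).trans ?_
  refine h1.trans (congrArg₂ (· - ·) ?_ ?_)
  · refine Eq.trans ?_ (mvfderiv_eq_fderiv_chart hYh _).symm
    rw [(key Y).fderiv_eq, chartRep_self]
  · refine Eq.trans ?_ (mvfderiv_eq_fderiv_chart hXh _).symm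
    rw [(key X).fderiv_eq, chartRep_self]

/-- Cartan's formula. Differentiating `η(Y)` and `η(X)` by the product rule yields the
antisymmetrized derivative of `η` plus terms differentiating the fields, and the latter add up to
`η` of the bracket. -/
theorem extDerivOne_apply [CompleteSpace F] {η : ∀ t : S, TangentSpace 𝓘(ℝ, F) t →L[ℝ] ℝ}
    (hη : IsSection 𝓘(ℝ, F) (F →L[ℝ] ℝ) (Cotangent F : S → Type _) η)
    {X Y : ∀ t : S, TangentSpace 𝓘(ℝ, F) t}
    (hX : IsSection 𝓘(ℝ, F) F (TangentSpace 𝓘(ℝ, F) : S → Type _) X)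
    (hY : IsSection 𝓘(ℝ, F) F (TangentSpace 𝓘(ℝ, F) : S → Type _) Y) (s : S) :
    extDerivOne F η s (X s) (Y s)
      = mvfderiv 𝓘(ℝ, F) (fun t => (η t (Y t) : ℝ)) s (X s)
        - mvfderiv 𝓘(ℝ, F) (fun t => (η t (X t) : ℝ)) s (Y s)
        - η s (mlieBracket 𝓘(ℝ, F) X Y s) := by
  have : IsManifold 𝓘(ℝ, F) 1 S := IsManifold.of_le (n := ∞) (by simp)
  set φ := extChartAt 𝓘(ℝ, F) s with hφ
  let η' : F → F →L[ℝ] ℝ := fun y => (η (φ.symm y)).comp (mfderiv 𝓘(ℝ, F) 𝓘(ℝ, F) φ.symm y)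
  have hη' : DifferentiableAt ℝ η' (φ s) := differentiableAt_cotangent_chart hη s
  have hT : (mfderiv 𝓘(ℝ, F) 𝓘(ℝ, F) φ s : F →L[ℝ] F) = ContinuousLinearMap.id ℝ F :=
    mfderiv_extChartAt_self
  have hL : extDerivOne F η s (X s) (Y s)
      = fderiv ℝ η' (φ s) (X s) (Y s) - fderiv ℝ η' (φ s) (Y s) (X s) := by
    have : ∀ (T : F →L[ℝ] F), T = ContinuousLinearMap.id ℝ F → ∀ (x y : F),
        ((fderiv ℝ η' (φ s) (T x) - (fderiv ℝ η' (φ s)).flip (T x)).comp T) y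
          = fderiv ℝ η' (φ s) x y - fderiv ℝ η' (φ s) y x := by
      rintro T rfl x y; rfl
    exact this _ hT (X s) (Y s)
  have hη0 : ∀ v : F, η' (φ s) v = η s v := by
    intro v
    have h1 := congrArg (fun T : F →L[ℝ] F => η' (φ s) (T v)) hT
    let η₁ : S → F →L[ℝ] ℝ := η
    have h2 : η₁ (φ.symm (φ s)) = η₁ s := congrArg η₁ (extChartAt_to_inv s)
    have h3 := congrArg (fun T : F →L[ℝ] F => η₁ (φ.symm (φ s)) (T v))
      (mfderiv_extChartAt_symm_self (E := F) s)
    exact h3.trans (congrArg (fun L : F →L[ℝ] ℝ => L v) h2)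
  have key : ∀ {X Y : ∀ t : S, TangentSpace 𝓘(ℝ, F) t},
      IsSection 𝓘(ℝ, F) F (TangentSpace 𝓘(ℝ, F) : S → Type _) X →
      mvfderiv 𝓘(ℝ, F) (fun t => (η t (X t) : ℝ)) s (Y s)
        = fderiv ℝ η' (φ s) (Y s) (X s) + η s (fderiv ℝ (chartRep X s) (φ s) (Y s)) := by
    intro X Y hX
    refine (mvfderiv_eq_fderiv_chart
      ((hη.cotangent_apply hX s).mdifferentiableAt (by simp)) _).trans ?_
    have h1 : (fun y => (η (φ.symm y) (X (φ.symm y)) : ℝ)) =ᶠ[𝓝 (φ s)]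
        fun y => η' y (chartRep X s y) := by
      filter_upwards [extChartAt_target_mem_nhds_self s] with y hy
      exact congrArg (η (φ.symm y)) (mfderiv_symm_chartRep X hy).symm
    have h2 := (hη'.hasFDerivAt.clm_apply (differentiableAt_chartRep hX s).hasFDerivAt).fderiv
    refine (congrArg (fun T : F →L[ℝ] ℝ => T (Y s)) (h1.fderiv_eq.trans h2)).trans ?_
    have h3 : ∀ (a c : F), a = c → η' (φ s) (fderiv ℝ (chartRep X s) (φ s) (Y s))
        + fderiv ℝ η' (φ s) (Y s) a = fderiv ℝ η' (φ s) (Y s) c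
          + η' (φ s) (fderiv ℝ (chartRep X s) (φ s) (Y s)) := by
      rintro a c rfl; exact add_comm _ _
    exact (h3 _ _ (chartRep_self X s)).trans (congrArg₂ (· + ·) rfl (hη0 _))
  have hB : η s (mlieBracket 𝓘(ℝ, F) X Y s) = η s (fderiv ℝ (chartRep Y s) (φ s) (X s))
      - η s (fderiv ℝ (chartRep X s) (φ s) (Y s)) := by
    rw [mlieBracket_eq_chartRep, lieBracket, chartRep_self, chartRep_self]
    exact map_sub (η s) _ _
  rw [hL, key hX, key hY, hB]
  ring

end ChartCalculus

/-! ### Bilinearity of the bracket, read off from second derivatives of the multiplication -/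

section LieBilinear

variable {E : Type*} [NormedAddCommGroup E] [NormedSpace ℝ E] [FiniteDimensional ℝ E]
  (D : Type*) [TopologicalSpace D] [ChartedSpace E D] [Group D] [LieGroup 𝓘(ℝ, E) ∞ D]

theorem lieD_skew (x y : E) : lieD D y x = -lieD D x y := by
  rw [lieD_eq_mulChart, lieD_eq_mulChart, neg_sub]

theorem lieD_add_right (x y z : E) : lieD D x (y + z) = lieD D x y + lieD D x z := by
  have h1 : ((0 : E), y + z) = (0, y) + (0, z) := by simp
  have h2 : (y + z, (0 : E)) = (y, 0) + (z, 0) := by simp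
  simp only [lieD_eq_mulChart, h1, h2, map_add, add_apply]
  abel

theorem lieD_smul_right (c : ℝ) (x y : E) : lieD D x (c • y) = c • lieD D x y := by
  have h1 : ((0 : E), c • y) = c • (0, y) := by simp
  have h2 : (c • y, (0 : E)) = c • (y, 0) := by simp
  simp only [lieD_eq_mulChart, h1, h2, map_smul, smul_apply, smul_sub]

/-- The Lie bracket of `𝔡` as a bilinear map. -/
def lieBilin : E →ₗ[ℝ] E →ₗ[ℝ] E :=
  LinearMap.mk₂ ℝ (lieD D)
    (fun x y z => by rw [lieD_skew D z, lieD_skew D z x, lieD_skew D z y, lieD_add_right, neg_add])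
    (fun c x y => by rw [lieD_skew D y, lieD_skew D y x, lieD_smul_right, smul_neg])
    (lieD_add_right D) (fun c x y => lieD_smul_right D c x y)

theorem lieBilin_apply (x y : E) : lieBilin D x y = lieD D x y := rfl

end LieBilinear

/-- One Leibniz rule serves the form `b`, the bilinear map `D₀` and, with a constant second factor,
linear functionals. -/
theorem mvfderiv_bilin {E₁ E₂ E₃ : Type*} [NormedAddCommGroup E₁] [NormedSpace ℝ E₁]
    [FiniteDimensional ℝ E₁] [NormedAddCommGroup E₂] [NormedSpace ℝ E₂] [FiniteDimensional ℝ E₂]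
    [NormedAddCommGroup E₃] [NormedSpace ℝ E₃]
    {F : Type*} [NormedAddCommGroup F] [NormedSpace ℝ F]
    {S : Type*} [TopologicalSpace S] [ChartedSpace F S] [IsManifold 𝓘(ℝ, F) ∞ S]
    (β : E₁ →ₗ[ℝ] E₂ →ₗ[ℝ] E₃) {e₁ : S → E₁} {e₂ : S → E₂} {s : S}
    (h₁ : MDifferentiableAt 𝓘(ℝ, F) 𝓘(ℝ, E₁) e₁ s) (h₂ : MDifferentiableAt 𝓘(ℝ, F) 𝓘(ℝ, E₂) e₂ s)
    (v : TangentSpace 𝓘(ℝ, F) s) :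
    MDifferentiableAt 𝓘(ℝ, F) 𝓘(ℝ, E₃) (fun t => β (e₁ t) (e₂ t)) s ∧
    mvfderiv 𝓘(ℝ, F) (fun t => β (e₁ t) (e₂ t)) s v
      = β (mvfderiv 𝓘(ℝ, F) e₁ s v) (e₂ s) + β (e₁ s) (mvfderiv 𝓘(ℝ, F) e₂ s v) := by
  let B := LinearMap.toContinuousBilinearMap β
  have hd : MDifferentiableAt 𝓘(ℝ, F) 𝓘(ℝ, E₃) (fun t => β (e₁ t) (e₂ t)) s :=
    MDifferentiableAt.clm_apply
      (MDifferentiableAt.comp (g := B) s (B.differentiableAt.mdifferentiableAt) h₁) h₂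
  refine ⟨hd, ?_⟩
  have h := B.isBoundedBilinearMap
  have d₁ := differentiableAt_comp_chart_symm h₁
  have d₂ := differentiableAt_comp_chart_symm h₂
  have h3 := B.hasFDerivAt_of_bilinear d₁.hasFDerivAt d₂.hasFDerivAt
  refine (mvfderiv_eq_fderiv_chart hd v).trans ?_
  refine (congrArg (fun T : F →L[ℝ] E₃ => T v) h3.fderiv).trans ?_
  have h5 := mvfderiv_eq_fderiv_chart h₁ v
  have h6 := mvfderiv_eq_fderiv_chart h₂ v
  let T : F := v
  have e0 : (extChartAt 𝓘(ℝ, F) s).symm (extChartAt 𝓘(ℝ, F) s s) = s := extChartAt_to_inv s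
  change B (e₁ ((extChartAt 𝓘(ℝ, F) s).symm (extChartAt 𝓘(ℝ, F) s s)))
      (fderiv ℝ (fun y => e₂ ((extChartAt 𝓘(ℝ, F) s).symm y)) (extChartAt 𝓘(ℝ, F) s s) T)
    + B (fderiv ℝ (fun y => e₁ ((extChartAt 𝓘(ℝ, F) s).symm y)) (extChartAt 𝓘(ℝ, F) s s) T)
      (e₂ ((extChartAt 𝓘(ℝ, F) s).symm (extChartAt 𝓘(ℝ, F) s s))) = _
  rw [e0, ← h5, ← h6, add_comm]
  rfl

/-! ### The bracket of `S × 𝔡` and its transport to `𝕋S` -/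

section BracketE

variable {E : Type*} [NormedAddCommGroup E] [NormedSpace ℝ E] [FiniteDimensional ℝ E]
  {D : Type*} [TopologicalSpace D] [ChartedSpace E D] [Group D] [LieGroup 𝓘(ℝ, E) ∞ D]
  {G : Subgroup D}
  {F : Type*} [NormedAddCommGroup F] [NormedSpace ℝ F] [FiniteDimensional ℝ F]
  [ChartedSpace F (D ⧸ G)]
  [IsManifold 𝓘(ℝ, F) ∞ (D ⧸ G)]
  {b : LinearMap.BilinForm ℝ E} (hb : b.Nondegenerate)

omit [FiniteDimensional ℝ F] [LieGroup 𝓘(ℝ, E) ∞ D] in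
/-- The Leibniz rule for the Lie derivative of a bilinear expression. -/
theorem mvfderiv_pairing_rho {e₁ e₂ : D ⧸ G → E} {s : D ⧸ G}
    (h₁ : MDifferentiableAt 𝓘(ℝ, F) 𝓘(ℝ, E) e₁ s) (h₂ : MDifferentiableAt 𝓘(ℝ, F) 𝓘(ℝ, E) e₂ s)
    (x : E) :
    mvfderiv 𝓘(ℝ, F) (fun t => b (e₁ t) (e₂ t)) s (rho G F s x)
      = b (lieSec G F e₁ s x) (e₂ s) + b (e₁ s) (lieSec G F e₂ s x) :=
  (mvfderiv_bilin b h₁ h₂ _).2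

omit [FiniteDimensional ℝ F] [LieGroup 𝓘(ℝ, E) ∞ D] [FiniteDimensional ℝ E]
  [IsManifold 𝓘(ℝ, F) ∞ (D ⧸ G)] in
theorem lieSec_const (z : E) (s : D ⧸ G) (x : E) : lieSec G F (fun _ => z) s x = 0 := by
  change mvfderiv 𝓘(ℝ, F) (fun _ => z) s (rho G F s x) = 0
  rw [mvfderiv_const]; rfl

omit [FiniteDimensional ℝ F] [LieGroup 𝓘(ℝ, E) ∞ D] [IsManifold 𝓘(ℝ, F) ∞ (D ⧸ G)] in
theorem pairing_bracketE (e₁ e₂ : D ⧸ G → E) (s : D ⧸ G) (z : E) :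
    b (bracketE G F hb e₁ e₂ s) z = b (lieSec G F e₂ s (e₁ s)) z - b (lieSec G F e₁ s (e₂ s)) z
      - b (lieD D (e₁ s) (e₂ s)) z + b (lieSec G F e₁ s z) (e₂ s) := by
  rw [bracketE, LinearMap.map_add₂, LinearMap.map_sub₂, LinearMap.map_sub₂,
    LinearMap.BilinForm.apply_toDual_symm_apply]
  rfl

omit [FiniteDimensional ℝ F] [FiniteDimensional ℝ E] [LieGroup 𝓘(ℝ, E) ∞ D]
  [IsManifold 𝓘(ℝ, F) ∞ (D ⧸ G)] in
theorem lieSec_add {e₁ e₂ : D ⧸ G → E} {s : D ⧸ G}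
    (h₁ : MDifferentiableAt 𝓘(ℝ, F) 𝓘(ℝ, E) e₁ s) (h₂ : MDifferentiableAt 𝓘(ℝ, F) 𝓘(ℝ, E) e₂ s)
    (x : E) :
    lieSec G F (fun t => e₁ t + e₂ t) s x = lieSec G F e₁ s x + lieSec G F e₂ s x := by
  change mvfderiv 𝓘(ℝ, F) (fun t => e₁ t + e₂ t) s (rho G F s x) = _
  rw [mvfderiv_fun_add h₁ h₂]; rfl

theorem bracketE_add_right {e₁ e₂ e₃ : D ⧸ G → E} {s : D ⧸ G}
    (h₂ : MDifferentiableAt 𝓘(ℝ, F) 𝓘(ℝ, E) e₂ s) (h₃ : MDifferentiableAt 𝓘(ℝ, F) 𝓘(ℝ, E) e₃ s) :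
    bracketE G F hb e₁ (fun t => e₂ t + e₃ t) s
      = bracketE G F hb e₁ e₂ s + bracketE G F hb e₁ e₃ s := by
  refine eq_of_pairing_eq hb fun z => ?_
  simp only [LinearMap.add_apply, pairing_bracketE, lieSec_add h₂ h₃, map_add, lieD_add_right]
  ring

theorem bracketE_add_left {e₁ e₂ e₃ : D ⧸ G → E} {s : D ⧸ G}
    (h₁ : MDifferentiableAt 𝓘(ℝ, F) 𝓘(ℝ, E) e₁ s) (h₂ : MDifferentiableAt 𝓘(ℝ, F) 𝓘(ℝ, E) e₂ s) :
    bracketE G F hb (fun t => e₁ t + e₂ t) e₃ s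
      = bracketE G F hb e₁ e₃ s + bracketE G F hb e₂ e₃ s := by
  refine eq_of_pairing_eq hb fun z => ?_
  simp only [LinearMap.add_apply, pairing_bracketE, lieSec_add h₁ h₂, map_add, ← lieBilin_apply]
  ring

variable (hlag : ∀ (s : D ⧸ G) (x : E), rho G F s x = 0 ↔ ∀ y, rho G F s y = 0 → b x y = 0)
  (hact : ContMDiff (𝓘(ℝ, E).prod 𝓘(ℝ, F)) 𝓘(ℝ, F) ∞ (fun p : D × (D ⧸ G) => p.1 • p.2))

include hlag hact in
-- The last term of the bracket is `ρ*` of the covector `v ↦ b(L_v e₁, e₂)`, which `ρ` kills; the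
-- other terms are those of `mlieBracket_rho`.
theorem rho_bracketE {e₁ e₂ : D ⧸ G → E} {s : D ⧸ G}
    (h₁ : MDifferentiableAt 𝓘(ℝ, F) 𝓘(ℝ, E) e₁ s) (h₂ : MDifferentiableAt 𝓘(ℝ, F) 𝓘(ℝ, E) e₂ s) :
    rho G F s (bracketE G F hb e₁ e₂ s)
      = mlieBracket 𝓘(ℝ, F) (fun t => rho G F t (e₁ t)) (fun t => rho G F t (e₂ t)) s := by
  rw [mlieBracket_rho hact h₁ h₂, bracketE, map_add]
  let ξ : TangentSpace 𝓘(ℝ, F) s →L[ℝ] ℝ :=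
    (LinearMap.toContinuousLinearMap (b.flip (e₂ s)) : E →L[ℝ] ℝ).comp (mvfderiv 𝓘(ℝ, F) e₁ s)
  have h := rho_rhoStar hb hlag ξ
  have h' : (b.toDual hb).symm ((b.flip (e₂ s)).comp (lieSec G F e₁ s : E →ₗ[ℝ] E))
      = rhoStar G F hb s ξ := rfl
  rw [h']
  exact (congrArg (fun w => rho G F s _ + w) h).trans (add_zero _)

variable (hq : IsQuadratic D b)

include hlag hact hq in
-- Test against a constant `z` and use Cartan's formula on `ρ(ψ)` and `ρ(z)`. Their bracket is
-- `-ρ(L_{ρ(z)}ψ + [ψ, z])`, invariance of `b` moves the Lie bracket off `ρ* η`, and derivatives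
-- along `ρ(ρ* η) = 0` vanish.
theorem bracketE_rhoStar_right {ψ : D ⧸ G → E} (hψ : ContMDiff 𝓘(ℝ, F) 𝓘(ℝ, E) ∞ ψ)
    {η : ∀ t : D ⧸ G, TangentSpace 𝓘(ℝ, F) t →L[ℝ] ℝ}
    (hη : IsSection 𝓘(ℝ, F) (F →L[ℝ] ℝ) (Cotangent F : D ⧸ G → Type _) η) (s : D ⧸ G) :
    bracketE G F hb ψ (fun t => rhoStar G F hb t (η t)) s
      = rhoStar G F hb s (lieDerivOne F (fun t => rho G F t (ψ t)) η s) := by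
  have : CompleteSpace F := FiniteDimensional.complete ℝ F
  refine eq_of_pairing_eq hb fun z => ?_
  have hy : MDifferentiableAt 𝓘(ℝ, F) 𝓘(ℝ, E) (fun t => rhoStar G F hb t (η t)) s :=
    (contMDiff_rhoStar hb hact hη s).mdifferentiableAt (by simp)
  have hψ' := (hψ s).mdifferentiableAt (by simp : (∞ : ℕ∞ω) ≠ 0)
  have hz : MDifferentiableAt 𝓘(ℝ, F) 𝓘(ℝ, E) (fun _ : D ⧸ G => z) s :=
    mdifferentiableAt_const
  have hfun : (fun t => b (rhoStar G F hb t (η t)) z) = fun t => (η t (rho G F t z) : ℝ) :=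
    funext fun t => pairing_rhoStar hb (η t) z
  have h1 := mvfderiv_pairing_rho (b := b) hy hz (ψ s)
  rw [lieSec_const, map_zero, add_zero, hfun] at h1
  have h2 : lieSec G F ψ s (rhoStar G F hb s (η s)) = 0 :=
    (congrArg (mvfderiv 𝓘(ℝ, F) ψ s) (rho_rhoStar hb hlag (η s))).trans (map_zero _)
  have h3 := hq.invariant (ψ s) (rhoStar G F hb s (η s)) z
  have h4 : b (lieSec G F ψ s z) (rhoStar G F hb s (η s)) = η s (rho G F s (lieSec G F ψ s z)) := by
    rw [hq.symm, pairing_rhoStar]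
  have h5 := extDerivOne_apply hη (contMDiff_rho hact hψ) (contMDiff_rho_const hact z) s
  have h6 := mlieBracket_rho hact hψ' hz
  rw [lieSec_const, zero_sub, ← neg_add', map_neg, map_add] at h6
  have h7 : η s (mlieBracket 𝓘(ℝ, F) (fun t => rho G F t (ψ t)) (fun t => rho G F t z) s)
      = -(η s (rho G F s (lieSec G F ψ s z)) + η s (rho G F s (lieD D (ψ s) z))) := by
    rw [h6, ← map_add (η s)]; exact map_neg (η s) _
  have h8 : (lieDerivOne F (fun t => rho G F t (ψ t)) η s) (rho G F s z)
      = extDerivOne F η s (rho G F s (ψ s)) (rho G F s z)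
        + mvfderiv 𝓘(ℝ, F) (fun t => η t (rho G F t (ψ t))) s (rho G F s z) := rfl
  rw [pairing_bracketE, pairing_rhoStar, h8, h5, h7, ← h1, h2, h4]
  rw [pairing_rhoStar] at h3
  simp only [map_zero, LinearMap.zero_apply]
  linarith

include hlag hact hq in
-- The same computation in the other slot. Here the last term of the bracket contributes
-- `L_{ρ(z)}(ξ(ρ ψ))` by the Leibniz rule, and this is the exact part of Cartan's formula.
theorem bracketE_rhoStar_left {ψ : D ⧸ G → E} (hψ : ContMDiff 𝓘(ℝ, F) 𝓘(ℝ, E) ∞ ψ)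
    {ξ : ∀ t : D ⧸ G, TangentSpace 𝓘(ℝ, F) t →L[ℝ] ℝ}
    (hξ : IsSection 𝓘(ℝ, F) (F →L[ℝ] ℝ) (Cotangent F : D ⧸ G → Type _) ξ) (s : D ⧸ G) :
    bracketE G F hb (fun t => rhoStar G F hb t (ξ t)) ψ s
      = -rhoStar G F hb s (extDerivOne F ξ s (rho G F s (ψ s))) := by
  have : CompleteSpace F := FiniteDimensional.complete ℝ F
  refine eq_of_pairing_eq hb fun z => ?_
  have hy : MDifferentiableAt 𝓘(ℝ, F) 𝓘(ℝ, E) (fun t => rhoStar G F hb t (ξ t)) s :=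
    (contMDiff_rhoStar hb hact hξ s).mdifferentiableAt (by simp)
  have hψ' := (hψ s).mdifferentiableAt (by simp : (∞ : ℕ∞ω) ≠ 0)
  have hz : MDifferentiableAt 𝓘(ℝ, F) 𝓘(ℝ, E) (fun _ : D ⧸ G => z) s :=
    mdifferentiableAt_const
  have hfun : (fun t => b (rhoStar G F hb t (ξ t)) z) = fun t => (ξ t (rho G F t z) : ℝ) :=
    funext fun t => pairing_rhoStar hb (ξ t) z
  have hfun' : (fun t => b (rhoStar G F hb t (ξ t)) (ψ t)) = fun t => (ξ t (rho G F t (ψ t)) : ℝ) :=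
    funext fun t => pairing_rhoStar hb (ξ t) (ψ t)
  have h1 := mvfderiv_pairing_rho (b := b) hy hz (ψ s)
  rw [lieSec_const, map_zero, add_zero, hfun] at h1
  have h1' := mvfderiv_pairing_rho (b := b) hy hψ' z
  rw [hfun', pairing_rhoStar] at h1'
  have h2 : lieSec G F ψ s (rhoStar G F hb s (ξ s)) = 0 :=
    (congrArg (mvfderiv 𝓘(ℝ, F) ψ s) (rho_rhoStar hb hlag (ξ s))).trans (map_zero _)
  have h3 := hq.invariant (ψ s) (rhoStar G F hb s (ξ s)) z
  rw [pairing_rhoStar] at h3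
  have h5 := extDerivOne_apply hξ (contMDiff_rho hact hψ) (contMDiff_rho_const hact z) s
  have h6 := mlieBracket_rho hact hψ' hz
  rw [lieSec_const, zero_sub, ← neg_add', map_neg, map_add] at h6
  have h7 : ξ s (mlieBracket 𝓘(ℝ, F) (fun t => rho G F t (ψ t)) (fun t => rho G F t z) s)
      = -(ξ s (rho G F s (lieSec G F ψ s z)) + ξ s (rho G F s (lieD D (ψ s) z))) := by
    rw [h6, ← map_add (ξ s)]; exact map_neg (ξ s) _
  rw [pairing_bracketE, LinearMap.map_neg₂, pairing_rhoStar, h5, h7, ← h1, h2,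
    lieD_skew D (ψ s), LinearMap.map_neg₂]
  simp only [map_zero, LinearMap.zero_apply]
  linarith

variable {σ : ∀ s : D ⧸ G, TangentSpace 𝓘(ℝ, F) s →L[ℝ] E} (hσ : IsIsotropicSplitting G F b σ)

include hlag hact hq hσ in
/-- `Ψ_σ` intertwines the twisted Dorfman bracket and the bracket of `E`. -/
theorem Psi_bracket {ψ ψ' : ∀ s, GenTangent F (D ⧸ G) s}
    (hψ : IsSection 𝓘(ℝ, F) (F × (F →L[ℝ] ℝ)) (GenTangent F (D ⧸ G)) ψ)
    (hψ' : IsSection 𝓘(ℝ, F) (F × (F →L[ℝ] ℝ)) (GenTangent F (D ⧸ G)) ψ') (s : D ⧸ G) :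
    Psi G F hb σ s ((courantSigma G F hb σ).bracket ψ ψ' s)
      = bracketE G F hb (fun t => Psi G F hb σ t (ψ t)) (fun t => Psi G F hb σ t (ψ' t)) s := by
  obtain ⟨hX, hξ⟩ := isSection_prod_iff.1 hψ
  obtain ⟨hY, hη⟩ := isSection_prod_iff.1 hψ'
  have hsX : ContMDiff 𝓘(ℝ, F) 𝓘(ℝ, E) ∞ (fun t => σ t (ψ t).1) := hσ.smooth.comp hX
  have hsY : ContMDiff 𝓘(ℝ, F) 𝓘(ℝ, E) ∞ (fun t => σ t (ψ' t).1) := hσ.smooth.comp hY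
  have hPY := contMDiff_Psi hb hact hσ hψ'
  have hd : ∀ {e : D ⧸ G → E}, ContMDiff 𝓘(ℝ, F) 𝓘(ℝ, E) ∞ e →
      MDifferentiableAt 𝓘(ℝ, F) 𝓘(ℝ, E) e s := fun h => (h s).mdifferentiableAt (by simp)
  -- Split `Ψψ` into its `σ` and `ρ*` parts. Against the `ρ*` part the second argument is left
  -- whole, since `bracketE_rhoStar_left` sees it only through its anchor; against the `σ` part it
  -- is split as well.
  have e1 : bracketE G F hb (fun t => Psi G F hb σ t (ψ t)) (fun t => Psi G F hb σ t (ψ' t)) s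
      = bracketE G F hb (fun t => σ t (ψ t).1) (fun t => Psi G F hb σ t (ψ' t)) s
        + bracketE G F hb (fun t => rhoStar G F hb t (ψ t).2)
          (fun t => Psi G F hb σ t (ψ' t)) s :=
    bracketE_add_left hb (hd hsX) (hd (contMDiff_rhoStar hb hact hξ))
  have e2 : bracketE G F hb (fun t => σ t (ψ t).1) (fun t => Psi G F hb σ t (ψ' t)) s
      = bracketE G F hb (fun t => σ t (ψ t).1) (fun t => σ t (ψ' t).1) s
        + bracketE G F hb (fun t => σ t (ψ t).1) (fun t => rhoStar G F hb t (ψ' t).2) s :=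
    bracketE_add_right hb (hd hsY) (hd (contMDiff_rhoStar hb hact hη))
  have e3 := bracketE_rhoStar_right hb hlag hact hq hsX hη s
  have e4 := bracketE_rhoStar_left hb hlag hact hq hPY hξ s
  -- The bracket of two `σ`-lifts has anchor `[X, Y]` and covector part `-H_σ(X, Y, ·)`, which is
  -- how `H_σ` is defined.
  have e5 := Psi_inverse_apply hb hlag hσ.rho_comp hσ.isotropic s
    (bracketE G F hb (fun t => σ t (ψ t).1) (fun t => σ t (ψ' t).1) s)
  rw [rho_bracketE hb hlag hact (hd hsX) (hd hsY)] at e5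
  simp only [hσ.rho_comp] at e3 e5
  rw [rho_Psi hb hlag hσ.rho_comp] at e4
  rw [e1, e2, e3, e4, ← e5, Psi_apply, Psi_apply]
  have e6 : ((courantSigma G F hb σ).bracket ψ ψ' s).2
      = lieDerivOne F (fun t => (ψ t).1) (fun t => (ψ' t).2) s
        - extDerivOne F (fun t => (ψ t).2) s (ψ' s).1
        + sigmaCov b (σ s) (bracketE G F hb (fun t => σ t (ψ t).1) (fun t => σ t (ψ' t).1) s) := by
    change lieDerivOne F (fun t => (ψ t).1) (fun t => (ψ' t).2) s
        - extDerivOne F (fun t => (ψ t).2) s (ψ' s).1 - -(sigmaCov b (σ s) _) = _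
    rw [sub_neg_eq_add]
  rw [e6, map_add, map_sub]
  change σ s (mlieBracket 𝓘(ℝ, F) (fun t => (ψ t).1) (fun t => (ψ' t).1) s) + _ = _
  dsimp only
  abel

end BracketE

/-! ### Levi-Civita connections over a point -/

section PointConnection

variable {E : Type*} [NormedAddCommGroup E] [NormedSpace ℝ E]
  {D : Type*} [TopologicalSpace D] [ChartedSpace E D] [Group D]
  {b : LinearMap.BilinForm ℝ E} {Wp : Submodule ℝ E} {D₀ : E →ₗ[ℝ] E →ₗ[ℝ] E}

theorem isSection_punit (ψ : ∀ s, Bundle.Trivial PUnit E s) :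
    IsSection 𝓘(ℝ, PUnit) E (Bundle.Trivial PUnit E) ψ := by
  intro s
  rw [contMDiffAt_section]
  have : (fun x : PUnit => (trivializationAt E (Bundle.Trivial PUnit E) s ⟨x, ψ x⟩).2)
      = fun _ => ψ PUnit.unit := by
    ext x; rfl
  rw [this]
  exact contMDiffAt_const

variable (hD₀ : IsLeviCivita E (quadraticLie D b) (fun _ => Wp) (pointConn D₀))

include hD₀

theorem pointConn_metric (x y z : E) : b (D₀ x y) z + b y (D₀ x z) = 0 := by
  have h := hD₀.metric (fun _ => x) (fun _ => y) (fun _ => z) (isSection_punit _)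
    (isSection_punit _) (isSection_punit _) PUnit.unit
  refine h.symm.trans ?_
  exact map_zero (mvfderiv 𝓘(ℝ, PUnit) (fun _ : PUnit => b y z) PUnit.unit)

/-- The Lie bracket enters with a plus sign because the Courant bracket over the point is `-[·,·]`.
-/
theorem pointConn_torsion (x y z : E) :
    b (D₀ x y - D₀ y x + lieD D x y) z + b (D₀ z x) y = 0 := by
  have h := hD₀.torsion_eq_zero (fun _ => x) (fun _ => y) (fun _ => z) (isSection_punit _)
    (isSection_punit _) (isSection_punit _) PUnit.unit
  have h2 : b (D₀ x y - D₀ y x - -lieD D x y) z + b (D₀ z x) y = 0 := h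
  rwa [sub_neg_eq_add] at h2

theorem pointConn_preserves (x : E) {y : E} (hy : y ∈ Wp) : D₀ x y ∈ Wp :=
  hD₀.preserves (fun _ => x) (fun _ => y) (isSection_punit _) (isSection_punit _)
    (fun _ => hy) PUnit.unit

end PointConnection

/-- Compose the smooth tangent map of `h` with the section `X` and take the fibre component. -/
theorem contMDiff_mvfderiv_apply {F V : Type*} [NormedAddCommGroup F] [NormedSpace ℝ F]
    [NormedAddCommGroup V] [NormedSpace ℝ V]
    {S : Type*} [TopologicalSpace S] [ChartedSpace F S] [IsManifold 𝓘(ℝ, F) ∞ S] {h : S → V}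
    (hh : ContMDiff 𝓘(ℝ, F) 𝓘(ℝ, V) ∞ h) {X : ∀ t : S, TangentSpace 𝓘(ℝ, F) t}
    (hX : IsSection 𝓘(ℝ, F) F (TangentSpace 𝓘(ℝ, F) : S → Type _) X) :
    ContMDiff 𝓘(ℝ, F) 𝓘(ℝ, V) ∞ (fun t => mvfderiv 𝓘(ℝ, F) h t (X t)) := by
  have : IsManifold 𝓘(ℝ, F) 1 S := IsManifold.of_le (n := ∞) (by simp)
  have h1 : ContMDiff 𝓘(ℝ, F).tangent 𝓘(ℝ, V).tangent ∞ (tangentMap 𝓘(ℝ, F) 𝓘(ℝ, V) h) :=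
    hh.contMDiff_tangentMap (by simp)
  exact (contMDiff_snd_tangentBundle_modelSpace V 𝓘(ℝ, V)).comp (h1.comp hX)

/-- Otherwise a linear functional vanishing on `W` would be non-zero on the derivative, although its
composite with `e` is identically zero. -/
theorem mvfderiv_mem_of_forall_mem {E : Type*} [NormedAddCommGroup E] [NormedSpace ℝ E]
    [FiniteDimensional ℝ E]
    {F : Type*} [NormedAddCommGroup F] [NormedSpace ℝ F]
    {S : Type*} [TopologicalSpace S] [ChartedSpace F S] [IsManifold 𝓘(ℝ, F) ∞ S]
    {W : Submodule ℝ E} {e : S → E} {s : S} (he : MDifferentiableAt 𝓘(ℝ, F) 𝓘(ℝ, E) e s)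
    (hW : ∀ t, e t ∈ W) (v : TangentSpace 𝓘(ℝ, F) s) : mvfderiv 𝓘(ℝ, F) e s v ∈ W := by
  by_contra hv
  obtain ⟨φ, hφ, hker⟩ := Submodule.exists_le_ker_of_notMem hv
  have h := (mvfderiv_bilin (φ.smulRight (LinearMap.id : ℝ →ₗ[ℝ] ℝ)) he
    (e₂ := fun _ => (1 : ℝ)) mdifferentiableAt_const v).2
  have h0 : (fun t => φ.smulRight (LinearMap.id : ℝ →ₗ[ℝ] ℝ) (e t) (1 : ℝ)) = fun _ => 0 := by
    funext t
    simp [LinearMap.mem_ker.1 (hker (hW t))]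
  have h1 : mvfderiv 𝓘(ℝ, F) (fun _ : S => (1 : ℝ)) s v = 0 :=
    congrArg (fun T : TangentSpace 𝓘(ℝ, F) s →L[ℝ] ℝ => T v) (mvfderiv_const (1 : ℝ))
  have h2 : mvfderiv 𝓘(ℝ, F) (fun _ : S => (0 : ℝ)) s v = 0 :=
    congrArg (fun T : TangentSpace 𝓘(ℝ, F) s →L[ℝ] ℝ => T v) (mvfderiv_const (0 : ℝ))
  rw [h0, h1, h2, map_zero, add_zero] at h
  exact hφ (by simpa using h.symm)

/-! ### `∇^σ` is a Levi-Civita connection -/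

section Connection

variable {E : Type*} [NormedAddCommGroup E] [NormedSpace ℝ E] [FiniteDimensional ℝ E]
  {D : Type*} [TopologicalSpace D] [ChartedSpace E D] [Group D] [LieGroup 𝓘(ℝ, E) ∞ D]
  {G : Subgroup D}
  {F : Type*} [NormedAddCommGroup F] [NormedSpace ℝ F] [FiniteDimensional ℝ F]
  [ChartedSpace F (D ⧸ G)]
  [IsManifold 𝓘(ℝ, F) ∞ (D ⧸ G)]
  {b : LinearMap.BilinForm ℝ E} (hb : b.Nondegenerate)
  (hlag : ∀ (s : D ⧸ G) (x : E), rho G F s x = 0 ↔ ∀ y, rho G F s y = 0 → b x y = 0)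
  (hact : ContMDiff (𝓘(ℝ, E).prod 𝓘(ℝ, F)) 𝓘(ℝ, F) ∞ (fun p : D × (D ⧸ G) => p.1 • p.2))
  {σ : ∀ s : D ⧸ G, TangentSpace 𝓘(ℝ, F) s →L[ℝ] E} (hσ : IsIsotropicSplitting G F b σ)
  {D₀ : E →ₗ[ℝ] E →ₗ[ℝ] E}

include hlag hσ in
theorem Psi_connSigma (ψ φ : ∀ s, GenTangent F (D ⧸ G) s) (s : D ⧸ G) :
    Psi G F hb σ s (connSigma G F hb σ D₀ ψ φ s)
      = connE G F D₀ (fun t => Psi G F hb σ t (ψ t)) (fun t => Psi G F hb σ t (φ t)) s :=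
  Function.invFun_eq ((Psi_bijective hb hlag hσ.rho_comp hσ.isotropic s).2 _)

include hact in
theorem contMDiff_lieSec {e₁ e₂ : D ⧸ G → E} (h₁ : ContMDiff 𝓘(ℝ, F) 𝓘(ℝ, E) ∞ e₁)
    (h₂ : ContMDiff 𝓘(ℝ, F) 𝓘(ℝ, E) ∞ e₂) :
    ContMDiff 𝓘(ℝ, F) 𝓘(ℝ, E) ∞ (fun s => lieSec G F e₂ s (e₁ s)) :=
  contMDiff_mvfderiv_apply h₂ (contMDiff_rho hact h₁)

omit [FiniteDimensional ℝ F] [LieGroup 𝓘(ℝ, E) ∞ D] in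
theorem contMDiff_bilin {e₁ e₂ : D ⧸ G → E} (h₁ : ContMDiff 𝓘(ℝ, F) 𝓘(ℝ, E) ∞ e₁)
    (h₂ : ContMDiff 𝓘(ℝ, F) 𝓘(ℝ, E) ∞ e₂) :
    ContMDiff 𝓘(ℝ, F) 𝓘(ℝ, E) ∞ (fun s => D₀ (e₁ s) (e₂ s)) :=
  ((LinearMap.toContinuousBilinearMap D₀).contMDiff.comp h₁).clm_apply h₂

include hact in
theorem contMDiff_connE {e₁ e₂ : D ⧸ G → E} (h₁ : ContMDiff 𝓘(ℝ, F) 𝓘(ℝ, E) ∞ e₁)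
    (h₂ : ContMDiff 𝓘(ℝ, F) 𝓘(ℝ, E) ∞ e₂) :
    ContMDiff 𝓘(ℝ, F) 𝓘(ℝ, E) ∞ (connE G F D₀ e₁ e₂) :=
  (contMDiff_lieSec hact h₁ h₂).add (contMDiff_bilin h₁ h₂)

include hlag hact hσ in
-- Lets the smoothness of `∇^σ` be checked on functions with values in the fixed space `𝔡`.
theorem isSection_iff_contMDiff_Psi {ψ : ∀ s, GenTangent F (D ⧸ G) s} :
    IsSection 𝓘(ℝ, F) (F × (F →L[ℝ] ℝ)) (GenTangent F (D ⧸ G)) ψ ↔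
      ContMDiff 𝓘(ℝ, F) 𝓘(ℝ, E) ∞ (fun s => Psi G F hb σ s (ψ s)) := by
  refine ⟨contMDiff_Psi hb hact hσ, fun h => ?_⟩
  have h2 := isSection_Psi_inverse hact hσ h
  convert h2 using 2 with s
  exact (Psi_bijective hb hlag hσ.rho_comp hσ.isotropic s).1
    (Psi_inverse_apply hb hlag hσ.rho_comp hσ.isotropic s _).symm

variable (hq : IsQuadratic D b) {Wp : Submodule ℝ E}
  (hD₀ : IsLeviCivita E (quadraticLie D b) (fun _ => Wp) (pointConn D₀))

include hlag hact hσ hq hD₀ in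
-- Every condition is pushed through the injective `Ψ_σ`. The Leibniz and metric rules are those of
-- `L_{ρ(ψ)}`, with `D₀` tensorial and skew. In the torsion all derivatives cancel against those in
-- `bracketE`. A function with values in `Wp` has derivatives in `Wp`.
theorem isLeviCivita_connSigma :
    IsLeviCivita (F × (F →L[ℝ] ℝ)) (courantSigma G F hb σ) (Vplus G F hb σ Wp)
      (connSigma G F hb σ D₀) := by
  have hinj := fun s => (Psi_bijective hb hlag hσ.rho_comp hσ.isotropic s).1
  have hd : ∀ {e : D ⧸ G → E}, ContMDiff 𝓘(ℝ, F) 𝓘(ℝ, E) ∞ e → ∀ {s},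
      MDifferentiableAt 𝓘(ℝ, F) 𝓘(ℝ, E) e s := fun {e} h {s} => (h s).mdifferentiableAt (by simp)
  have hP := fun {ψ : ∀ s, GenTangent F (D ⧸ G) s}
    (h : IsSection 𝓘(ℝ, F) (F × (F →L[ℝ] ℝ)) (GenTangent F (D ⧸ G)) ψ) =>
    contMDiff_Psi hb hact hσ h
  have hpair : ∀ {s} (p q : GenTangent F (D ⧸ G) s), (courantSigma G F hb σ).pairing s p q
      = b (Psi G F hb σ s p) (Psi G F hb σ s q) := fun p q =>
    (pairing_Psi hb hq.symm hlag hσ.rho_comp hσ.isotropic p q).symm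
  have hanch : ∀ {s} (p : GenTangent F (D ⧸ G) s), (courantSigma G F hb σ).anchor s p
      = rho G F s (Psi G F hb σ s p) := fun p => (rho_Psi hb hlag hσ.rho_comp p).symm
  constructor
  · constructor
    · intro ψ φ hψ hφ
      rw [isSection_iff_contMDiff_Psi hb hlag hact hσ]
      simp only [Psi_connSigma hb hlag hσ]
      exact contMDiff_connE hact (hP hψ) (hP hφ)
    · intro ψ ψ' φ hψ hψ' hφ
      funext s
      refine hinj s ?_
      rw [Pi.add_apply, map_add]
      simp only [Psi_connSigma hb hlag hσ, connE, Pi.add_apply, map_add, LinearMap.add_apply]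
      abel
    · intro ψ φ φ' hψ hφ hφ'
      funext s
      refine hinj s ?_
      rw [Pi.add_apply, map_add]
      simp only [Psi_connSigma hb hlag hσ, connE, Pi.add_apply, map_add]
      rw [lieSec_add (hd (hP hφ)) (hd (hP hφ'))]
      abel
    · intro f ψ φ hf hψ hφ
      funext s
      refine hinj s ?_
      rw [map_smul]
      simp only [Psi_connSigma hb hlag hσ, connE, map_smul, LinearMap.smul_apply, smul_add]
    · intro f ψ φ hf hψ hφ
      funext s
      refine hinj s ?_
      rw [map_add, map_smul, map_smul]
      simp only [Psi_connSigma hb hlag hσ, connE, map_smul, CourantOps.lieFun, hanch]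
      have h1 := mvfderiv_fun_smul ((hf s).mdifferentiableAt (by simp)) (hd (hP hφ) (s := s))
      have h2 := congrArg (fun T : TangentSpace 𝓘(ℝ, F) s →L[ℝ] E =>
        T (rho G F s (Psi G F hb σ s (ψ s)))) h1
      change mvfderiv 𝓘(ℝ, F) _ s (rho G F s (Psi G F hb σ s (ψ s))) + _ = _
      refine (congrArg (· + _) h2).trans ?_
      change (f s • mvfderiv 𝓘(ℝ, F) (fun t => Psi G F hb σ t (φ t)) s
          (rho G F s (Psi G F hb σ s (ψ s)))
        + mvfderiv 𝓘(ℝ, F) f s (rho G F s (Psi G F hb σ s (ψ s))) • Psi G F hb σ s (φ s)) + _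
        = f s • (mvfderiv 𝓘(ℝ, F) (fun t => Psi G F hb σ t (φ t)) s
          (rho G F s (Psi G F hb σ s (ψ s))) + _) + _
      rw [smul_add]
      abel
    · intro ψ φ φ' hψ hφ hφ' s
      simp only [hpair, CourantOps.lieFun, hanch, Psi_connSigma hb hlag hσ, connE]
      rw [mvfderiv_pairing_rho (hd (hP hφ)) (hd (hP hφ'))]
      have := pointConn_metric hD₀ (Psi G F hb σ s (ψ s)) (Psi G F hb σ s (φ s))
        (Psi G F hb σ s (φ' s))
      simp only [map_add, LinearMap.add_apply]
      linarith
  · intro ψ ψ' ψ'' hψ hψ' hψ'' s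
    have := pointConn_torsion hD₀ (Psi G F hb σ s (ψ s)) (Psi G F hb σ s (ψ' s))
        (Psi G F hb σ s (ψ'' s))
    simp only [CourantOps.torsion, hpair, map_sub, Psi_connSigma hb hlag hσ,
      Psi_bracket hb hlag hact hq hσ hψ hψ', connE, LinearMap.sub_apply, pairing_bracketE,
      map_add, LinearMap.add_apply] at this ⊢
    linarith
  · intro ψ φ hψ hφ hW s
    change Psi G F hb σ s (connSigma G F hb σ D₀ ψ φ s) ∈ Wp
    rw [Psi_connSigma hb hlag hσ]
    exact Wp.add_mem (mvfderiv_mem_of_forall_mem (hd (hP hφ)) hW _)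
      (pointConn_preserves hD₀ _ (hW s))

end Connection

/-! ### Curvature tensors on `𝔡` -/

section AlgebraicCurvature

variable {E : Type*} [NormedAddCommGroup E] [NormedSpace ℝ E] [FiniteDimensional ℝ E]
  (D : Type*) [TopologicalSpace D] [ChartedSpace E D] [Group D] [LieGroup 𝓘(ℝ, E) ∞ D]
  {b : LinearMap.BilinForm ℝ E} (hb : b.Nondegenerate) (D₀ : E →ₗ[ℝ] E →ₗ[ℝ] E)

/-- The curvature operator `[∇⁰_y, ∇⁰_z] x + ∇⁰_{[y,z]} x`. -/
def curvOp (x y z : E) : E := D₀ y (D₀ z x) - D₀ z (D₀ y x) + D₀ (lieBilin D y z) x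

/-- The vector `K⁰(x,y)` with `⟨K⁰(x,y), z⟩ = ⟨∇⁰_z x, y⟩`. -/
def kVec (x y : E) : E := (b.toDual hb).symm ((b.flip y).comp (D₀.flip x))

theorem pairing_kVec (x y z : E) : b (kVec hb D₀ x y) z = b (D₀ z x) y := by
  rw [kVec, LinearMap.BilinForm.apply_toDual_symm_apply]
  rfl

/-- The generalized Riemann tensor of a Courant algebroid connection over a point. -/
def riemannPoint (f x y z : E) : ℝ :=
  (b f (curvOp D D₀ x y z) + b z (curvOp D D₀ y x f) + b (kVec hb D₀ y z) (kVec hb D₀ x f)) / 2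

theorem kVec_add_left (x x' y : E) : kVec hb D₀ (x + x') y = kVec hb D₀ x y + kVec hb D₀ x' y :=
  eq_of_pairing_eq hb fun z => by simp [pairing_kVec]

theorem kVec_add_right (x y y' : E) : kVec hb D₀ x (y + y') = kVec hb D₀ x y + kVec hb D₀ x y' :=
  eq_of_pairing_eq hb fun z => by simp [pairing_kVec]

theorem kVec_smul_left (c : ℝ) (x y : E) : kVec hb D₀ (c • x) y = c • kVec hb D₀ x y :=
  eq_of_pairing_eq hb fun z => by simp [pairing_kVec]

theorem kVec_smul_right (c : ℝ) (x y : E) : kVec hb D₀ x (c • y) = c • kVec hb D₀ x y :=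
  eq_of_pairing_eq hb fun z => by simp [pairing_kVec]

/-- The generalized Riemann tensor as a bilinear form in its first and third arguments. -/
def riemannBilin (x z : E) : LinearMap.BilinForm ℝ E :=
  LinearMap.mk₂ ℝ (fun f y => riemannPoint D hb D₀ f x y z)
    (fun f f' y => by
      simp only [riemannPoint, curvOp, map_add, LinearMap.add_apply, kVec_add_right, map_sub]; ring)
    (fun c f y => by
      simp only [riemannPoint, curvOp, map_add, map_sub, map_smul, LinearMap.smul_apply,
        kVec_smul_right, smul_eq_mul]; ring)
    (fun f y y' => by
      simp only [riemannPoint, curvOp, map_add, LinearMap.add_apply, kVec_add_left, map_sub]; ring)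
    (fun c f y => by
      simp only [riemannPoint, curvOp, map_add, map_sub, map_smul, LinearMap.smul_apply,
        kVec_smul_left, smul_eq_mul]; ring)

theorem riemannPoint_add_left (f x x' y z : E) : riemannPoint D hb D₀ f (x + x') y z
    = riemannPoint D hb D₀ f x y z + riemannPoint D hb D₀ f x' y z := by
  simp only [riemannPoint, curvOp, map_add, LinearMap.add_apply, kVec_add_left, map_sub]; ring

theorem riemannPoint_smul_left (c : ℝ) (f x y z : E) : riemannPoint D hb D₀ f (c • x) y z
    = c • riemannPoint D hb D₀ f x y z := by
  simp only [riemannPoint, curvOp, map_add, map_sub, map_smul, LinearMap.smul_apply,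
    kVec_smul_left, smul_eq_mul]; ring

theorem riemannPoint_add_right (f x y z z' : E) : riemannPoint D hb D₀ f x y (z + z')
    = riemannPoint D hb D₀ f x y z + riemannPoint D hb D₀ f x y z' := by
  simp only [riemannPoint, curvOp, map_add, LinearMap.add_apply, kVec_add_right, map_sub]; ring

theorem riemannPoint_smul_right (c : ℝ) (f x y z : E) : riemannPoint D hb D₀ f x y (c • z)
    = c • riemannPoint D hb D₀ f x y z := by
  simp only [riemannPoint, curvOp, map_add, map_sub, map_smul, LinearMap.smul_apply,
    kVec_smul_right, smul_eq_mul]; ring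

/-- The generalized Ricci tensor of a Courant algebroid connection over a point. -/
def ricciPoint : LinearMap.BilinForm ℝ E :=
  LinearMap.mk₂ ℝ (fun x z => ∑ i, riemannPoint D hb D₀
      (b.dualBasis hb (Module.finBasis ℝ E) i) x (Module.finBasis ℝ E i) z)
    (fun x x' z => by simp only [riemannPoint_add_left, Finset.sum_add_distrib])
    (fun c x z => by simp only [riemannPoint_smul_left, Finset.smul_sum])
    (fun x z z' => by simp only [riemannPoint_add_right, Finset.sum_add_distrib])
    (fun c x z => by simp only [riemannPoint_smul_right, Finset.smul_sum])

/-- Over a point there are no derivatives, and nondegeneracy of `b` supplies the vector that defines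
`K`, so its default value never occurs. -/
theorem riemann_pointConn (f x y z : ∀ s, Bundle.Trivial PUnit E s) (s : PUnit) :
    (quadraticLie D b).riemann E (pointConn D₀) f x y z s
      = riemannPoint D hb D₀ (f s) (x s) (y s) (z s) := by
  have hK : ∀ x y : ∀ s, Bundle.Trivial PUnit E s,
      (quadraticLie D b).K E (pointConn D₀) x y s = kVec hb D₀ (x s) (y s) := by
    intro x y
    have h : ∃ k : Bundle.Trivial PUnit E s,
        ∀ φ : ∀ s, Bundle.Trivial PUnit E s, IsSection 𝓘(ℝ, PUnit) E (Bundle.Trivial PUnit E) φ →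
        (quadraticLie D b).pairing s k (φ s)
          = (quadraticLie D b).pairing s (pointConn D₀ φ x s) (y s) :=
      ⟨kVec hb D₀ (x s) (y s), fun φ _ => pairing_kVec hb D₀ _ _ _⟩
    rw [CourantOps.K, dif_pos h]
    refine eq_of_pairing_eq hb fun z => ?_
    rw [pairing_kVec]
    exact h.choose_spec (fun _ => z) (isSection_punit _)
  have hR : ∀ f x y z : ∀ s, Bundle.Trivial PUnit E s,
      (quadraticLie D b).curvatureZero (pointConn D₀) f x y z s
        = b (f s) (curvOp D D₀ (x s) (y s) (z s)) := by
    intro f x y z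
    change b (f s) (D₀ (y s) (D₀ (z s) (x s)) - D₀ (z s) (D₀ (y s) (x s))
      - D₀ (-lieBilin D (y s) (z s)) (x s)) = _
    rw [map_neg, LinearMap.neg_apply, sub_neg_eq_add]
    rfl
  rw [CourantOps.riemann, hR, hR, hK, hK]
  rfl

end AlgebraicCurvature

/-! ### The generalized Riemann tensor of `∇^σ` -/

section Curvature

variable {E : Type*} [NormedAddCommGroup E] [NormedSpace ℝ E] [FiniteDimensional ℝ E]
  {D : Type*} [TopologicalSpace D] [ChartedSpace E D] [Group D] [LieGroup 𝓘(ℝ, E) ∞ D]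
  {G : Subgroup D}
  {F : Type*} [NormedAddCommGroup F] [NormedSpace ℝ F] [FiniteDimensional ℝ F]
  [ChartedSpace F (D ⧸ G)]
  [IsManifold 𝓘(ℝ, F) ∞ (D ⧸ G)]
  {b : LinearMap.BilinForm ℝ E} (hb : b.Nondegenerate)
  (hlag : ∀ (s : D ⧸ G) (x : E), rho G F s x = 0 ↔ ∀ y, rho G F s y = 0 → b x y = 0)
  (hact : ContMDiff (𝓘(ℝ, E).prod 𝓘(ℝ, F)) 𝓘(ℝ, F) ∞ (fun p : D × (D ⧸ G) => p.1 • p.2))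
  {D₀ : E →ₗ[ℝ] E →ₗ[ℝ] E}

/-- The vector `τ` with `⟨τ, z⟩ = ⟨L_{ρ(z)} e₁, e₂⟩`. -/
def tauVec (F : Type*) [NormedAddCommGroup F] [NormedSpace ℝ F] [ChartedSpace F (D ⧸ G)]
    (e₁ e₂ : D ⧸ G → E) (s : D ⧸ G) : E :=
  (b.toDual hb).symm ((b.flip (e₂ s)).comp (lieSec G F e₁ s : E →ₗ[ℝ] E))

theorem pairing_tauVec (e₁ e₂ : D ⧸ G → E) (s : D ⧸ G) (z : E) :
    b (tauVec hb F e₁ e₂ s) z = b (lieSec G F e₁ s z) (e₂ s) := by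
  rw [tauVec, LinearMap.BilinForm.apply_toDual_symm_apply]
  rfl

include hlag in
-- The vector `τ` is in the image of `ρ*`, so `ρ τ = 0` and every derivative along it vanishes.
theorem pairing_tauVec_tauVec (e₁ e₂ e₃ e₄ : D ⧸ G → E) (s : D ⧸ G) :
    b (tauVec hb F e₁ e₂ s) (tauVec hb F e₃ e₄ s) = 0 := by
  let ξ : TangentSpace 𝓘(ℝ, F) s →L[ℝ] ℝ :=
    (LinearMap.toContinuousLinearMap (b.flip (e₄ s)) : E →L[ℝ] ℝ).comp (mvfderiv 𝓘(ℝ, F) e₃ s)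
  have h : rho G F s (tauVec hb F e₃ e₄ s) = 0 := rho_rhoStar hb hlag ξ
  rw [pairing_tauVec]
  have h2 : lieSec G F e₁ s (tauVec hb F e₃ e₄ s) = 0 :=
    (congrArg (mvfderiv 𝓘(ℝ, F) e₁ s) h).trans (map_zero _)
  rw [h2, map_zero, LinearMap.zero_apply]

include hlag hact in
/-- The curvature operator of `∇^E`. -/
theorem connE_curvature {e₁ e₂ e₃ : D ⧸ G → E}
    (h₁ : ContMDiff 𝓘(ℝ, F) 𝓘(ℝ, E) ∞ e₁) (h₂ : ContMDiff 𝓘(ℝ, F) 𝓘(ℝ, E) ∞ e₂)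
    (h₃ : ContMDiff 𝓘(ℝ, F) 𝓘(ℝ, E) ∞ e₃) (s : D ⧸ G) :
    connE G F D₀ e₁ (connE G F D₀ e₂ e₃) s - connE G F D₀ e₂ (connE G F D₀ e₁ e₃) s
        - connE G F D₀ (bracketE G F hb e₁ e₂) e₃ s
      = curvOp D D₀ (e₃ s) (e₁ s) (e₂ s) - D₀ (tauVec hb F e₁ e₂ s) (e₃ s) := by
  have : CompleteSpace F := FiniteDimensional.complete ℝ F
  have hd : ∀ {e : D ⧸ G → E}, ContMDiff 𝓘(ℝ, F) 𝓘(ℝ, E) ∞ e →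
      MDifferentiableAt 𝓘(ℝ, F) 𝓘(ℝ, E) e s := fun h => (h s).mdifferentiableAt (by simp)
  have key : ∀ {e₁ e₂ : D ⧸ G → E}, ContMDiff 𝓘(ℝ, F) 𝓘(ℝ, E) ∞ e₁ →
      ContMDiff 𝓘(ℝ, F) 𝓘(ℝ, E) ∞ e₂ →
      connE G F D₀ e₁ (connE G F D₀ e₂ e₃) s
        = lieSec G F (fun t => lieSec G F e₃ t (e₂ t)) s (e₁ s)
          + (D₀ (lieSec G F e₂ s (e₁ s)) (e₃ s) + D₀ (e₂ s) (lieSec G F e₃ s (e₁ s)))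
          + (D₀ (e₁ s) (lieSec G F e₃ s (e₂ s)) + D₀ (e₁ s) (D₀ (e₂ s) (e₃ s))) := by
    intro e₁ e₂ h₁ h₂
    have a1 : lieSec G F (connE G F D₀ e₂ e₃) s (e₁ s)
        = lieSec G F (fun t => lieSec G F e₃ t (e₂ t)) s (e₁ s)
          + lieSec G F (fun t => D₀ (e₂ t) (e₃ t)) s (e₁ s) :=
      lieSec_add (hd (contMDiff_lieSec hact h₂ h₃)) (hd (contMDiff_bilin h₂ h₃)) _
    have a2 : lieSec G F (fun t => D₀ (e₂ t) (e₃ t)) s (e₁ s)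
        = D₀ (lieSec G F e₂ s (e₁ s)) (e₃ s) + D₀ (e₂ s) (lieSec G F e₃ s (e₁ s)) :=
      (mvfderiv_bilin D₀ (hd h₂) (hd h₃) _).2
    rw [connE, a1, a2, connE, map_add]
  -- The anchor sends the bracket to the commutator of vector fields, so the iterated derivatives of
  -- `e₃` cancel. Of the remaining bracket terms, which enter through `D₀`, only `-[e₁, e₂]` and `τ`
  -- survive.
  have hbr : lieSec G F e₃ s (bracketE G F hb e₁ e₂ s)
      = lieSec G F (fun t => lieSec G F e₃ t (e₂ t)) s (e₁ s)
        - lieSec G F (fun t => lieSec G F e₃ t (e₁ t)) s (e₂ s) := by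
    have a1 := mvfderiv_mlieBracket h₃ (contMDiff_rho hact h₁) (contMDiff_rho hact h₂) s
      (hd (contMDiff_lieSec hact h₁ h₃)) (hd (contMDiff_lieSec hact h₂ h₃))
    rw [← rho_bracketE hb hlag hact (hd h₁) (hd h₂)] at a1
    exact a1
  have hb2 : bracketE G F hb e₁ e₂ s = lieSec G F e₂ s (e₁ s) - lieSec G F e₁ s (e₂ s)
      - lieBilin D (e₁ s) (e₂ s) + tauVec hb F e₁ e₂ s := rfl
  have hc : connE G F D₀ (bracketE G F hb e₁ e₂) e₃ s
      = lieSec G F e₃ s (bracketE G F hb e₁ e₂ s) + D₀ (bracketE G F hb e₁ e₂ s) (e₃ s) := rfl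
  rw [key h₁ h₂, key h₂ h₁, hc, hbr, hb2, curvOp]
  simp only [map_add, map_sub, LinearMap.add_apply, LinearMap.sub_apply]
  abel

variable {σ : ∀ s : D ⧸ G, TangentSpace 𝓘(ℝ, F) s →L[ℝ] E} (hσ : IsIsotropicSplitting G F b σ)
  (hq : IsQuadratic D b)

include hlag hact hσ hq in
-- The point of the symmetrized definition: each `R^{(0)}` is off by a term `∇⁰_τ`, and these two
-- terms are exactly the cross terms of `⟨K⁰ + τ, K⁰ + τ⟩`. No compatibility of `D₀` with `b` is
-- involved.
theorem riemann_connSigma {f x y z : ∀ s, GenTangent F (D ⧸ G) s}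
    (hf : IsSection 𝓘(ℝ, F) (F × (F →L[ℝ] ℝ)) (GenTangent F (D ⧸ G)) f)
    (hx : IsSection 𝓘(ℝ, F) (F × (F →L[ℝ] ℝ)) (GenTangent F (D ⧸ G)) x)
    (hy : IsSection 𝓘(ℝ, F) (F × (F →L[ℝ] ℝ)) (GenTangent F (D ⧸ G)) y)
    (hz : IsSection 𝓘(ℝ, F) (F × (F →L[ℝ] ℝ)) (GenTangent F (D ⧸ G)) z) (s : D ⧸ G) :
    (courantSigma G F hb σ).riemann (F × (F →L[ℝ] ℝ)) (connSigma G F hb σ D₀) f x y z s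
      = riemannPoint D hb D₀ (Psi G F hb σ s (f s)) (Psi G F hb σ s (x s))
        (Psi G F hb σ s (y s)) (Psi G F hb σ s (z s)) := by
  have hP := fun {ψ : ∀ s, GenTangent F (D ⧸ G) s}
    (h : IsSection 𝓘(ℝ, F) (F × (F →L[ℝ] ℝ)) (GenTangent F (D ⧸ G)) ψ) =>
    contMDiff_Psi hb hact hσ h
  have hpair : ∀ {s} (p q : GenTangent F (D ⧸ G) s), (courantSigma G F hb σ).pairing s p q
      = b (Psi G F hb σ s p) (Psi G F hb σ s q) := fun p q =>
    (pairing_Psi hb hq.symm hlag hσ.rho_comp hσ.isotropic p q).symm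
  have hinv := fun s => Psi_inverse_apply hb hlag hσ.rho_comp hσ.isotropic s
  have hK : ∀ x y : ∀ s, GenTangent F (D ⧸ G) s,
      Psi G F hb σ s ((courantSigma G F hb σ).K (F × (F →L[ℝ] ℝ)) (connSigma G F hb σ D₀) x y s)
        = kVec hb D₀ (Psi G F hb σ s (x s)) (Psi G F hb σ s (y s))
          + tauVec hb F (fun t => Psi G F hb σ t (x t)) (fun t => Psi G F hb σ t (y t)) s := by
    intro x y
    have h : ∃ k : GenTangent F (D ⧸ G) s, ∀ φ : ∀ s, GenTangent F (D ⧸ G) s,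
        IsSection 𝓘(ℝ, F) (F × (F →L[ℝ] ℝ)) (GenTangent F (D ⧸ G)) φ →
        (courantSigma G F hb σ).pairing s k (φ s)
          = (courantSigma G F hb σ).pairing s (connSigma G F hb σ D₀ φ x s) (y s) := by
      refine ⟨(rho G F s (kVec hb D₀ (Psi G F hb σ s (x s)) (Psi G F hb σ s (y s))
          + tauVec hb F (fun t => Psi G F hb σ t (x t)) (fun t => Psi G F hb σ t (y t)) s),
        sigmaCov b (σ s) (kVec hb D₀ (Psi G F hb σ s (x s)) (Psi G F hb σ s (y s))
          + tauVec hb F (fun t => Psi G F hb σ t (x t)) (fun t => Psi G F hb σ t (y t)) s)),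
        fun φ _ => ?_⟩
      rw [hpair, hpair, hinv, Psi_connSigma hb hlag hσ, LinearMap.map_add₂, pairing_kVec,
        pairing_tauVec, connE, LinearMap.map_add₂, add_comm]
    rw [CourantOps.K, dif_pos h]
    -- The images of constants under the inverse of `Ψ_σ` are smooth sections and span each fibre,
    -- so they determine `K`.
    refine eq_of_pairing_eq hb fun w => ?_
    have h2 := h.choose_spec (fun t => (rho G F t w, sigmaCov b (σ t) w))
      (isSection_Psi_inverse hact hσ contMDiff_const)
    rw [hpair, hpair, hinv, Psi_connSigma hb hlag hσ, connE] at h2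
    simp only [hinv] at h2
    rw [h2, LinearMap.map_add₂, LinearMap.map_add₂, pairing_kVec, pairing_tauVec, add_comm]
  have hR : ∀ {f x y z : ∀ s, GenTangent F (D ⧸ G) s},
      IsSection 𝓘(ℝ, F) (F × (F →L[ℝ] ℝ)) (GenTangent F (D ⧸ G)) x →
      IsSection 𝓘(ℝ, F) (F × (F →L[ℝ] ℝ)) (GenTangent F (D ⧸ G)) y →
      IsSection 𝓘(ℝ, F) (F × (F →L[ℝ] ℝ)) (GenTangent F (D ⧸ G)) z →
      (courantSigma G F hb σ).curvatureZero (connSigma G F hb σ D₀) f x y z s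
        = b (Psi G F hb σ s (f s)) (curvOp D D₀ (Psi G F hb σ s (x s)) (Psi G F hb σ s (y s))
          (Psi G F hb σ s (z s)) - D₀ (tauVec hb F (fun t => Psi G F hb σ t (y t))
            (fun t => Psi G F hb σ t (z t)) s) (Psi G F hb σ s (x s))) := by
    intro f x y z hx hy hz
    rw [CourantOps.curvatureZero, hpair, map_sub (Psi G F hb σ s), map_sub (Psi G F hb σ s)]
    rw [← connE_curvature hb hlag hact (hP hy) (hP hz) (hP hx)]
    simp only [Psi_connSigma hb hlag hσ]
    have hbr : (fun t => Psi G F hb σ t ((courantSigma G F hb σ).bracket y z t))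
        = bracketE G F hb (fun t => Psi G F hb σ t (y t)) (fun t => Psi G F hb σ t (z t)) :=
      funext fun t => Psi_bracket hb hlag hact hq hσ hy hz t
    rw [hbr]
  rw [CourantOps.riemann, hR hx hy hz, hR hy hx hf, hpair, hK, hK, riemannPoint]
  simp only [map_add, map_sub, LinearMap.add_apply, pairing_tauVec_tauVec hb hlag]
  have h1 := pairing_kVec hb D₀ (Psi G F hb σ s (y s)) (Psi G F hb σ s (z s))
    (tauVec hb F (fun t => Psi G F hb σ t (x t)) (fun t => Psi G F hb σ t (f t)) s)
  have h2 := pairing_kVec hb D₀ (Psi G F hb σ s (x s)) (Psi G F hb σ s (f s))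
    (tauVec hb F (fun t => Psi G F hb σ t (y t)) (fun t => Psi G F hb σ t (z t)) s)
  rw [hq.symm] at h2
  rw [h1, h2, hq.symm (Psi G F hb σ s (f s)) (D₀ _ _), hq.symm (Psi G F hb σ s (z s)) (D₀ _ _)]
  ring

end Curvature

/-! ### Traces in dual bases -/

section BilinearTrace

variable {E : Type*} [NormedAddCommGroup E] [NormedSpace ℝ E] [FiniteDimensional ℝ E]

open Classical in
/-- The trace of a bilinear form `T` with respect to a bilinear form `g`. -/
def bilinTrace (g T : LinearMap.BilinForm ℝ E) : ℝ :=
  if h : g.Nondegenerate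
  then ∑ i, T (g.dualBasis h (Module.finBasis ℝ E) i) (Module.finBasis ℝ E i) else 0

variable {ι : Type*} [Fintype ι] [DecidableEq ι] {g : LinearMap.BilinForm ℝ E} {f e : ι → E}

omit [FiniteDimensional ℝ E] in
theorem pairing_dual_sum (hfe : ∀ μ ν, g (f μ) (e ν) = if μ = ν then 1 else 0) (c : ι → ℝ) (μ : ι) :
    g (f μ) (∑ ν, c ν • e ν) = c μ ∧ g (∑ ν, c ν • f ν) (e μ) = c μ := by
  constructor
  · simp [map_sum, hfe]
  · simp [map_sum, LinearMap.sum_apply, hfe]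

variable (hcard : Fintype.card ι = Module.finrank ℝ E)
  (hfe : ∀ μ ν, g (f μ) (e ν) = if μ = ν then 1 else 0)

include hcard hfe

/-- Duality makes both families linearly independent, and the cardinality makes them bases. No
symmetry of `g` is assumed, so left and right coefficients are kept apart. -/
theorem exists_expansion_dual (v : E) :
    v = ∑ μ, g (f μ) v • e μ ∧ v = ∑ μ, g v (e μ) • f μ := by
  have he : LinearIndependent ℝ e := by
    rw [Fintype.linearIndependent_iff]
    intro c hc μ
    rw [← (pairing_dual_sum hfe c μ).1, hc, map_zero]
  have hf : LinearIndependent ℝ f := by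
    rw [Fintype.linearIndependent_iff]
    intro c hc μ
    rw [← (pairing_dual_sum hfe c μ).2, hc, map_zero, LinearMap.zero_apply]
  constructor
  · have h := (basisOfLinearIndependentOfCardEqFinrank' e he hcard).sum_repr v
    simp only [coe_basisOfLinearIndependentOfCardEqFinrank'] at h
    conv_lhs => rw [← h]
    refine Finset.sum_congr rfl fun μ _ => ?_
    conv_rhs => rw [← h, (pairing_dual_sum hfe _ μ).1]
  · have h := (basisOfLinearIndependentOfCardEqFinrank' f hf hcard).sum_repr v
    simp only [coe_basisOfLinearIndependentOfCardEqFinrank'] at h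
    conv_lhs => rw [← h]
    refine Finset.sum_congr rfl fun μ _ => ?_
    conv_rhs => rw [← h, (pairing_dual_sum hfe _ μ).2]

theorem nondegenerate_of_dual : g.Nondegenerate := by
  constructor
  · intro v hv
    rw [(exists_expansion_dual hcard hfe v).2]
    simp [hv]
  · intro v hv
    rw [(exists_expansion_dual hcard hfe v).1]
    simp [hv]

/-- The trace can be computed in any pair of dual bases. -/
theorem bilinTrace_eq_sum (T : LinearMap.BilinForm ℝ E) : bilinTrace g T = ∑ μ, T (f μ) (e μ) := by
  have hg := nondegenerate_of_dual hcard hfe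
  rw [bilinTrace, dif_pos hg]
  set B := Module.finBasis ℝ E
  -- Expand `B i` in the family `e` on one side and `f μ` in the dual basis of `B` on the other:
  -- both sums become the same double sum.
  have h1 : ∀ i, T (g.dualBasis hg B i) (B i)
      = ∑ μ, g (f μ) (B i) * T (g.dualBasis hg B i) (e μ) := by
    intro i
    conv_lhs => rw [(exists_expansion_dual hcard hfe (B i)).1]
    simp [map_sum]
  have h2 : ∀ μ, T (f μ) (e μ) = ∑ i, g (f μ) (B i) * T (g.dualBasis hg B i) (e μ) := by
    intro μ
    conv_lhs => rw [← (g.dualBasis hg B).sum_repr (f μ)]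
    simp [map_sum, LinearMap.sum_apply, LinearMap.BilinForm.dualBasis_repr_apply]
  rw [Finset.sum_congr rfl fun i _ => h1 i, Finset.sum_congr rfl fun μ _ => h2 μ,
    Finset.sum_comm]

end BilinearTrace

/-! ### Transport of curvature traces along an isometric trivialization -/

section Trivialization

variable {E₀ : Type*} [NormedAddCommGroup E₀] [NormedSpace ℝ E₀]
  {H : Type*} [TopologicalSpace H] {I : ModelWithCorners ℝ E₀ H}
  {M : Type*} [TopologicalSpace M] [ChartedSpace H M]
  (F : Type*) [NormedAddCommGroup F] [NormedSpace ℝ F]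
  {V : M → Type*} [∀ x, AddCommGroup (V x)] [∀ x, Module ℝ (V x)]
  [TopologicalSpace (TotalSpace F V)] [∀ x, TopologicalSpace (V x)] [FiberBundle F V]
  {E : Type*} [NormedAddCommGroup E] [NormedSpace ℝ E] [FiniteDimensional ℝ E]

/-- A fibrewise isometry onto a trivial bundle, for which constant sections are smooth. -/
structure IsTrivialization (C : CourantOps I V) (b : LinearMap.BilinForm ℝ E)
    (Φ : ∀ x, V x →ₗ[ℝ] E) (Θ : ∀ x, E → V x) : Prop where
  bijective : ∀ x, Function.Bijective (Φ x)
  apply_inv : ∀ x e, Φ x (Θ x e) = e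
  pairing : ∀ x p q, C.pairing x p q = b (Φ x p) (Φ x q)
  smooth_const : ∀ e, IsSection I F V (fun x => Θ x e)
  finrank_eq : Module.finrank ℝ F = Module.finrank ℝ E

variable {F} {C : CourantOps I V} {b : LinearMap.BilinForm ℝ E} {Φ : ∀ x, V x →ₗ[ℝ] E}
  {Θ : ∀ x, E → V x} (hΦ : IsTrivialization F C b Φ Θ)

include hΦ

/-- Only the value of a dual frame at `x` enters the trace, and there it gives dual families in `E`.
-/
theorem frameTrace_eq_bilinTrace {g : ∀ y, LinearMap.BilinForm ℝ (V y)}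
    {g₀ T₀ : LinearMap.BilinForm ℝ E} (hg : ∀ y p q, g y p q = g₀ (Φ y p) (Φ y q)) {x : M}
    {T : (∀ y, V y) → (∀ y, V y) → M → ℝ}
    (hT : ∀ f e, IsSection I F V f → IsSection I F V e → T f e x = T₀ (Φ x (f x)) (Φ x (e x))) :
    frameTrace I F g T x = bilinTrace g₀ T₀ := by
  have hcard : Fintype.card (Fin (Module.finrank ℝ F)) = Module.finrank ℝ E := by
    rw [Fintype.card_fin, hΦ.finrank_eq]
  by_cases h : ∃ p : (Fin (Module.finrank ℝ F) → ∀ y, V y) × (Fin (Module.finrank ℝ F) → ∀ y, V y),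
      IsDualFrameAt I F g x p.1 p.2
  · rw [frameTrace, dif_pos h]
    have hs := h.choose_spec
    have hd : ∀ μ ν, g₀ (Φ x (h.choose.1 μ x)) (Φ x (h.choose.2 ν x)) = if μ = ν then 1 else 0 := by
      intro μ ν
      rw [← hg]
      exact hs.dual.self_of_nhds μ ν
    rw [bilinTrace_eq_sum hcard hd]
    exact Finset.sum_congr rfl fun μ _ => hT _ _ (hs.smooth_left μ) (hs.smooth_right μ)
  -- The two default values `0` match: if `g₀` were nondegenerate, a basis of `E` and its dual would
  -- give constant sections forming a global dual frame.
  · rw [frameTrace, dif_neg h, bilinTrace, dif_neg]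
    intro hnd
    let B := (Module.finBasis ℝ E).reindex (finCongr hΦ.finrank_eq.symm)
    refine h ⟨(fun μ y => Θ y (g₀.dualBasis hnd B μ), fun μ y => Θ y (B μ)),
      fun μ => hΦ.smooth_const _, fun μ => hΦ.smooth_const _,
      Filter.Eventually.of_forall fun y μ ν => ?_⟩
    rw [hg, hΦ.apply_inv, hΦ.apply_inv, LinearMap.BilinForm.apply_dualBasis_left]
    simp only [eq_comm]


variable {Vp : ∀ x, Submodule ℝ (V x)} {Wp : Submodule ℝ E} (hV : ∀ x p, p ∈ Vp x ↔ Φ x p ∈ Wp)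

include hV

theorem mem_perp_iff {x : M} (p : V x) : p ∈ C.perp Vp x ↔ Φ x p ∈ b.orthogonal Wp := by
  constructor
  · intro h w hw
    obtain ⟨q, rfl⟩ := (hΦ.bijective x).2 w
    exact (hΦ.pairing x q p).symm.trans (h q ((hV x q).2 hw))
  · intro h q hq
    exact (hΦ.pairing x q p).trans (h _ ((hV x q).1 hq))

theorem isCompl_perp_iff (x : M) : IsCompl (Vp x) (C.perp Vp x) ↔ IsCompl Wp (b.orthogonal Wp) := by
  have h1 : Vp x = Wp.comap (Φ x) := Submodule.ext (hV x)
  have h2 : C.perp Vp x = (b.orthogonal Wp).comap (Φ x) := Submodule.ext (mem_perp_iff hΦ hV)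
  rw [h1, h2]
  exact ((Submodule.orderIsoMapComapOfBijective (Φ x) (hΦ.bijective x)).symm.isCompl_iff).symm

open Classical in
/-- The projection onto `W₊` along its orthogonal. -/
def projPoint (b : LinearMap.BilinForm ℝ E) (Wp : Submodule ℝ E) : E →ₗ[ℝ] E :=
  if h : IsCompl Wp (b.orthogonal Wp) then Wp.projection (b.orthogonal Wp) h else 0

/-- The generalized metric `G` on `𝔡`. -/
def genMetricPoint (b : LinearMap.BilinForm ℝ E) (Wp : Submodule ℝ E) : LinearMap.BilinForm ℝ E :=
  b.comp (projPoint b Wp) (projPoint b Wp)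
    - b.comp (LinearMap.id - projPoint b Wp) (LinearMap.id - projPoint b Wp)

/-- A projection is determined by its value lying in `Wp` and the remainder in the complement, and
`Φ` transports both conditions. Complementarity itself is transported too, so the default cases
occur together. -/
theorem apply_projPlus {x : M} (p : V x) :
    Φ x (C.projPlus Vp x p) = projPoint b Wp (Φ x p) := by
  by_cases h : IsCompl Wp (b.orthogonal Wp)
  · have h' := (isCompl_perp_iff hΦ hV x).2 h
    rw [CourantOps.projPlus, projPoint, dif_pos h, dif_pos h']
    have h1 : Φ x ((Vp x).projection _ h' p) ∈ Wp :=
      (hV x _).1 (Submodule.projection_apply_mem h' p)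
    have h2 : Φ x (p - (Vp x).projection _ h' p) ∈ b.orthogonal Wp := by
      rw [← mem_perp_iff hΦ hV, ← Submodule.projection_apply_eq_zero_iff h', map_sub,
        Submodule.projection_apply_of_mem_left h' (Submodule.projection_apply_mem h' p), sub_self]
    have h3 := Submodule.projection_apply_of_mem_right h h2
    rw [map_sub, map_sub, Submodule.projection_apply_of_mem_left h h1, sub_eq_zero] at h3
    exact h3.symm
  · have h' := fun h' => h ((isCompl_perp_iff hΦ hV x).1 h')
    rw [CourantOps.projPlus, projPoint, dif_neg h, dif_neg h', LinearMap.zero_apply,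
      LinearMap.zero_apply, map_zero]

theorem genMetric_apply {x : M} (p q : V x) :
    C.genMetric Vp x p q = genMetricPoint b Wp (Φ x p) (Φ x q) := by
  have h := fun p : V x => apply_projPlus hΦ hV p
  change C.pairing x (C.projPlus Vp x p) (C.projPlus Vp x q)
      - C.pairing x (p - C.projPlus Vp x p) (q - C.projPlus Vp x q)
    = b (projPoint b Wp (Φ x p)) (projPoint b Wp (Φ x q))
      - b (Φ x p - projPoint b Wp (Φ x p)) (Φ x q - projPoint b Wp (Φ x q))
  rw [hΦ.pairing, hΦ.pairing, map_sub (Φ x), map_sub (Φ x), h, h]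

omit hV

variable {D : Type*} [TopologicalSpace D] [ChartedSpace E D] [Group D] [LieGroup 𝓘(ℝ, E) ∞ D]
  (hb : b.Nondegenerate) {D₀ : E →ₗ[ℝ] E →ₗ[ℝ] E}
  {conn : (∀ x, V x) → (∀ x, V x) → ∀ x, V x}
  (hR : ∀ f x y z, IsSection I F V f → IsSection I F V x → IsSection I F V y →
    IsSection I F V z → ∀ s, C.riemann F conn f x y z s
      = riemannPoint D hb D₀ (Φ s (f s)) (Φ s (x s)) (Φ s (y s)) (Φ s (z s)))

include hR

/-- Although Ricci is defined on sections, its value is a fixed bilinear form of their values in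
`E`; this is what makes the scalar curvature constant. -/
theorem ricci_eq_ricciPoint {x z : ∀ s, V s} (hx : IsSection I F V x) (hz : IsSection I F V z)
    (s : M) : C.ricci F conn x z s = ricciPoint D hb D₀ (Φ s (x s)) (Φ s (z s)) := by
  have h := frameTrace_eq_bilinTrace hΦ (g := C.pairing) (g₀ := b) (x := s)
    (T := fun f e => C.riemann F conn f x e z)
    (T₀ := riemannBilin D hb D₀ (Φ s (x s)) (Φ s (z s))) hΦ.pairing
    (fun f e hf he => hR f x e z hf hx he hz s)
  refine h.trans ?_
  rw [bilinTrace, dif_pos hb]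
  rfl

include hV

theorem scalarPlus_eq_bilinTrace (s : M) :
    C.scalarPlus F Vp conn s = bilinTrace (genMetricPoint b Wp) (ricciPoint D hb D₀) :=
  frameTrace_eq_bilinTrace hΦ (fun _ => genMetric_apply hΦ hV)
    (fun _ _ hf he => ricci_eq_ricciPoint hΦ hb hR hf he s)

/-- Every pair of vectors is attained by the smooth sections `Θ · x`, `Θ · y` at any chosen point of
the base. -/
theorem ricciMixedVanishes_iff [Nonempty M] :
    C.RicciMixedVanishes F Vp conn ↔
      ∀ x ∈ Wp, ∀ y ∈ b.orthogonal Wp, ricciPoint D hb D₀ x y = 0 := by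
  constructor
  · intro h x hx y hy
    obtain ⟨s⟩ := ‹Nonempty M›
    have h1 := h (fun s => Θ s x) (fun s => Θ s y) (hΦ.smooth_const x) (hΦ.smooth_const y)
      (fun s => (hV s _).2 (by rwa [hΦ.apply_inv]))
      (fun s => (mem_perp_iff hΦ hV _).2 (by rwa [hΦ.apply_inv])) s
    rwa [ricci_eq_ricciPoint hΦ hb hR (hΦ.smooth_const x) (hΦ.smooth_const y), hΦ.apply_inv,
      hΦ.apply_inv] at h1
  · intro h ψ φ hψ hφ hψW hφW s
    rw [ricci_eq_ricciPoint hΦ hb hR hψ hφ]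
    exact h _ ((hV s _).1 (hψW s)) _ ((mem_perp_iff hΦ hV _).1 (hφW s))

end Trivialization

/-! ### The two trivializations and the conclusion -/

section Main

variable {E : Type*} [NormedAddCommGroup E] [NormedSpace ℝ E] [FiniteDimensional ℝ E]
  {D : Type*} [TopologicalSpace D] [ChartedSpace E D] [Group D] [LieGroup 𝓘(ℝ, E) ∞ D]
  {b : LinearMap.BilinForm ℝ E}

theorem isTrivialization_quadraticLie :
    IsTrivialization E (quadraticLie D b) b (fun _ => LinearMap.id) (fun _ e => e) where
  bijective _ := Function.bijective_id
  apply_inv _ _ := rfl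
  pairing _ _ _ := rfl
  smooth_const _ := isSection_punit _
  finrank_eq := rfl

theorem scalarPlus_pointConn (hb : b.Nondegenerate) (Wp : Submodule ℝ E)
    (D₀ : E →ₗ[ℝ] E →ₗ[ℝ] E) :
    (quadraticLie D b).scalarPlus E (fun _ => Wp) (pointConn D₀) PUnit.unit
      = bilinTrace (genMetricPoint b Wp) (ricciPoint D hb D₀) :=
  scalarPlus_eq_bilinTrace isTrivialization_quadraticLie (fun _ _ => Iff.rfl) hb
    (fun f x y z _ _ _ _ => riemann_pointConn D hb D₀ f x y z) _

theorem ricciMixedVanishes_pointConn_iff (hb : b.Nondegenerate) (Wp : Submodule ℝ E)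
    (D₀ : E →ₗ[ℝ] E →ₗ[ℝ] E) :
    (quadraticLie D b).RicciMixedVanishes E (fun _ => Wp) (pointConn D₀) ↔
      ∀ x ∈ Wp, ∀ y ∈ b.orthogonal Wp, ricciPoint D hb D₀ x y = 0 :=
  ricciMixedVanishes_iff isTrivialization_quadraticLie (fun _ _ => Iff.rfl) hb
    (fun f x y z _ _ _ _ => riemann_pointConn D hb D₀ f x y z)

variable {G : Subgroup D}
  {F : Type*} [NormedAddCommGroup F] [NormedSpace ℝ F] [FiniteDimensional ℝ F]
  [ChartedSpace F (D ⧸ G)] [IsManifold 𝓘(ℝ, F) ∞ (D ⧸ G)]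
  (hb : b.Nondegenerate) (hsymm : ∀ x y, b x y = b y x)
  (hlag : ∀ (s : D ⧸ G) (x : E), rho G F s x = 0 ↔ ∀ y, rho G F s y = 0 → b x y = 0)
  (hact : ContMDiff (𝓘(ℝ, E).prod 𝓘(ℝ, F)) 𝓘(ℝ, F) ∞ (fun p : D × (D ⧸ G) => p.1 • p.2))
  {σ : ∀ s : D ⧸ G, TangentSpace 𝓘(ℝ, F) s →L[ℝ] E} (hσ : IsIsotropicSplitting G F b σ)

include hsymm hlag hact hσ in
theorem isTrivialization_courantSigma :
    IsTrivialization (F × (F →L[ℝ] ℝ)) (courantSigma G F hb σ) b (Psi G F hb σ)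
      (fun s e => (rho G F s e, sigmaCov b (σ s) e)) where
  bijective := Psi_bijective hb hlag hσ.rho_comp hσ.isotropic
  apply_inv := Psi_inverse_apply hb hlag hσ.rho_comp hσ.isotropic
  pairing _ p q := (pairing_Psi hb hsymm hlag hσ.rho_comp hσ.isotropic p q).symm
  smooth_const e := isSection_Psi_inverse hact hσ contMDiff_const
  finrank_eq := by
    -- The rank of `𝕋S` is read off at the base coset, whose fibre is the model space `F × (F →L[ℝ]
    -- ℝ)`.
    let s : D ⧸ G := ((1 : D) : D ⧸ G)
    let Ψ : (F × (F →L[ℝ] ℝ)) →ₗ[ℝ] E := Psi G F hb σ s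
    exact (LinearEquiv.ofBijective Ψ
      (Psi_bijective hb hlag hσ.rho_comp hσ.isotropic s)).finrank_eq

end Main

end PoissonLie

end

theorem mainTheorem5
    {E : Type*} [NormedAddCommGroup E] [NormedSpace ℝ E] [FiniteDimensional ℝ E]
    {D : Type*} [TopologicalSpace D] [T2Space D] [ChartedSpace E D] [Group D]
    [LieGroup 𝓘(ℝ, E) ∞ D] [ConnectedSpace D]
    (b : LinearMap.BilinForm ℝ E) (hb : PoissonLie.IsQuadratic D b)
    (G : Subgroup D) (hGclosed : IsClosed (G : Set D)) (hGconn : IsConnected (G : Set D))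
    (hG : ∀ x : E, x ∈ PoissonLie.lieSubgroup (E := E) G ↔
      ∀ y ∈ PoissonLie.lieSubgroup (E := E) G, b x y = 0)
    {F : Type*} [NormedAddCommGroup F] [NormedSpace ℝ F] [FiniteDimensional ℝ F]
    [ChartedSpace F (D ⧸ G)] [IsManifold 𝓘(ℝ, F) ∞ (D ⧸ G)]
    (hsmooth : ContMDiff 𝓘(ℝ, E) 𝓘(ℝ, F) ∞ (fun d : D => (d : D ⧸ G)))
    (hsubm : ∀ d : D, Function.Surjective
      (mfderiv 𝓘(ℝ, E) 𝓘(ℝ, F) (fun d : D => (d : D ⧸ G)) d))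
    (σ : ∀ s : D ⧸ G, TangentSpace 𝓘(ℝ, F) s →L[ℝ] E)
    (hσ : PoissonLie.IsIsotropicSplitting G F b σ)
    (Wp : Submodule ℝ E) (hWp : PoissonLie.IsMaximalPositive b Wp)
    (D₀ : E →ₗ[ℝ] E →ₗ[ℝ] E)
    (hD₀ : PoissonLie.IsLeviCivita E (PoissonLie.quadraticLie D b) (fun _ => Wp)
      (PoissonLie.pointConn D₀)) :
    PoissonLie.IsLeviCivita (F × (F →L[ℝ] ℝ))
        (PoissonLie.courantSigma G F hb.nondegenerate σ)
        (PoissonLie.Vplus G F hb.nondegenerate σ Wp)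
        (PoissonLie.connSigma G F hb.nondegenerate σ D₀) ∧
    (∀ s : D ⧸ G,
      (PoissonLie.courantSigma G F hb.nondegenerate σ).scalarPlus (F × (F →L[ℝ] ℝ))
          (PoissonLie.Vplus G F hb.nondegenerate σ Wp)
          (PoissonLie.connSigma G F hb.nondegenerate σ D₀) s
        = (PoissonLie.quadraticLie D b).scalarPlus E (fun _ => Wp)
          (PoissonLie.pointConn D₀) PUnit.unit) ∧
    ((PoissonLie.courantSigma G F hb.nondegenerate σ).RicciMixedVanishes (F × (F →L[ℝ] ℝ))
          (PoissonLie.Vplus G F hb.nondegenerate σ Wp)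
          (PoissonLie.connSigma G F hb.nondegenerate σ D₀) ↔
      (PoissonLie.quadraticLie D b).RicciMixedVanishes E (fun _ => Wp)
          (PoissonLie.pointConn D₀)) := by
  have hact := PoissonLie.contMDiff_coset_smul hsmooth hsubm
  have hlag := PoissonLie.rho_eq_zero_iff_orthogonal hsmooth hsubm hb hG
  have ht := PoissonLie.isTrivialization_courantSigma hb.nondegenerate hb.symm hlag hact hσ
  have hR := fun f x y z hf hx hy hz => PoissonLie.riemann_connSigma (f := f) (x := x) (y := y)
    (z := z) (D₀ := D₀) hb.nondegenerate hlag hact hσ hb hf hx hy hz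
  refine ⟨PoissonLie.isLeviCivita_connSigma hb.nondegenerate hlag hact hσ hb hD₀, fun s => ?_, ?_⟩
  -- Both scalars are the same trace on `𝔡`, in which `s` and `σ` no longer appear.
  · rw [PoissonLie.scalarPlus_eq_bilinTrace ht (fun _ _ => Iff.rfl) hb.nondegenerate hR,
      PoissonLie.scalarPlus_pointConn hb.nondegenerate]
  · exact (PoissonLie.ricciMixedVanishes_iff ht (fun _ _ => Iff.rfl) hb.nondegenerate hR).trans
      (PoissonLie.ricciMixedVanishes_pointConn_iff hb.nondegenerate Wp D₀).symm
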